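/- **Setting.** Let $N$ agents minimize a risk $J(w)=\mathbb{E}\,Q(w,x)$, $w\in\mathbb{R}^M$, where $x\sim\mathcal{X}$ and the loss $Q$ is integrable in $x$ and differentiable in $w$. The samples $x_{k,i}$ ($1\le k\le N$, $i\ge 1$) are independent with common law $\mathcal{X}$, and are independent of the initial estimates $w_{k,0}$, which have finite second moments. With step sizes $\mu(i)=\mu/i$, $\mu>0$, the diffusion algorithm is $$\psi_{k,i}=w_{k,i-1}-\mu(i)\nabla_wQ(w_{k,i-1},x_{k,i}),\qquad w_{k,i}=\sum_{\ell=1}^N a_{\ell k}\psi_{\ell,i}.$$ Assume: 1. $J$ is twice continuously differentiable and $\underline\lambda I\le\nabla^2J(w)\le\overline\lambda I$ for all $w$, for some constants $0<\underline\lambda\le\overline\lambda<\infty$; $w^o$ is the minimizer of $J$. 2. The gradient noise $v_{k,i}(w)=\nabla_wQ(w,x_{k,i})-\nabla J(w)$ satisfies $\mathbb{E}[v_{k,i}(w)\mid\mathcal{F}_{i-1}]=0$ and $\mathbb{E}[\|v_{k,i}(w)\|^2\mid\mathcal{F}_{i-1}]\le\alpha\|w^o-w\|^2+\sigma_v^2$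 for all square-integrable $\mathcal{F}_{i-1}$-measurable $w$, where $\mathcal{F}_{i-1}$ is generated by all $w_{k,j}$ with $j\le i-1$, and $\alpha\ge0$, $\sigma_v^2>0$. 3. $A=(a_{\ell k})$ is left-stochastic (non-negative entries, columns adding up to one) and primitive; $p$ is its right eigenvector, $Ap=p$, normalized by $\mathbb{1}^{\mathsf T}p=1$. Let $R_v(w)=\mathbb{E}\{v_{k,i}(w)v_{k,i}(w)^{\mathsf T}\}$ and $R_v=R_v(w^o)$; let $\nabla^2J(w^o)=\Phi\Lambda\Phi^{\mathsf T}$ with $\Phi$ orthogonal and $\Lambda=\mathrm{diag}(\lambda_1,\dots,\lambda_M)$, and let $\lambda_{\min}=\min_m\lambda_m$. Put $\mathcal{A}=A\otimes I_M$, $\mathcal{G}=\mathcal{A}^{\mathsf T}(I_N\otimes R_v)\mathcal{A}$, $\mathcal{B}_t=\mathcal{A}^{\mathsf T}\bigl[I_{MN}-\mu(t)(I_N\otimes\nabla^2J(w^o))^{\mathsf T}\bigr]$ and, for a fixed agent $k$, $\Sigma=\frac12E_{kk}\otimes\nabla^2J(w^o)$, where $E_{kk}$ is the $N\times N$ matrix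 whose only non-zero entry is a one at position $(k,k)$. Define $$\alpha_m(i)=\begin{cases}\dfrac{1}{(2\lambda_m\mu-1)\,i},&2\lambda_m\mu>1,\\[2mm]\dfrac{\log i}{i},&2\lambda_m\mu=1,\\[2mm]\dfrac{{}_3F_2(1,1,1;2-\lambda_m\mu,2-\lambda_m\mu;1)}{\Gamma(2-\lambda_m\mu)^2}\,i^{-2\lambda_m\mu},&2\lambda_m\mu<1,\end{cases}\qquad g(i)=\frac{\mu^2}{2}\Bigl(\sum_{m=1}^M\lambda_m\alpha_m(i)(\Phi^{\mathsf T}R_v\Phi)_{mm}\Bigr)\|p\|_2^2 .$$ **Theorem (convergence rate of the asymptotic term).** (a) The hypergeometric series in $\alpha_m(i)$ converges when $2\lambda_m\mu<1$, and, as $i\to\infty$, $$f(i):=\sum_{j=1}^{i-1}\mu^2(j)\,\mathsf{Tr}\Bigl(\mathcal{G}^{\mathsf T}\Bigl(\prod_{t=j+1}^{i-1}\mathcal{B}_t^{\mathsf T}\Bigr)\Sigma\Bigl(\prod_{t=j+1}^{i-1}\mathcal{B}_t^{\mathsf T}\Bigr)^{\mathsf T}\Bigr)\sim g(i),$$ that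 is, $f-g=o(g)$; if $R_v\ne0$, this means $f(i)/g(i)\to1$. (b) Let $2\lambda_{\min}\mu\ge1$. Suppose that $w\mapsto R_v(w)$ is continuous at $w^o$, and that $(\Phi^{\mathsf T}R_v\Phi)_{mm}\ne0$ for some $m$ which, if $2\lambda_{\min}\mu=1$, satisfies $\lambda_m=\lambda_{\min}$. In the threshold case $2\lambda_{\min}\mu=1$ suppose also that $\nabla^2J$ is Hölder continuous at $w^o$, i.e. $\nabla^2J(w)-\nabla^2J(w^o)=O(\|w-w^o\|^\beta)$ as $w\to w^o$ for some $\beta>0$. Then for every $\nu>0$ $$\liminf_{i\to\infty}\Pr\Bigl\{J(w_{k,i-1})-J(w^o)\le\frac{g(i)}{\nu}\Bigr\}\ge1-\nu .$$ -/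

import Mathlib

open MeasureTheory ProbabilityTheory Filter Topology Asymptotics
open scoped Kronecker Matrix

namespace Diffusion

/-- The parameter space `ℝ^M` with its Euclidean norm. -/
abbrev Param (M : ℕ) : Type := EuclideanSpace ℝ (Fin M)

section Risk

variable {M : ℕ} {S : Type*}

/-- The risk `J(w) = E_D Q(w, x)` of a loss function `Q` under the data distribution `D`. -/
noncomputable def risk [MeasurableSpace S] (Q : Param M → S → ℝ) (D : Measure S) (w : Param M) : ℝ :=
  ∫ x, Q w x ∂D

/-- The instantaneous gradient `∇_w Q(w, x)` of the loss. -/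
noncomputable def lossGrad (Q : Param M → S → ℝ) (w : Param M) (x : S) : Param M :=
  gradient (fun u => Q u x) w

/-- The Hessian matrix of a function on `ℝ^M`. -/
noncomputable def hessian (J : Param M → ℝ) (w : Param M) : Matrix (Fin M) (Fin M) ℝ :=
  Matrix.of fun a b =>
    fderiv ℝ (fderiv ℝ J) w (EuclideanSpace.single a 1) (EuclideanSpace.single b 1)

/-- Twice continuously differentiable, with Hessian between `lo * I` and `hi * I` everywhere
(in the positive semidefinite order). -/
structure BoundedHessian (J : Param M → ℝ) (lo hi : ℝ) : Prop where
  contDiff : ContDiff ℝ 2 J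
  lo_pos : 0 < lo
  lo_le_hi : lo ≤ hi
  lower : ∀ w, (hessian J w - lo • (1 : Matrix (Fin M) (Fin M) ℝ)).PosSemidef
  upper : ∀ w, (hi • (1 : Matrix (Fin M) (Fin M) ℝ) - hessian J w).PosSemidef

/-- The gradient noise `∇_w Q(w, x) - ∇ J(w)`. -/
noncomputable def gradNoise [MeasurableSpace S] (Q : Param M → S → ℝ) (D : Measure S)
    (w : Param M) (x : S) : Param M :=
  lossGrad Q w x - gradient (risk Q D) w

/-- The second-moment matrix `E v(w) v(w)ᵀ` of the gradient noise at `w`. -/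
noncomputable def noiseCov [MeasurableSpace S] (Q : Param M → S → ℝ) (D : Measure S)
    (w : Param M) : Matrix (Fin M) (Fin M) ℝ :=
  Matrix.of fun a b => ∫ x, gradNoise Q D w x a * gradNoise Q D w x b ∂D

end Risk

section Algorithm

variable {M N : ℕ} {S Ω : Type*}

/-- The diffusion strategy (adapt, then combine):
`ψ_{l,i} = w_{l,i-1} - μ(i) ∇_w Q(w_{l,i-1}, x_{l,i})`, `w_{k,i} = ∑_l a_{lk} ψ_{l,i}`.
`estimate Q A step x w₀ i k` is `w_{k,i}`; the sample `x l i` is used at time `i ≥ 1`. -/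
noncomputable def estimate (Q : Param M → S → ℝ) (A : Matrix (Fin N) (Fin N) ℝ) (step : ℕ → ℝ)
    (x : Fin N → ℕ → Ω → S) (w₀ : Fin N → Ω → Param M) : ℕ → Fin N → Ω → Param M
  | 0, k, ω => w₀ k ω
  | i + 1, k, ω => ∑ l, A l k •
      (estimate Q A step x w₀ i l ω -
        step (i + 1) • lossGrad Q (estimate Q A step x w₀ i l ω) (x l (i + 1) ω))

/-- The past history: the σ-algebra generated by all `w_{k,j}` with `j ≤ n`. -/
abbrev history (w : ℕ → Fin N → Ω → Param M) (n : ℕ) : MeasurableSpace Ω :=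
  ⨆ k : Fin N, ⨆ j : Fin (n + 1), MeasurableSpace.comap (w j k) inferInstance

/-- The gradient noise model: for each agent `k`, each time `i ≥ 1` and each square-integrable `W`
that is measurable with respect to the past history up to time `i - 1`, the gradient noise at `W`
has zero conditional mean and conditional second moment at most `α ‖w° - W‖² + σ²`. -/
def GradientNoiseModel [MeasurableSpace S] [MeasurableSpace Ω] (P : Measure Ω)
    (Q : Param M → S → ℝ) (D : Measure S) (x : Fin N → ℕ → Ω → S)
    (w : ℕ → Fin N → Ω → Param M) (wo : Param M) (α σsq : ℝ) : Prop :=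
  ∀ (k : Fin N) (i : ℕ), 1 ≤ i → ∀ W : Ω → Param M,
    Measurable[history w (i - 1)] W → MemLp W 2 P →
      MemLp (fun ω => gradNoise Q D (W ω) (x k i ω)) 2 P ∧
      P[fun ω => gradNoise Q D (W ω) (x k i ω) | history w (i - 1)] =ᵐ[P] 0 ∧
      P[fun ω => ‖gradNoise Q D (W ω) (x k i ω)‖ ^ 2 | history w (i - 1)] ≤ᵐ[P]
        fun ω => α * ‖wo - W ω‖ ^ 2 + σsq

/-- Left-stochastic (non-negative entries, each column adds up to one) and primitive. -/
structure LeftStochasticPrimitive (A : Matrix (Fin N) (Fin N) ℝ) : Prop where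
  col_sum : ∀ k, ∑ l, A l k = 1
  primitive : A.IsPrimitive

end Algorithm

section Network

variable {M N : ℕ}

/-- `𝒜 = A ⊗ I_M`. -/
def netA (A : Matrix (Fin N) (Fin N) ℝ) : Matrix (Fin N × Fin M) (Fin N × Fin M) ℝ :=
  A ⊗ₖ (1 : Matrix (Fin M) (Fin M) ℝ)

/-- `ℬ_t = 𝒜ᵀ (I_{MN} - μ(t) ℋᵀ)` with `ℋ = I_N ⊗ H`. -/
def netB (A : Matrix (Fin N) (Fin N) ℝ) (H : Matrix (Fin M) (Fin M) ℝ) (step : ℕ → ℝ) (t : ℕ) :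
    Matrix (Fin N × Fin M) (Fin N × Fin M) ℝ :=
  (netA A)ᵀ * (1 - step t • ((1 : Matrix (Fin N) (Fin N) ℝ) ⊗ₖ H)ᵀ)

/-- `𝒢 = 𝒜ᵀ (I_N ⊗ R) 𝒜`. -/
def netG (A : Matrix (Fin N) (Fin N) ℝ) (R : Matrix (Fin M) (Fin M) ℝ) :
    Matrix (Fin N × Fin M) (Fin N × Fin M) ℝ :=
  (netA A)ᵀ * ((1 : Matrix (Fin N) (Fin N) ℝ) ⊗ₖ R) * netA A

/-- `Σ = ½ E_{kk} ⊗ H`. -/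
noncomputable def netSigma (k : Fin N) (H : Matrix (Fin M) (Fin M) ℝ) :
    Matrix (Fin N × Fin M) (Fin N × Fin M) ℝ :=
  (1 / 2 : ℝ) • (Matrix.single k k (1 : ℝ) ⊗ₖ H)

/-- The ordered product `ℬ_{j+1}ᵀ ℬ_{j+2}ᵀ ⋯ ℬ_{i-1}ᵀ` (the identity if it is empty). -/
def netProd (A : Matrix (Fin N) (Fin N) ℝ) (H : Matrix (Fin M) (Fin M) ℝ) (step : ℕ → ℝ)
    (j i : ℕ) : Matrix (Fin N × Fin M) (Fin N × Fin M) ℝ :=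
  ((List.Ico (j + 1) i).map fun t => (netB A H step t)ᵀ).prod

/-- The asymptotic term
`∑_{j=1}^{i-1} μ(j)² Tr(𝒢ᵀ (∏_{t=j+1}^{i-1} ℬ_tᵀ) Σ (∏_{t=j+1}^{i-1} ℬ_tᵀ)ᵀ)`. -/
noncomputable def asymptoticTerm (A : Matrix (Fin N) (Fin N) ℝ) (H R : Matrix (Fin M) (Fin M) ℝ)
    (step : ℕ → ℝ) (k : Fin N) (i : ℕ) : ℝ :=
  ∑ j ∈ Finset.Ico 1 i, step j ^ 2 *
    ((netG A R)ᵀ * netProd A H step j i * netSigma k H * (netProd A H step j i)ᵀ).trace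

end Network

section Rates

/-- The `n`-th term of the hypergeometric series `₃F₂(a₁, a₂, a₃; b₁, b₂; z)`. -/
noncomputable def hyp3F2Term (a₁ a₂ a₃ b₁ b₂ z : ℝ) (n : ℕ) : ℝ :=
  ((ascPochhammer ℝ n).eval a₁ * (ascPochhammer ℝ n).eval a₂ * (ascPochhammer ℝ n).eval a₃) /
    ((ascPochhammer ℝ n).eval b₁ * (ascPochhammer ℝ n).eval b₂) * (z ^ n / (n.factorial : ℝ))

/-- The generalized hypergeometric function `₃F₂(a₁, a₂, a₃; b₁, b₂; z)`, as the sum of its series. -/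
noncomputable def hyp3F2 (a₁ a₂ a₃ b₁ b₂ z : ℝ) : ℝ :=
  ∑' n : ℕ, hyp3F2Term a₁ a₂ a₃ b₁ b₂ z n

/-- The rate `δ(i)` attached to an eigenvalue `l` and the step-size constant `μ`. -/
noncomputable def deltaRate (l μ : ℝ) (i : ℕ) : ℝ :=
  if 1 < 2 * l * μ then 1 / (i : ℝ)
  else if 2 * l * μ = 1 then Real.log i / i
  else 1 / (i : ℝ) ^ (2 * l * μ)

/-- The coefficient `α(i)` attached to an eigenvalue `l` and the step-size constant `μ`. -/
noncomputable def alphaRate (l μ : ℝ) (i : ℕ) : ℝ :=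
  if 1 < 2 * l * μ then deltaRate l μ i / (2 * l * μ - 1)
  else if 2 * l * μ = 1 then deltaRate l μ i
  else hyp3F2 1 1 1 (2 - l * μ) (2 - l * μ) 1 * deltaRate l μ i / Real.Gamma (2 - l * μ) ^ 2

/-- The closed form `(μ²/2) (∑_m λ_m α_m(i) (Φᵀ R Φ)_{mm}) ‖p‖²`. -/
noncomputable def closedForm {M N : ℕ} (μ : ℝ) (lam : Fin M → ℝ) (Φ R : Matrix (Fin M) (Fin M) ℝ)
    (p : EuclideanSpace ℝ (Fin N)) (i : ℕ) : ℝ :=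
  μ ^ 2 / 2 * (∑ m, lam m * alphaRate (lam m) μ i * (Φᵀ * R * Φ) m m) * ‖p‖ ^ 2

end Rates

end Diffusion

/-!
Along an eigenvector of the Hessian with eigenvalue `λ`, the linearized recursion multiplies the
error by `1 - λ μ / t` at time `t`, while the noise of step `j` enters with variance of order `j⁻²`.
Everything is measured by the scalar sums `rateSum c i = ∑_{j<i} j⁻² ∏_{j<t<i} (1 - c/t)²` with `c =
λ μ`. Their size is `1 / ((2c - 1) i)`, `log i / i` or a multiple of `i^(-2c)`, according to the
position of `2c` relative to `1` (`rateSum_isEquivalent`). In the last case the product is `i^(-c) /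
Γ(1 - c)` up to a factor tending to one, by Euler's limit for the Gamma function, and what remains
of the sum is the hypergeometric series term by term.

For the asymptotic term, the trace splits into Kronecker factors: it is a superposition over the
eigenvalues of the sums `rateSum`, weighted with `∑_l (A^(i-j))_{lk}²` (`asymptoticTerm_eq`). Powers
of a primitive left-stochastic matrix converge to `p 1ᵀ`, so that the weights tend to `‖p‖²`, except
for a bounded number of `j` close to `i`, each of which contributes `O(i⁻²)` only
(`isLittleO_weighted_rateSum`). This gives `asymptoticTerm_isEquivalent`.

For the excess risk, second moments of the nonlinear recursion cannot be linearized globally, as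
nothing is known about the risk far from its minimizer beyond the bounds on the Hessian. The
argument localizes. The network error `netError`, weighted by `p`, is almost a supermartingale, so
that with probability close to one it stays below `(n + 1)^(-g)` from some time on
(`exists_escape_netError_le`). The event of having stayed there up to time `n` is known at time `n`,
and on it:

* the agents agree up to `O(n⁻²)` in mean square, by the geometric convergence of the powers of `A`
  (`norm_deviation_le`, `exists_spread_rate`);
* every mode of their weighted average obeys the linear recursion up to `o(n⁻²)`, as the gradient is
  nearly linear and the noise covariance nearly constant (`integral_mode_centroid_succ_le`), and
  hence decays at its own rate with the expected constant (`eventually_localized_mode_le`);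
* the excess risk is the quadratic form of the Hessian in these modes, up to a factor close to one
  (`exists_sub_le_modes`).

So the localized mean of the excess risk is at most `(1 + o(1)) g(i)`, and Markov's inequality
concludes (`eventually_excess_risk_prob_ge`). The mode recursions are coupled through the
linearization error, and closing them needs an a priori rate for the total energy. Above the
threshold that rate is `1 / n`, and continuity of the Hessian suffices. At the threshold it is only
`n^(-q)` with `q < 1`, and the Hölder modulus of the Hessian makes up for the difference.
-/

namespace Diffusion


/-! ### Scalar sums and the hypergeometric series -/

section Rates

/-- The product `∏_{t=j+1}^{i-1} (1 - c/t)` by which a mode with constant `c = λ μ` damps, until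
time `i`, a perturbation that entered at time `j`. -/
noncomputable def decay (c : ℝ) (j i : ℕ) : ℝ := ∏ t ∈ Finset.Ico (j + 1) i, (1 - c / t)

/-- The scalar sum `∑_{j=1}^{i-1} j⁻² ∏_{t=j+1}^{i-1} (1 - c/t)²`. -/
noncomputable def rateSum (c : ℝ) (i : ℕ) : ℝ := ∑ j ∈ Finset.Ico 1 i, decay c j i ^ 2 / (j : ℝ) ^ 2

lemma decay_succ (c : ℝ) {j i : ℕ} (h : j < i) : decay c j (i + 1) = (1 - c / i) * decay c j i := by
  rw [decay, Finset.prod_Ico_succ_top (by omega), mul_comm]; rfl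

lemma decay_self_succ (c : ℝ) (i : ℕ) : decay c i (i + 1) = 1 := by simp [decay]

lemma decay_mul (c : ℝ) {j i : ℕ} (h : j < i) : decay c 0 (j + 1) * decay c j i = decay c 0 i := by
  simpa [decay] using Finset.prod_Ico_consecutive (fun t : ℕ => 1 - c / t) (by omega : 1 ≤ j + 1) h

lemma rateSum_succ (c : ℝ) {i : ℕ} (h : 1 ≤ i) :
    rateSum c (i + 1) = (1 - c / i) ^ 2 * rateSum c i + 1 / (i : ℝ) ^ 2 := by
  rw [rateSum, Finset.sum_Ico_succ_top h, decay_self_succ, rateSum, Finset.mul_sum]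
  congr 1
  · refine Finset.sum_congr rfl fun j hj => ?_
    rw [decay_succ c (Finset.mem_Ico.1 hj).2]; ring
  · simp

lemma rateSum_nonneg (c : ℝ) (i : ℕ) : 0 ≤ rateSum c i :=
  Finset.sum_nonneg fun _ _ => by positivity

lemma rpow_mul_one_sub_le {x q : ℝ} (hx : 0 < x) (hq : 0 ≤ q) :
    x ^ (-q) * (1 - q / x) ≤ (x + 1) ^ (-q) := by
  have h1 : (x + 1) ^ (-q) = x ^ (-q) * (1 + 1 / x) ^ (-q) := by
    rw [← Real.mul_rpow hx.le (by positivity)]; congr 1; field_simp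
  rw [h1]
  refine mul_le_mul_of_nonneg_left ?_ (by positivity)
  rw [Real.rpow_def_of_pos (by positivity)]
  have h2 : Real.log (1 + 1 / x) ≤ 1 / x := by
    have := Real.log_le_sub_one_of_pos (show (0 : ℝ) < 1 + 1 / x by positivity); linarith
  have h3 := Real.add_one_le_exp (Real.log (1 + 1 / x) * -q)
  have h4 : Real.log (1 + 1 / x) * q ≤ 1 / x * q := mul_le_mul_of_nonneg_right h2 hq
  have h5 : q / x = 1 / x * q := by ring
  linarith

/-- A discrete Gronwall estimate: relative damping `q' / n` against forcing of order `n ^ (-1 - q)`,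
`q < q'`, forces decay of order `n ^ (-q)`. -/
lemma rate_of_recursion {x : ℕ → ℝ} {q q' C : ℝ} (hq : 0 ≤ q) (hqq : q < q')
    (h : ∀ᶠ n : ℕ in atTop,
      x (n + 1) ≤ (1 - q' / (n + 1)) * x n + C * ((n : ℝ) + 1) ^ (-1 - q)) :
    ∃ K > 0, ∀ᶠ n : ℕ in atTop, x n ≤ K * ((n : ℝ) + 1) ^ (-q) := by
  obtain ⟨n0, hn0⟩ := eventually_atTop.1 (h.and (eventually_ge_atTop ⌈q'⌉₊))
  set K := max 1 (max (C / (q' - q)) (x n0 * ((n0 : ℝ) + 1) ^ q))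
  have hK0 : 0 < K := lt_of_lt_of_le one_pos (le_max_left _ _)
  have hK1 : C ≤ K * (q' - q) := by
    rw [← div_le_iff₀ (by linarith)]
    exact (le_max_left _ _).trans (le_max_right _ _)
  have hK2 : x n0 * ((n0 : ℝ) + 1) ^ q ≤ K := (le_max_right _ _).trans (le_max_right _ _)
  refine ⟨K, hK0, eventually_atTop.2 ⟨n0, fun n hn => ?_⟩⟩
  induction n, hn using Nat.le_induction with
  | base =>
    rw [Real.rpow_neg (by positivity), ← div_eq_mul_inv, le_div_iff₀ (by positivity)]
    exact hK2
  | succ n hn ih =>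
    obtain ⟨h1, h2⟩ := hn0 n hn
    have hN : (0 : ℝ) < (n : ℝ) + 1 := by positivity
    have h3 : q' ≤ (n : ℝ) + 1 := (Nat.ceil_le.1 h2).trans (by linarith)
    have h4 : 0 ≤ 1 - q' / ((n : ℝ) + 1) := by
      rw [sub_nonneg, div_le_one hN]; exact h3
    have h5 : ((n : ℝ) + 1) ^ (-1 - q) = ((n : ℝ) + 1) ^ (-q) / ((n : ℝ) + 1) := by
      rw [show -1 - q = -q - 1 by ring, Real.rpow_sub_one hN.ne']
    have h6 := rpow_mul_one_sub_le hN hq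
    have hP : 0 < ((n : ℝ) + 1) ^ (-q) := by positivity
    push_cast
    calc x (n + 1) ≤ (1 - q' / (n + 1)) * (K * ((n : ℝ) + 1) ^ (-q))
          + C * ((n : ℝ) + 1) ^ (-1 - q) := by
            have := mul_le_mul_of_nonneg_left ih h4; linarith
      _ ≤ (1 - q' / (n + 1)) * (K * ((n : ℝ) + 1) ^ (-q))
          + (K * (q' - q)) * (((n : ℝ) + 1) ^ (-q) / ((n : ℝ) + 1)) := by
            rw [h5]; gcongr
      _ = K * (((n : ℝ) + 1) ^ (-q) * (1 - q / ((n : ℝ) + 1))) := by field_simp; ring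
      _ ≤ K * ((n : ℝ) + 1 + 1) ^ (-q) := by gcongr

lemma eventually_sq_le {c q' : ℝ} (h : q' < 2 * c) :
    ∀ᶠ n : ℕ in atTop, (1 - c / ((n : ℝ) + 1)) ^ 2 ≤ 1 - q' / ((n : ℝ) + 1) := by
  have h1 : Tendsto (fun n : ℕ => c ^ 2 / ((n : ℝ) + 1)) atTop (𝓝 0) := by
    simpa [div_eq_mul_inv] using
      (tendsto_one_div_add_atTop_nhds_zero_nat (𝕜 := ℝ)).const_mul (c ^ 2)
  filter_upwards [h1.eventually_lt_const (show 0 < 2 * c - q' by linarith)] with n hn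
  have hN : (0 : ℝ) < (n : ℝ) + 1 := by positivity
  have : 1 - q' / ((n : ℝ) + 1) - (1 - c / ((n : ℝ) + 1)) ^ 2
      = (2 * c - q' - c ^ 2 / ((n : ℝ) + 1)) / ((n : ℝ) + 1) := by field_simp; ring
  have h2 : 0 ≤ (2 * c - q' - c ^ 2 / ((n : ℝ) + 1)) / ((n : ℝ) + 1) :=
    div_nonneg (by linarith) hN.le
  linarith

lemma tendsto_mul_of_le_rpow {x : ℕ → ℝ} {q K : ℝ} (hq : 1 < q)
    (h : ∀ᶠ n : ℕ in atTop, |x n| ≤ K * ((n : ℝ) + 1) ^ (-q)) :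
    Tendsto (fun n : ℕ => ((n : ℝ) + 1) * x n) atTop (𝓝 0) := by
  have h1 : Tendsto (fun n : ℕ => K * ((n : ℝ) + 1) ^ (-(q - 1))) atTop (𝓝 0) := by
    have : Tendsto (fun n : ℕ => ((n : ℝ) + 1) ^ (-(q - 1))) atTop (𝓝 0) :=
      (tendsto_rpow_neg_atTop (by linarith)).comp
        (tendsto_atTop_add_const_right _ 1 tendsto_natCast_atTop_atTop)
    simpa using this.const_mul K
  refine squeeze_zero_norm' ?_ h1
  filter_upwards [h] with n hn
  have hN : (0 : ℝ) < (n : ℝ) + 1 := by positivity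
  rw [norm_mul, Real.norm_eq_abs, Real.norm_eq_abs, abs_of_pos hN]
  calc ((n : ℝ) + 1) * |x n| ≤ ((n : ℝ) + 1) * (K * ((n : ℝ) + 1) ^ (-q)) := by gcongr
    _ = K * ((n : ℝ) + 1) ^ (-(q - 1)) := by
      rw [show -(q - 1) = -q + 1 by ring, Real.rpow_add_one hN.ne']; ring

/-- Above the threshold, `i ∑_j j⁻² ∏ (1 - c/t)² → 1 / (2c - 1)`: the difference to
`1 / ((2c - 1) i)` obeys the same recursion with forcing of order `i⁻³`. -/
lemma tendsto_rateSum_of_one_lt {c : ℝ} (hc : 1 < 2 * c) :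
    Tendsto (fun i : ℕ => (i : ℝ) * rateSum c i) atTop (𝓝 (1 / (2 * c - 1))) := by
  set e : ℕ → ℝ := fun n => rateSum c (n + 1) - 1 / ((2 * c - 1) * (n + 1)) with he
  obtain ⟨q, hq1, hq2⟩ : ∃ q, 1 < q ∧ q < min (2 * c) 2 := exists_between (by simp [hc])
  obtain ⟨q', hq3, hq4⟩ := exists_between (hq2.trans_le (min_le_left _ _))
  have hq5 : q ≤ 2 := (hq2.trans_le (min_le_right _ _)).le
  have hd : 0 < 2 * c - 1 := by linarith
  set C := (1 + c ^ 2) / (2 * c - 1)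
  have hstep : ∀ n, |e (n + 1)| ≤ (1 - c / ((n : ℝ) + 1)) ^ 2 * |e n|
      + C * (1 / ((n : ℝ) + 1) ^ 3) := by
    intro n
    have hN : (0 : ℝ) < (n : ℝ) + 1 := by positivity
    have h1 : e (n + 1) = (1 - c / ((n : ℝ) + 1)) ^ 2 * e n
        + (c ^ 2 / ((n : ℝ) + 1) ^ 3 - 1 / (((n : ℝ) + 1) ^ 2 * ((n : ℝ) + 1 + 1))) / (2 * c - 1) := by
      simp only [he]
      rw [rateSum_succ c (by omega : 1 ≤ n + 1)]
      push_cast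
      generalize rateSum c (n + 1) = r
      obtain ⟨d, hdc⟩ : ∃ d, d = 2 * c - 1 := ⟨_, rfl⟩
      have hc' : c = (1 + d) / 2 := by linarith
      rw [← hdc] at hd ⊢
      rw [hc']
      field_simp
      ring
    have h2 : |(c ^ 2 / ((n : ℝ) + 1) ^ 3 - 1 / (((n : ℝ) + 1) ^ 2 * ((n : ℝ) + 1 + 1))) / (2 * c - 1)|
        ≤ C * (1 / ((n : ℝ) + 1) ^ 3) := by
      rw [abs_div, abs_of_pos hd, div_le_iff₀ hd]
      have h3 : 1 / (((n : ℝ) + 1) ^ 2 * ((n : ℝ) + 1 + 1)) ≤ 1 / ((n : ℝ) + 1) ^ 3 := by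
        apply one_div_le_one_div_of_le (by positivity); nlinarith [sq_nonneg ((n : ℝ) + 1)]
      have h4 : 0 ≤ 1 / (((n : ℝ) + 1) ^ 2 * ((n : ℝ) + 1 + 1)) := by positivity
      have h5 : 0 ≤ c ^ 2 / ((n : ℝ) + 1) ^ 3 := by positivity
      have h6 : C * (1 / ((n : ℝ) + 1) ^ 3) * (2 * c - 1)
          = 1 / ((n : ℝ) + 1) ^ 3 + c ^ 2 / ((n : ℝ) + 1) ^ 3 := by
        simp only [C]; rw [mul_right_comm, div_mul_cancel₀ _ hd.ne']; ring
      rw [h6, abs_le]; constructor <;> linarith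
    rw [h1]
    refine (abs_add_le _ _).trans ?_
    rw [abs_mul, abs_of_nonneg (sq_nonneg (1 - c / ((n : ℝ) + 1)))]
    linarith
  obtain ⟨K, -, hK⟩ := rate_of_recursion (x := fun n => |e n|) (q := q) (q' := q') (C := C)
    (by linarith) hq3 (by
      filter_upwards [eventually_sq_le hq4] with n hn
      refine (hstep n).trans (add_le_add (mul_le_mul_of_nonneg_right hn (abs_nonneg _)) ?_)
      have hN : (1 : ℝ) ≤ (n : ℝ) + 1 := by simp
      refine mul_le_mul_of_nonneg_left ?_ (by positivity)
      rw [one_div, ← Real.rpow_natCast, ← Real.rpow_neg (by positivity)]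
      exact Real.rpow_le_rpow_of_exponent_le hN (by push_cast; linarith))
  have h1 := tendsto_mul_of_le_rpow hq1 hK
  rw [← tendsto_add_atTop_iff_nat 1]
  have h2 := h1.add_const (1 / (2 * c - 1))
  rw [zero_add] at h2
  refine h2.congr fun n => ?_
  simp only [he]
  push_cast
  field_simp
  ring

lemma decay_zero_pos {c : ℝ} (hc : c < 1) (i : ℕ) : 0 < decay c 0 i := by
  refine Finset.prod_pos fun t ht => ?_
  have h1 : (1 : ℝ) ≤ t := by exact_mod_cast (Finset.mem_Ico.1 ht).1
  rw [sub_pos, div_lt_one (by linarith)]; linarith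

lemma prod_range_eq_decay (c : ℝ) (n : ℕ) :
    ∏ j ∈ Finset.range (n + 1), (1 - c + j) = (n + 1).factorial * decay c 0 (n + 2) := by
  induction n with
  | zero => simp [decay]
  | succ n ih =>
    rw [Finset.prod_range_succ, ih, decay_succ c (by omega : 0 < n + 2), Nat.factorial_succ (n + 1)]
    push_cast
    field_simp
    ring

/-- `∏_{t=1}^{i-1} (1 - c/t) ~ i^{-c} / Γ(1 - c)`, a form of Euler's limit for the Gamma function. -/
lemma tendsto_decay_mul_rpow {c : ℝ} (hc : c < 1) :
    Tendsto (fun i : ℕ => decay c 0 i * (i : ℝ) ^ c) atTop (𝓝 (1 / Real.Gamma (1 - c))) := by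
  rw [← tendsto_add_atTop_iff_nat 2]
  have h1 := Real.GammaSeq_tendsto_Gamma (1 - c)
  have hG : 0 < Real.Gamma (1 - c) := Real.Gamma_pos_of_pos (by linarith)
  have h2 : Tendsto (fun n : ℕ => ((n : ℝ) / (n + 1)) * (1 / Real.GammaSeq (1 - c) n) *
      (1 + 2 / (n : ℝ)) ^ c) atTop (𝓝 (1 * (1 / Real.Gamma (1 - c)) * 1)) := by
    refine ((tendsto_natCast_div_add_atTop (1 : ℝ)).mul
      (tendsto_const_nhds.div h1 hG.ne')).mul ?_
    have h3 : Tendsto (fun n : ℕ => 1 + 2 / (n : ℝ)) atTop (𝓝 (1 + 0)) :=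
      tendsto_const_nhds.add (tendsto_const_div_atTop_nhds_zero_nat 2)
    rw [add_zero] at h3
    have := h3.rpow_const (p := c) (Or.inl one_ne_zero)
    simpa using this
  rw [one_mul, mul_one] at h2
  refine h2.congr' ?_
  filter_upwards [eventually_gt_atTop 0] with n hn
  have hn' : (0 : ℝ) < n := by exact_mod_cast hn
  have hD := decay_zero_pos hc (n + 2)
  rw [Real.GammaSeq, prod_range_eq_decay, Nat.factorial_succ]
  push_cast
  have h4 : (1 + 2 / (n : ℝ)) ^ c = ((n : ℝ) + 2) ^ c / (n : ℝ) ^ c := by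
    rw [← Real.div_rpow (by positivity) hn'.le]; congr 1; field_simp
  have h5 : (n : ℝ) ^ (1 - c) = n / (n : ℝ) ^ c := by
    rw [Real.rpow_sub hn', Real.rpow_one]
  rw [h4, h5]
  have : (0 : ℝ) < (n : ℝ) ^ c := by positivity
  field_simp

/-- The summand left when the damping factor common to all terms is taken out of `rateSum`. -/
noncomputable def rateWeight (c : ℝ) (j : ℕ) : ℝ := 1 / ((j : ℝ) * decay c 0 (j + 1)) ^ 2

lemma rateSum_eq {c : ℝ} (hc : c < 1) (i : ℕ) :
    rateSum c i = decay c 0 i ^ 2 * ∑ j ∈ Finset.Ico 1 i, rateWeight c j := by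
  rw [rateSum, Finset.mul_sum]
  refine Finset.sum_congr rfl fun j hj => ?_
  obtain ⟨h1, h2⟩ := Finset.mem_Ico.1 hj
  have hj0 : (0 : ℝ) < j := by exact_mod_cast h1
  have hD := decay_zero_pos hc (j + 1)
  rw [← decay_mul c h2, rateWeight]
  field_simp

lemma tendsto_rateWeight {c : ℝ} (hc : c < 1) :
    Tendsto (fun n : ℕ => rateWeight c (n + 1) * ((n : ℝ) + 2) ^ (2 - 2 * c)) atTop
      (𝓝 (Real.Gamma (1 - c) ^ 2)) := by
  have hG : 0 < Real.Gamma (1 - c) := Real.Gamma_pos_of_pos (by linarith)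
  have h1 := (tendsto_decay_mul_rpow hc)
  rw [← tendsto_add_atTop_iff_nat 2] at h1
  have h2 : Tendsto (fun n : ℕ => ((n : ℝ) + 2) / (n + 1)) atTop (𝓝 1) := by
    have := (tendsto_natCast_div_add_atTop (1 : ℝ)).inv₀ one_ne_zero
    rw [← tendsto_add_atTop_iff_nat 1] at this
    simp only [inv_one, inv_div] at this
    refine this.congr fun n => ?_
    push_cast; ring
  have h3 := (h2.pow 2).mul ((tendsto_const_nhds (x := (1 : ℝ))).div (h1.pow 2) (by positivity))
  have h4 : (1 : ℝ) ^ 2 * (1 / (1 / Real.Gamma (1 - c)) ^ 2) = Real.Gamma (1 - c) ^ 2 := by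
    field_simp
  rw [h4] at h3
  refine h3.congr fun n => ?_
  have hD := decay_zero_pos hc (n + 2)
  have hn : (0 : ℝ) < (n : ℝ) + 2 := by positivity
  have : (0 : ℝ) < ((n : ℝ) + 2) ^ c := by positivity
  have h6 : ((n : ℝ) + 2) ^ (2 * c) = (((n : ℝ) + 2) ^ c) ^ 2 := by
    rw [mul_comm 2 c, Real.rpow_mul hn.le]; norm_cast
  rw [rateWeight, Real.rpow_sub hn, h6, Pi.div_apply]
  push_cast
  rw [Real.rpow_two]
  field_simp

/-- The terms of the hypergeometric series are the summands of `rateSum`, up to the common damping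
factor. -/
lemma hyp3F2Term_eq {c : ℝ} (hc : c < 1) (n : ℕ) :
    hyp3F2Term 1 1 1 (2 - c) (2 - c) 1 n = (1 - c) ^ 2 * rateWeight c (n + 1) := by
  have h1 : (1 - c) * (ascPochhammer ℝ n).eval (2 - c) = (n + 1).factorial * decay c 0 (n + 2) := by
    rw [← prod_range_eq_decay]
    induction n with
    | zero => simp
    | succ n ih =>
      rw [ascPochhammer_succ_eval, Finset.prod_range_succ, ← ih]; push_cast; ring
  have hc' : 0 < 1 - c := by linarith
  have hD := decay_zero_pos hc (n + 2)
  have h2 : (ascPochhammer ℝ n).eval (2 - c) = (n + 1).factorial * decay c 0 (n + 2) / (1 - c) := by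
    rw [← h1]; field_simp
  have h3 : (0 : ℝ) < n.factorial := by positivity
  rw [hyp3F2Term, rateWeight, h2, ascPochhammer_eval_one, Nat.factorial_succ]
  push_cast
  simp only [one_pow]
  field_simp

lemma summable_rateWeight {c : ℝ} (hc : 2 * c < 1) : Summable (fun n => rateWeight c (n + 1)) := by
  have h0 : Summable (fun n : ℕ => ((n : ℝ) + 2) ^ (-(2 - 2 * c))) := by
    have := (Real.summable_nat_rpow (p := -(2 - 2 * c))).2 (by linarith)
    have := (summable_nat_add_iff 2).2 this
    simpa using this
  refine summable_of_isBigO_nat h0 ?_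
  have h1 := (tendsto_rateWeight (by linarith : c < 1)).isBigO_one ℝ
  have h2 := h1.mul (isBigO_refl (fun n : ℕ => ((n : ℝ) + 2) ^ (-(2 - 2 * c))) atTop)
  refine (h2.congr (fun n => ?_) (fun n => ?_))
  · rw [mul_assoc, ← Real.rpow_add (by positivity)]; simp
  · simp

/-- The hypergeometric series in `alphaRate` converges below the threshold. -/
lemma summable_hyp3F2Term {c : ℝ} (hc : 2 * c < 1) :
    Summable (hyp3F2Term 1 1 1 (2 - c) (2 - c) 1) := by
  have := (summable_rateWeight hc).mul_left ((1 - c) ^ 2)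
  refine this.congr fun n => ?_
  rw [hyp3F2Term_eq (by linarith)]

lemma hyp3F2_pos {c : ℝ} (hc : 2 * c < 1) : 0 < hyp3F2 1 1 1 (2 - c) (2 - c) 1 := by
  have h1 : ∀ n, 0 < hyp3F2Term 1 1 1 (2 - c) (2 - c) 1 n := by
    intro n
    rw [hyp3F2Term_eq (by linarith)]
    have := decay_zero_pos (by linarith : c < 1) (n + 1 + 1)
    have : 0 < 1 - c := by linarith
    rw [rateWeight]; positivity
  exact (summable_hyp3F2Term hc).tsum_pos (fun n => (h1 n).le) 0 (h1 0)

/-- Below the threshold the sum is governed by its first terms: with the common damping factor taken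
out it converges, to a multiple of the hypergeometric series. -/
lemma tendsto_rateSum_of_lt_one {c : ℝ} (hc : 2 * c < 1) :
    Tendsto (fun i : ℕ => (i : ℝ) ^ (2 * c) * rateSum c i) atTop
      (𝓝 (hyp3F2 1 1 1 (2 - c) (2 - c) 1 / Real.Gamma (2 - c) ^ 2)) := by
  have hc1 : c < 1 := by linarith
  have hG : 0 < Real.Gamma (1 - c) := Real.Gamma_pos_of_pos (by linarith)
  have h1 := (tendsto_decay_mul_rpow hc1).pow 2
  have h2 : Tendsto (fun i : ℕ => ∑ j ∈ Finset.Ico 1 i, rateWeight c j) atTop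
      (𝓝 (hyp3F2 1 1 1 (2 - c) (2 - c) 1 / (1 - c) ^ 2)) := by
    have h3 : HasSum (fun n => rateWeight c (n + 1))
        (hyp3F2 1 1 1 (2 - c) (2 - c) 1 / (1 - c) ^ 2) := by
      have := (summable_hyp3F2Term hc).hasSum.div_const ((1 - c) ^ 2)
      refine this.congr_fun fun n => ?_
      have : 0 < 1 - c := by linarith
      rw [hyp3F2Term_eq hc1]; field_simp
    have h4 := h3.tendsto_sum_nat
    rw [← tendsto_add_atTop_iff_nat 1]
    refine h4.congr fun n => ?_
    rw [Finset.sum_Ico_eq_sum_range]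
    simp [add_comm]
  have h5 := h1.mul h2
  have h6 : Real.Gamma (2 - c) = (1 - c) * Real.Gamma (1 - c) := by
    rw [← Real.Gamma_add_one (by linarith : (1 : ℝ) - c ≠ 0)]; congr 1; ring
  have h7 : (1 / Real.Gamma (1 - c)) ^ 2 * (hyp3F2 1 1 1 (2 - c) (2 - c) 1 / (1 - c) ^ 2)
      = hyp3F2 1 1 1 (2 - c) (2 - c) 1 / Real.Gamma (2 - c) ^ 2 := by
    have : 0 < 1 - c := by linarith
    rw [h6]; field_simp
  rw [h7] at h5
  refine h5.congr fun i => ?_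
  rw [rateSum_eq hc1, mul_comm 2 c, Real.rpow_mul (by positivity)]
  norm_cast
  ring

/-- At the threshold `2c = 1` the sum grows like the harmonic one. -/
lemma tendsto_rateSum_of_eq_one {c : ℝ} (hc : 2 * c = 1) :
    Tendsto (fun i : ℕ => (i : ℝ) / Real.log i * rateSum c i) atTop (𝓝 1) := by
  have hc1 : c < 1 := by linarith
  have hG : 0 < Real.Gamma (1 - c) := Real.Gamma_pos_of_pos (by linarith)
  set G := Real.Gamma (1 - c) with hGd
  have hlog : Tendsto (fun n : ℕ => Real.log n) atTop atTop :=
    Real.tendsto_log_atTop.comp tendsto_natCast_atTop_atTop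
  -- the partial sums of `1 / (j + 1)` divided by the logarithm tend to one
  have hharm : Tendsto (fun n : ℕ => (∑ j ∈ Finset.range n, 1 / ((j : ℝ) + 1)) / Real.log n) atTop
      (𝓝 1) := by
    have h1 := Real.tendsto_harmonic_sub_log.div_atTop hlog
    have h2 := h1.add_const 1
    rw [zero_add] at h2
    refine h2.congr' ?_
    filter_upwards [hlog.eventually_gt_atTop 0] with n hn
    rw [harmonic]; push_cast
    simp only [one_div]
    field_simp
    ring
  have hdiv : Tendsto (fun n : ℕ => ∑ j ∈ Finset.range n, 1 / ((j : ℝ) + 1)) atTop atTop :=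
    Real.tendsto_sum_range_one_div_nat_succ_atTop
  have hw : Tendsto (fun n : ℕ => rateWeight c (n + 1) * ((n : ℝ) + 1)) atTop (𝓝 (G ^ 2)) := by
    have h1 := (tendsto_rateWeight hc1).mul (tendsto_natCast_div_add_atTop (1 : ℝ)|>.comp
      (tendsto_add_atTop_nat 1))
    rw [mul_one] at h1
    refine h1.congr fun n => ?_
    have : (2 : ℝ) - 2 * c = 1 := by linarith
    simp only [Function.comp, this, Real.rpow_one]
    push_cast
    field_simp
    ring
  have hlo : (fun n : ℕ => rateWeight c (n + 1) - G ^ 2 * (1 / ((n : ℝ) + 1)))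
      =o[atTop] (fun n : ℕ => 1 / ((n : ℝ) + 1)) := by
    rw [isLittleO_iff_tendsto' (Eventually.of_forall fun n h => absurd h (by positivity))]
    have := hw.sub_const (G ^ 2)
    rw [sub_self] at this
    refine this.congr fun n => ?_
    field_simp
  have hsum := hlo.sum_range (fun n => by positivity) hdiv
  have h3 : Tendsto (fun n : ℕ => (∑ j ∈ Finset.range n, rateWeight c (j + 1)) / Real.log n) atTop
      (𝓝 (G ^ 2)) := by
    have h4 := (hsum.tendsto_div_nhds_zero.add_const (G ^ 2)).mul hharm
    rw [zero_add, mul_one] at h4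
    refine h4.congr' ?_
    filter_upwards [hlog.eventually_gt_atTop 0, hdiv.eventually_gt_atTop 0] with n h5 h6
    rw [Finset.sum_sub_distrib, ← Finset.mul_sum]
    field_simp
    ring
  have h4 : Tendsto (fun n : ℕ => (∑ j ∈ Finset.range n, rateWeight c (j + 1)) /
      Real.log ((n : ℝ) + 1)) atTop (𝓝 (G ^ 2)) := by
    have h5 : Tendsto (fun n : ℕ => Real.log n / Real.log ((n : ℝ) + 1)) atTop (𝓝 1) := by
      have h6 : Tendsto (fun n : ℕ => Real.log (1 + 1 / (n : ℝ)) / Real.log n) atTop (𝓝 0) := by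
        refine Tendsto.div_atTop (a := Real.log (1 + 0)) ?_ hlog
        refine Tendsto.log ?_ (by norm_num)
        exact tendsto_const_nhds.add (tendsto_const_div_atTop_nhds_zero_nat 1)
      have h7 := (h6.const_add 1).inv₀ (by norm_num)
      rw [add_zero, inv_one] at h7
      refine h7.congr' ?_
      filter_upwards [hlog.eventually_gt_atTop 0, eventually_gt_atTop 0] with n h8 h9
      have h9' : (0 : ℝ) < n := by exact_mod_cast h9
      have h10 : Real.log ((n : ℝ) + 1) = Real.log n + Real.log (1 + 1 / (n : ℝ)) := by
        rw [← Real.log_mul (by positivity) (by positivity)]; congr 1; field_simp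
      rw [h10, inv_eq_one_div]
      have h11 : 0 < Real.log (1 + 1 / (n : ℝ)) := Real.log_pos (by simp; positivity)
      field_simp
    have h6 := h3.mul h5
    rw [mul_one] at h6
    refine h6.congr' ?_
    filter_upwards [hlog.eventually_gt_atTop 0] with n h8
    field_simp
  rw [← tendsto_add_atTop_iff_nat 1]
  have hD := ((tendsto_decay_mul_rpow hc1).pow 2)
  rw [← tendsto_add_atTop_iff_nat 1] at hD
  have h8 := hD.mul h4
  have h9 : (1 / G) ^ 2 * G ^ 2 = 1 := by field_simp
  rw [h9] at h8
  refine h8.congr fun n => ?_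
  have h10 : (((n + 1 : ℕ) : ℝ) ^ c) ^ 2 = ((n + 1 : ℕ) : ℝ) := by
    rw [← Real.rpow_natCast, ← Real.rpow_mul (by positivity)]
    push_cast
    rw [mul_comm c 2, hc, Real.rpow_one]
  rw [rateSum_eq hc1, mul_pow, h10, Finset.sum_Ico_eq_sum_range]
  simp only [Nat.add_sub_cancel, add_comm 1]
  push_cast
  ring

end Rates


/-! ### The rates of the modes -/

section Rates

lemma alphaRate_of_one_lt {l μ : ℝ} (h : 1 < 2 * l * μ) (i : ℕ) :
    alphaRate l μ i = 1 / (i : ℝ) / (2 * l * μ - 1) := by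
  simp [alphaRate, deltaRate, h]

lemma alphaRate_of_eq_one {l μ : ℝ} (h : 2 * l * μ = 1) (i : ℕ) :
    alphaRate l μ i = Real.log i / i := by
  simp [alphaRate, deltaRate, h]

lemma alphaRate_of_lt_one {l μ : ℝ} (h : 2 * l * μ < 1) (i : ℕ) :
    alphaRate l μ i = hyp3F2 1 1 1 (2 - l * μ) (2 - l * μ) 1 / Real.Gamma (2 - l * μ) ^ 2 *
      (1 / (i : ℝ) ^ (2 * (l * μ))) := by
  simp [alphaRate, deltaRate, h.not_gt, h.ne, ← mul_assoc]
  ring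

lemma alphaRate_nonneg (l μ : ℝ) (i : ℕ) : 0 ≤ alphaRate l μ i := by
  rcases lt_trichotomy (2 * l * μ) 1 with h | h | h
  · rw [alphaRate_of_lt_one h]
    have := hyp3F2_pos (c := l * μ) (by linarith)
    positivity
  · rw [alphaRate_of_eq_one h]
    exact div_nonneg (Real.log_natCast_nonneg i) (Nat.cast_nonneg i)
  · rw [alphaRate_of_one_lt h]
    exact div_nonneg (by positivity) (by linarith)

lemma eventually_alphaRate_pos (l μ : ℝ) : ∀ᶠ i in atTop, 0 < alphaRate l μ i := by
  filter_upwards [eventually_gt_atTop 1] with i hi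
  have hi' : (1 : ℝ) < i := by exact_mod_cast hi
  rcases lt_trichotomy (2 * l * μ) 1 with h | h | h
  · rw [alphaRate_of_lt_one h]
    have := hyp3F2_pos (c := l * μ) (by linarith)
    have : 0 < Real.Gamma (2 - l * μ) := Real.Gamma_pos_of_pos (by linarith)
    positivity
  · rw [alphaRate_of_eq_one h]
    exact div_pos (Real.log_pos hi') (by linarith)
  · rw [alphaRate_of_one_lt h]
    exact div_pos (by positivity) (by linarith)

/-- The scalar sum of a mode with eigenvalue `l` is asymptotically equivalent to `alphaRate l μ`. -/
lemma rateSum_isEquivalent (l μ : ℝ) :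
    (fun i => rateSum (l * μ) i) ~[atTop] (fun i => alphaRate l μ i) := by
  refine (isEquivalent_iff_tendsto_one ((eventually_alphaRate_pos l μ).mono fun i h => h.ne')).2 ?_
  rcases lt_trichotomy (2 * l * μ) 1 with h | h | h
  · have h1 := tendsto_rateSum_of_lt_one (c := l * μ) (by linarith)
    have h2 := hyp3F2_pos (c := l * μ) (by linarith)
    have h3 : 0 < Real.Gamma (2 - l * μ) := Real.Gamma_pos_of_pos (by linarith)
    have h4 := h1.div_const (hyp3F2 1 1 1 (2 - l * μ) (2 - l * μ) 1 / Real.Gamma (2 - l * μ) ^ 2)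
    rw [div_self (by positivity)] at h4
    refine h4.congr' ?_
    filter_upwards [eventually_gt_atTop 0] with i hi
    have hi' : (0 : ℝ) < i := by exact_mod_cast hi
    have : 0 < (i : ℝ) ^ (2 * (l * μ)) := by positivity
    simp only [Pi.div_apply, alphaRate_of_lt_one h]
    field_simp
  · refine (tendsto_rateSum_of_eq_one (c := l * μ) (by linarith)).congr fun i => ?_
    simp only [Pi.div_apply, alphaRate_of_eq_one h]
    rw [div_div_eq_mul_div]; ring
  · have h1 := (tendsto_rateSum_of_one_lt (c := l * μ) (by linarith)).mul_const
      (2 * (l * μ) - 1)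
    rw [one_div, inv_mul_cancel₀ (by linarith)] at h1
    refine h1.congr fun i => ?_
    simp only [Pi.div_apply, alphaRate_of_one_lt h]
    rw [div_div_eq_mul_div, div_div_eq_mul_div, div_one]; ring

lemma isLittleO_inv_sq_alphaRate (l μ : ℝ) :
    (fun i : ℕ => 1 / (i : ℝ) ^ 2) =o[atTop] (fun i => alphaRate l μ i) := by
  rw [isLittleO_iff_tendsto' ((eventually_alphaRate_pos l μ).mono fun i h h' => absurd h' h.ne')]
  have hinv : Tendsto (fun i : ℕ => 1 / (i : ℝ)) atTop (𝓝 0) := tendsto_one_div_atTop_nhds_zero_nat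
  rcases lt_trichotomy (2 * l * μ) 1 with h | h | h
  · have h2 := hyp3F2_pos (c := l * μ) (by linarith)
    have h3 : 0 < Real.Gamma (2 - l * μ) := Real.Gamma_pos_of_pos (by linarith)
    have h4 : Tendsto (fun i : ℕ => (i : ℝ) ^ (-(2 - 2 * (l * μ)))) atTop (𝓝 0) :=
      (tendsto_rpow_neg_atTop (by linarith)).comp tendsto_natCast_atTop_atTop
    have h5 := h4.div_const (hyp3F2 1 1 1 (2 - l * μ) (2 - l * μ) 1 / Real.Gamma (2 - l * μ) ^ 2)
    rw [zero_div] at h5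
    refine h5.congr' ?_
    filter_upwards [eventually_gt_atTop 0] with i hi
    have hi' : (0 : ℝ) < i := by exact_mod_cast hi
    have : 0 < (i : ℝ) ^ (2 * (l * μ)) := by positivity
    rw [alphaRate_of_lt_one h, Real.rpow_neg hi'.le, Real.rpow_sub hi', Real.rpow_two]
    field_simp
  · have h1 : Tendsto (fun i : ℕ => 1 / (i : ℝ) / Real.log i) atTop (𝓝 0) :=
      hinv.div_atTop (Real.tendsto_log_atTop.comp tendsto_natCast_atTop_atTop)
    refine h1.congr' ?_
    filter_upwards [eventually_gt_atTop 1] with i hi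
    have hi' : (1 : ℝ) < i := by exact_mod_cast hi
    have := Real.log_pos hi'
    rw [alphaRate_of_eq_one h]
    field_simp
  · have h1 := hinv.mul_const (2 * l * μ - 1)
    rw [zero_mul] at h1
    refine h1.congr' ?_
    filter_upwards [eventually_gt_atTop 0] with i hi
    have hi' : (0 : ℝ) < i := by exact_mod_cast hi
    have : 2 * l * μ - 1 ≠ 0 := by linarith
    rw [alphaRate_of_one_lt h]
    field_simp

lemma isLittleO_inv_alphaRate_of_eq_one {l μ : ℝ} (h : 2 * l * μ = 1) :
    (fun i : ℕ => 1 / (i : ℝ)) =o[atTop] (fun i => alphaRate l μ i) := by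
  rw [isLittleO_iff_tendsto' ((eventually_alphaRate_pos l μ).mono fun i h h' => absurd h' h.ne')]
  have h1 : Tendsto (fun i : ℕ => (1 : ℝ) / Real.log i) atTop (𝓝 0) :=
    tendsto_const_nhds.div_atTop (Real.tendsto_log_atTop.comp tendsto_natCast_atTop_atTop)
  refine h1.congr' ?_
  filter_upwards [eventually_gt_atTop 1] with i hi
  have hi' : (1 : ℝ) < i := by exact_mod_cast hi
  have := Real.log_pos hi'
  rw [alphaRate_of_eq_one h]
  field_simp

lemma decay_sq_le_of_eq_half (j : ℕ) {i : ℕ} (h : j < i) :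
    decay (1 / 2) j i ^ 2 ≤ ((j : ℝ) + 1) / i := by
  induction i, h using Nat.le_induction with
  | base =>
    rw [decay_self_succ]; push_cast
    rw [div_self (by positivity), one_pow]
  | succ i hi ih =>
    have hi0 : (1 : ℝ) ≤ i := by exact_mod_cast (by omega : 1 ≤ i)
    rw [decay_succ _ (by omega), mul_pow]
    calc (1 - 1 / 2 / (i : ℝ)) ^ 2 * decay (1 / 2) j i ^ 2
        ≤ (i / (i + 1)) * (((j : ℝ) + 1) / i) := by
          refine mul_le_mul ?_ ih (by positivity) (by positivity)
          rw [le_div_iff₀ (by positivity)]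
          have : (1 - 1 / 2 / (i : ℝ)) ^ 2 * (i + 1) = i - (3 * i - 1) / (4 * (i : ℝ) ^ 2) := by
            field_simp; ring
          rw [this]
          have : 0 ≤ (3 * i - 1) / (4 * (i : ℝ) ^ 2) := div_nonneg (by linarith) (by positivity)
          linarith
      _ = ((j : ℝ) + 1) / ((i + 1 : ℕ) : ℝ) := by push_cast; field_simp

/-- From the threshold on, the effect of a single perturbation is negligible. -/
lemma isLittleO_decay_sq_alphaRate {l μ : ℝ} (h : 1 ≤ 2 * l * μ) (j : ℕ) :
    (fun i => decay (l * μ) j i ^ 2) =o[atTop] (fun i => alphaRate l μ i) := by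
  rcases h.eq_or_lt with h | h
  · refine IsBigO.trans_isLittleO (g := fun i : ℕ => 1 / (i : ℝ)) ?_
      (isLittleO_inv_alphaRate_of_eq_one h.symm)
    refine IsBigO.of_bound ((j : ℝ) + 1) ?_
    filter_upwards [eventually_gt_atTop j] with i hi
    rw [show l * μ = 1 / 2 by linarith, Real.norm_of_nonneg (by positivity),
      Real.norm_of_nonneg (by positivity), mul_one_div]
    exact decay_sq_le_of_eq_half j hi
  · rw [isLittleO_iff_tendsto' ((eventually_alphaRate_pos l μ).mono fun i h h' => absurd h' h.ne')]
    obtain ⟨q, hq1, hq2⟩ : ∃ q, 1 < q ∧ q < 2 * (l * μ) := exists_between (by linarith)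
    obtain ⟨q', hq3, hq4⟩ := exists_between hq2
    obtain ⟨K, -, hK⟩ := rate_of_recursion (x := fun n => decay (l * μ) j (n + 1) ^ 2) (C := 0)
      (by linarith) hq3 (by
        filter_upwards [eventually_sq_le hq4, eventually_ge_atTop j] with n h1 h2
        rw [decay_succ _ (by omega), mul_pow, zero_mul, add_zero]
        push_cast
        exact mul_le_mul_of_nonneg_right h1 (sq_nonneg _))
    have h1 := (tendsto_mul_of_le_rpow (x := fun n => decay (l * μ) j (n + 1) ^ 2) hq1
      (hK.mono fun n hn => by rwa [abs_of_nonneg (sq_nonneg _)])).mul_const (2 * l * μ - 1)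
    rw [zero_mul] at h1
    rw [← tendsto_add_atTop_iff_nat 1]
    refine h1.congr fun n => ?_
    have : 2 * l * μ - 1 ≠ 0 := by linarith
    rw [alphaRate_of_one_lt h]
    push_cast
    field_simp

lemma decay_sq_le_one {c : ℝ} (hc : 0 ≤ c) {j : ℕ} (hj : c ≤ j) (i : ℕ) : decay c j i ^ 2 ≤ 1 := by
  rw [decay, ← Finset.prod_pow]
  refine Finset.prod_le_one (fun _ _ => sq_nonneg _) fun t ht => ?_
  have h1 : (j : ℝ) + 1 ≤ t := by exact_mod_cast (Finset.mem_Ico.1 ht).1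
  have h2 : 0 < (t : ℝ) := by linarith
  have h3 : c / t ≤ 1 := by rw [div_le_one h2]; linarith
  have h4 : 0 ≤ c / t := by positivity
  rw [sq_le_one_iff_abs_le_one, abs_le]; constructor <;> linarith

/-- Convergent weights can be replaced by their limit in the scalar sum: only a bounded number of
terms, each of order `i⁻²`, see a weight that is not close to the limit. -/
lemma isLittleO_weighted_rateSum {l μ : ℝ} (hc : 0 ≤ l * μ) {a : ℕ → ℝ} {a' : ℝ}
    (ha : Tendsto a atTop (𝓝 a')) :
    (fun i => (∑ j ∈ Finset.Ico 1 i, decay (l * μ) j i ^ 2 / (j : ℝ) ^ 2 * a (i - j))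
      - a' * alphaRate l μ i) =o[atTop] (fun i => alphaRate l μ i) := by
  have hmain : (fun i => (∑ j ∈ Finset.Ico 1 i, decay (l * μ) j i ^ 2 / (j : ℝ) ^ 2 * a (i - j))
      - a' * rateSum (l * μ) i) =o[atTop] (fun i => alphaRate l μ i) := by
    obtain ⟨B, hB⟩ := (ha.sub_const a').norm.bddAbove_range
    have hB' : ∀ n, |a n - a'| ≤ B := fun n => hB ⟨n, rfl⟩
    have hB0 : 0 ≤ B := (abs_nonneg _).trans (hB' 0)
    rw [isLittleO_iff]
    intro ε hε
    obtain ⟨n0, hn0⟩ := Metric.tendsto_atTop.1 ha (ε / 4) (by positivity)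
    have e1 := ((isLittleO_iff.1 (rateSum_isEquivalent l μ).isLittleO) (zero_lt_one))
    have e2 := (isLittleO_iff.1 (isLittleO_inv_sq_alphaRate l μ))
      (show 0 < ε / (2 * (B * 4 * n0 + 1)) by positivity)
    filter_upwards [e1, e2, eventually_ge_atTop (2 * n0), eventually_ge_atTop 1,
      eventually_ge_atTop (2 * ⌈l * μ⌉₊)] with i h1 h2 h3 h4 h5
    have hi : (0 : ℝ) < i := by exact_mod_cast h4
    have hα := alphaRate_nonneg l μ i
    rw [Real.norm_of_nonneg hα] at h1 h2 ⊢
    rw [Real.norm_of_nonneg (by positivity)] at h2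
    have h6 : rateSum (l * μ) i ≤ 2 * alphaRate l μ i := by
      have := le_abs_self (rateSum (l * μ) i - alphaRate l μ i)
      simp only [Pi.sub_apply, Real.norm_eq_abs] at h1
      linarith
    have h7 : ∀ j ∈ Finset.Ico 1 i, |decay (l * μ) j i ^ 2 / (j : ℝ) ^ 2 * (a (i - j) - a')| ≤
        ε / 4 * (decay (l * μ) j i ^ 2 / (j : ℝ) ^ 2) +
          (if i - j < n0 then B * (4 * (1 / (i : ℝ) ^ 2)) else 0) := by
      intro j hj
      obtain ⟨hj1, hj2⟩ := Finset.mem_Ico.1 hj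
      have hj0 : (0 : ℝ) < j := by exact_mod_cast hj1
      have hb : 0 ≤ decay (l * μ) j i ^ 2 / (j : ℝ) ^ 2 := by positivity
      rw [abs_mul, abs_of_nonneg hb]
      split_ifs with hlt
      · have hij : (i : ℝ) ≤ 2 * j := by exact_mod_cast (by omega : i ≤ 2 * j)
        have hcj : l * μ ≤ j := by
          have : (⌈l * μ⌉₊ : ℝ) ≤ j := by exact_mod_cast (by omega : ⌈l * μ⌉₊ ≤ j)
          exact (Nat.le_ceil _).trans this
        have hb2 : decay (l * μ) j i ^ 2 / (j : ℝ) ^ 2 ≤ 4 * (1 / (i : ℝ) ^ 2) := by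
          calc decay (l * μ) j i ^ 2 / (j : ℝ) ^ 2 ≤ 1 / (j : ℝ) ^ 2 := by
                gcongr; exact decay_sq_le_one hc hcj i
            _ ≤ 4 * (1 / (i : ℝ) ^ 2) := by
                rw [mul_one_div, div_le_div_iff₀ (by positivity) (by positivity)]
                nlinarith
        have := mul_le_mul hb2 (hB' (i - j)) (abs_nonneg _) (by positivity)
        have : 0 ≤ ε / 4 * (decay (l * μ) j i ^ 2 / (j : ℝ) ^ 2) := by positivity
        linarith
      · have := (hn0 (i - j) (by omega)).le
        rw [Real.dist_eq] at this
        have := mul_le_mul_of_nonneg_left this hb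
        linarith
    have h8 : (∑ j ∈ Finset.Ico 1 i, decay (l * μ) j i ^ 2 / (j : ℝ) ^ 2 * a (i - j))
        - a' * rateSum (l * μ) i
        = ∑ j ∈ Finset.Ico 1 i, decay (l * μ) j i ^ 2 / (j : ℝ) ^ 2 * (a (i - j) - a') := by
      simp only [mul_sub, Finset.sum_sub_distrib, ← Finset.sum_mul, rateSum]; ring
    rw [h8, Real.norm_eq_abs]
    have h9 : ∑ j ∈ Finset.Ico 1 i, (if i - j < n0 then B * (4 * (1 / (i : ℝ) ^ 2)) else 0)
        ≤ n0 * (B * (4 * (1 / (i : ℝ) ^ 2))) := by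
      rw [← Finset.sum_filter, Finset.sum_const, nsmul_eq_mul]
      refine mul_le_mul_of_nonneg_right ?_ (by positivity)
      have hsub : (Finset.Ico 1 i).filter (fun j => i - j < n0) ⊆ Finset.Ico (i - n0) i := by
        intro j hj
        simp only [Finset.mem_filter, Finset.mem_Ico] at hj ⊢
        omega
      have := Finset.card_le_card hsub
      rw [Nat.card_Ico] at this
      exact_mod_cast this.trans (by omega)
    calc |∑ j ∈ Finset.Ico 1 i, decay (l * μ) j i ^ 2 / (j : ℝ) ^ 2 * (a (i - j) - a')|
        ≤ ∑ j ∈ Finset.Ico 1 i, |decay (l * μ) j i ^ 2 / (j : ℝ) ^ 2 * (a (i - j) - a')| :=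
          Finset.abs_sum_le_sum_abs _ _
      _ ≤ ε / 4 * rateSum (l * μ) i + n0 * (B * (4 * (1 / (i : ℝ) ^ 2))) := by
          refine (Finset.sum_le_sum h7).trans ?_
          rw [Finset.sum_add_distrib, ← Finset.mul_sum]
          exact add_le_add le_rfl h9
      _ ≤ ε * alphaRate l μ i := by
          have h10 : n0 * (B * (4 * (1 / (i : ℝ) ^ 2))) ≤ ε / 2 * alphaRate l μ i := by
            have hpos : 0 < B * 4 * n0 + 1 := by positivity
            calc n0 * (B * (4 * (1 / (i : ℝ) ^ 2))) = (B * 4 * n0) * (1 / (i : ℝ) ^ 2) := by ring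
              _ ≤ (B * 4 * n0 + 1) * (1 / (i : ℝ) ^ 2) := by gcongr; linarith
              _ ≤ (B * 4 * n0 + 1) * (ε / (2 * (B * 4 * n0 + 1)) * alphaRate l μ i) := by gcongr
              _ = ε / 2 * alphaRate l μ i := by field_simp
          have h11 := mul_le_mul_of_nonneg_left h6 (show 0 ≤ ε / 4 by positivity)
          linarith
  have h2 := ((rateSum_isEquivalent l μ).isLittleO.const_mul_left a')
  refine (hmain.add h2).congr_left fun i => ?_
  simp only [Pi.sub_apply]; ring

/-- A sequence damped by `(1 - lμ/n)²` and driven by at most `(κ + o(1)) / n²` is asymptotically at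
most `κ` times the rate of the mode. -/
lemma eventually_le_alphaRate_of_recursion {l μ κ : ℝ} {u : ℕ → ℝ} (hc : 1 ≤ 2 * l * μ)
    (hκ : 0 ≤ κ) (h : ∀ η > 0, ∀ᶠ n : ℕ in atTop,
      u (n + 1) ≤ (1 - l * μ / ((n : ℝ) + 1)) ^ 2 * u n + (κ + η) / ((n : ℝ) + 1) ^ 2)
    {η : ℝ} (hη : 0 < η) : ∀ᶠ n in atTop, u n ≤ (κ + η) * alphaRate l μ (n + 1) := by
  obtain ⟨n0, hn0⟩ := eventually_atTop.1 (h (η / 3) (by positivity))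
  have hclaim : ∀ n ≥ n0, u n ≤ (κ + η / 3) * rateSum (l * μ) (n + 1)
      + |u n0| * decay (l * μ) n0 (n + 1) ^ 2 := by
    intro n hn
    induction n, hn using Nat.le_induction with
    | base =>
      rw [decay_self_succ]
      have := le_abs_self (u n0)
      have := mul_nonneg (show 0 ≤ κ + η / 3 by positivity) (rateSum_nonneg (l * μ) (n0 + 1))
      linarith
    | succ n hn ih =>
      refine (hn0 n hn).trans ?_
      rw [rateSum_succ _ (by omega), decay_succ _ (by omega)]
      have := mul_le_mul_of_nonneg_left ih (sq_nonneg (1 - l * μ / ((n : ℝ) + 1)))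
      push_cast
      refine (add_le_add_left this _).trans (le_of_eq ?_)
      ring
  have e1 := (tendsto_add_atTop_nat 1).eventually ((isLittleO_iff.1
    (rateSum_isEquivalent l μ).isLittleO) (show 0 < (η / 3) / (κ + η / 3) by positivity))
  have e2 := (tendsto_add_atTop_nat 1).eventually ((isLittleO_iff.1
    (isLittleO_decay_sq_alphaRate hc n0)) (show 0 < (η / 3) / (|u n0| + 1) by positivity))
  filter_upwards [e1, e2, eventually_ge_atTop n0] with n h1 h2 h3
  have hα := alphaRate_nonneg l μ (n + 1)
  rw [Real.norm_of_nonneg hα] at h1 h2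
  rw [Real.norm_of_nonneg (sq_nonneg _)] at h2
  simp only [Pi.sub_apply, Real.norm_eq_abs] at h1
  have h4 := (le_abs_self _).trans h1
  have hk : 0 < κ + η / 3 := by positivity
  have h5 : (κ + η / 3) * (rateSum (l * μ) (n + 1) - alphaRate l μ (n + 1))
      ≤ η / 3 * alphaRate l μ (n + 1) := by
    refine (mul_le_mul_of_nonneg_left h4 hk.le).trans (le_of_eq ?_)
    field_simp
  have h6 : |u n0| * decay (l * μ) n0 (n + 1) ^ 2 ≤ η / 3 * alphaRate l μ (n + 1) := by
    calc |u n0| * decay (l * μ) n0 (n + 1) ^ 2 ≤ (|u n0| + 1) * decay (l * μ) n0 (n + 1) ^ 2 := by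
          gcongr; linarith
      _ ≤ (|u n0| + 1) * ((η / 3) / (|u n0| + 1) * alphaRate l μ (n + 1)) := by gcongr
      _ = _ := by field_simp
  have := hclaim n h3
  linarith

end Rates


/-! ### Powers of the combination matrix -/

section Combination

variable {N : ℕ}

lemma sum_abs_mulVec_le {B : Matrix (Fin N) (Fin N) ℝ} {δ : ℝ} (hB : ∀ l k, δ ≤ B l k)
    (hcol : ∀ k, ∑ l, B l k = 1) {x : Fin N → ℝ} (hx : ∑ k, x k = 0) :
    ∑ l, |(B *ᵥ x) l| ≤ (1 - N * δ) * ∑ k, |x k| := by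
  have h1 : ∀ l, |(B *ᵥ x) l| ≤ ∑ k, (B l k - δ) * |x k| := by
    intro l
    -- subtracting `δ` from every entry does not change the product, as the entries of `x` cancel
    have h2 : (B *ᵥ x) l = ∑ k, (B l k - δ) * x k := by
      simp only [sub_mul, Finset.sum_sub_distrib, ← Finset.mul_sum, hx, mul_zero, sub_zero]
      rfl
    rw [h2]
    refine (Finset.abs_sum_le_sum_abs _ _).trans (le_of_eq (Finset.sum_congr rfl fun k _ => ?_))
    rw [abs_mul, abs_of_nonneg (sub_nonneg.2 (hB l k))]
  refine (Finset.sum_le_sum fun l _ => h1 l).trans (le_of_eq ?_)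
  rw [Finset.sum_comm, Finset.mul_sum]
  refine Finset.sum_congr rfl fun k _ => ?_
  rw [← Finset.sum_mul, Finset.sum_sub_distrib, hcol]
  simp

variable {A : Matrix (Fin N) (Fin N) ℝ}

lemma pow_nonneg_of_primitive (hA : LeftStochasticPrimitive A) (n : ℕ) :
    ∀ l k, 0 ≤ (A ^ n) l k := by
  induction n with
  | zero => intro l k; simp only [pow_zero, Matrix.one_apply]; split_ifs <;> norm_num
  | succ n ih =>
    intro l k
    rw [pow_succ, Matrix.mul_apply]
    exact Finset.sum_nonneg fun j _ => mul_nonneg (ih l j) (hA.primitive.nonneg j k)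

lemma pow_col_sum (hA : LeftStochasticPrimitive A) (n : ℕ) : ∀ k, ∑ l, (A ^ n) l k = 1 := by
  induction n with
  | zero => intro k; simp [Matrix.one_apply]
  | succ n ih =>
    intro k
    simp only [pow_succ, Matrix.mul_apply]
    rw [Finset.sum_comm]
    simp only [← Finset.sum_mul, ih, one_mul, hA.col_sum]

lemma pow_mulVec_fixed {p : Fin N → ℝ} (hp : A *ᵥ p = p) (n : ℕ) : (A ^ n) *ᵥ p = p := by
  induction n with
  | zero => simp
  | succ n ih => rw [pow_succ, ← Matrix.mulVec_mulVec, hp, ih]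

lemma sum_mulVec_of_col_sum {B : Matrix (Fin N) (Fin N) ℝ} (hcol : ∀ k, ∑ l, B l k = 1)
    (x : Fin N → ℝ) : ∑ l, (B *ᵥ x) l = ∑ k, x k := by
  simp only [Matrix.mulVec, dotProduct]
  rw [Finset.sum_comm]
  simp only [← Finset.sum_mul, hcol, one_mul]

/-- Powers of a primitive left-stochastic matrix contract the vectors of total mass zero
geometrically. -/
lemma exists_geometric_contraction [NeZero N] (hA : LeftStochasticPrimitive A) :
    ∃ C ρ : ℝ, 0 < C ∧ 0 < ρ ∧ ρ < 1 ∧ ∀ (n : ℕ) (x : Fin N → ℝ), ∑ k, x k = 0 →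
      ∑ l, |((A ^ n) *ᵥ x) l| ≤ C * ρ ^ n * ∑ k, |x k| := by
  obtain ⟨m, hm, hpos⟩ := hA.primitive.exists_pos_pow
  obtain ⟨δ, hδ, hδA⟩ : ∃ δ : ℝ, 0 < δ ∧ ∀ l k, δ ≤ (A ^ m) l k := by
    obtain ⟨q, hq⟩ := Finite.exists_min (fun q : Fin N × Fin N => (A ^ m) q.1 q.2)
    exact ⟨_, hpos q.1 q.2, fun l k => hq (l, k)⟩
  set r := 1 - min δ (1 / 2) with hr
  have hr0 : 0 < r := by have := min_le_right δ (1 / 2); linarith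
  have hr1 : r < 1 := by have : 0 < min δ (1 / 2) := by positivity
                         linarith
  have hN : (1 : ℝ) ≤ N := by exact_mod_cast NeZero.one_le
  have hstep : ∀ x : Fin N → ℝ, ∑ k, x k = 0 →
      ∑ l, |((A ^ m) *ᵥ x) l| ≤ r * ∑ k, |x k| := by
    intro x hx
    refine (sum_abs_mulVec_le hδA (pow_col_sum hA m) hx).trans ?_
    refine mul_le_mul_of_nonneg_right ?_ (Finset.sum_nonneg fun _ _ => abs_nonneg _)
    have := min_le_left δ (1 / 2)
    nlinarith
  have hq : ∀ (q : ℕ) (x : Fin N → ℝ), ∑ k, x k = 0 →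
      ∑ l, |((A ^ (m * q)) *ᵥ x) l| ≤ r ^ q * ∑ k, |x k| := by
    intro q
    induction q with
    | zero => intro x _; simp
    | succ q ih =>
      intro x hx
      rw [mul_add_one, pow_add, ← Matrix.mulVec_mulVec]
      refine (ih _ (by rw [sum_mulVec_of_col_sum (pow_col_sum hA m), hx])).trans ?_
      rw [pow_succ, mul_assoc]
      exact mul_le_mul_of_nonneg_left (hstep x hx) (by positivity)
  set ρ := r ^ (1 / (m : ℝ)) with hρ
  have hρ0 : 0 < ρ := by positivity
  have hρ1 : ρ < 1 := Real.rpow_lt_one hr0.le hr1 (by positivity)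
  have hρm : ρ ^ m = r := by
    rw [hρ, ← Real.rpow_natCast, ← Real.rpow_mul hr0.le, one_div_mul_cancel (by positivity),
      Real.rpow_one]
  refine ⟨1 / r, ρ, by positivity, hρ0, hρ1, fun n x hx => ?_⟩
  have hx0 : 0 ≤ ∑ k, |x k| := Finset.sum_nonneg fun _ _ => abs_nonneg _
  conv_lhs => rw [← Nat.mod_add_div n m]
  rw [pow_add, ← Matrix.mulVec_mulVec]
  have h1 := sum_abs_mulVec_le (pow_nonneg_of_primitive hA (n % m)) (pow_col_sum hA (n % m))
    (x := (A ^ (m * (n / m))) *ᵥ x) (by rw [sum_mulVec_of_col_sum (pow_col_sum hA _), hx])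
  refine h1.trans ?_
  rw [mul_zero, sub_zero, one_mul]
  refine (hq (n / m) x hx).trans (mul_le_mul_of_nonneg_right ?_ hx0)
  rw [one_div, inv_mul_eq_div, le_div_iff₀ hr0, ← hρm, ← pow_mul, ← pow_add]
  refine pow_le_pow_of_le_one hρ0.le hρ1.le ?_
  have := Nat.mod_add_div n m
  have := Nat.mod_lt n hm
  omega

variable {p : Fin N → ℝ}

/-- The powers of a primitive left-stochastic matrix converge to `p 1ᵀ` geometrically. -/
lemma exists_geometric_pow (hA : LeftStochasticPrimitive A) (hp : A *ᵥ p = p)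
    (hp1 : ∑ l, p l = 1) :
    ∃ C ρ : ℝ, 0 < C ∧ 0 < ρ ∧ ρ < 1 ∧ ∀ n l k, |(A ^ n) l k - p l| ≤ C * ρ ^ n := by
  have : NeZero N := ⟨by rintro rfl; simp at hp1⟩
  obtain ⟨C, ρ, hC, hρ0, hρ1, h⟩ := exists_geometric_contraction hA
  refine ⟨C * (1 + ∑ k, ∑ l, |(Pi.single k 1 : Fin N → ℝ) l - p l|), ρ, by positivity, hρ0, hρ1,
    fun n l k => ?_⟩
  have h1 := h n (Pi.single k 1 - p) (by simp [hp1])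
  rw [Matrix.mulVec_sub, pow_mulVec_fixed hp, Matrix.mulVec_single_one] at h1
  have h2 : |(A ^ n) l k - p l| ≤ ∑ l, |((A ^ n).col k - p) l| :=
    Finset.single_le_sum (f := fun l => |((A ^ n).col k - p) l|)
      (fun _ _ => abs_nonneg _) (Finset.mem_univ l)
  refine (h2.trans h1).trans ?_
  have h3 : ∑ l, |(Pi.single k 1 - p : Fin N → ℝ) l| ≤ ∑ k, ∑ l, |(Pi.single k 1 : Fin N → ℝ) l - p l| :=
    Finset.single_le_sum (f := fun k => ∑ l, |(Pi.single k 1 : Fin N → ℝ) l - p l|)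
      (fun _ _ => Finset.sum_nonneg fun _ _ => abs_nonneg _) (Finset.mem_univ k)
  calc C * ρ ^ n * ∑ l, |(Pi.single k 1 - p : Fin N → ℝ) l|
      ≤ C * ρ ^ n * (1 + ∑ k, ∑ l, |(Pi.single k 1 : Fin N → ℝ) l - p l|) := by gcongr; linarith
    _ = _ := by ring

lemma tendsto_pow_apply (hA : LeftStochasticPrimitive A) (hp : A *ᵥ p = p) (hp1 : ∑ l, p l = 1)
    (l k : Fin N) : Tendsto (fun n => (A ^ n) l k) atTop (𝓝 (p l)) := by
  obtain ⟨C, ρ, -, hρ0, hρ1, h⟩ := exists_geometric_pow hA hp hp1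
  rw [tendsto_iff_norm_sub_tendsto_zero]
  refine squeeze_zero (fun n => norm_nonneg _) (fun n => h n l k) ?_
  simpa using (tendsto_pow_atTop_nhds_zero_of_lt_one hρ0.le hρ1).const_mul C

lemma perron_pos (hA : LeftStochasticPrimitive A) (hp : A *ᵥ p = p) (hp1 : ∑ l, p l = 1)
    (l : Fin N) : 0 < p l := by
  have hnn : ∀ l, 0 ≤ p l := fun l =>
    ge_of_tendsto' (tendsto_pow_apply hA hp hp1 l l) fun n => pow_nonneg_of_primitive hA n l l
  obtain ⟨m, -, hpos⟩ := hA.primitive.exists_pos_pow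
  obtain ⟨k, hk⟩ : ∃ k, p k ≠ 0 := by
    by_contra! h
    simp [h] at hp1
  have h1 : p l = ∑ k, (A ^ m) l k * p k := (congrFun (pow_mulVec_fixed hp m) l).symm
  rw [h1]
  exact Finset.sum_pos' (fun k _ => mul_nonneg (hpos l k).le (hnn k))
    ⟨k, Finset.mem_univ _, mul_pos (hpos l k) ((hnn k).lt_of_ne' hk)⟩

end Combination

/-! ### The asymptotic term -/

section AsymptoticTerm

variable {M N : ℕ}

lemma netB_transpose (A : Matrix (Fin N) (Fin N) ℝ) (H : Matrix (Fin M) (Fin M) ℝ) (step : ℕ → ℝ)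
    (t : ℕ) : (netB A H step t)ᵀ = A ⊗ₖ (1 - step t • H : Matrix (Fin M) (Fin M) ℝ) := by
  have h1 : (1 : Matrix (Fin N × Fin M) (Fin N × Fin M) ℝ) - step t • ((1 : Matrix (Fin N) (Fin N) ℝ) ⊗ₖ H)
      = (1 : Matrix (Fin N) (Fin N) ℝ) ⊗ₖ (1 - step t • H : Matrix (Fin M) (Fin M) ℝ) := by
    ext ⟨a, b⟩ ⟨c, d⟩
    simp only [Matrix.sub_apply, Matrix.smul_apply, Matrix.kroneckerMap_apply, Matrix.one_apply,
      Prod.mk.injEq, smul_eq_mul]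
    by_cases hac : a = c <;> by_cases hbd : b = d <;> simp [hac, hbd]
  rw [netB, Matrix.transpose_mul, Matrix.transpose_transpose, Matrix.transpose_sub,
    Matrix.transpose_one, Matrix.transpose_smul, Matrix.transpose_transpose, h1, netA,
    ← Matrix.mul_kronecker_mul, one_mul, mul_one]

variable {H Φ : Matrix (Fin M) (Fin M) ℝ} {lam : Fin M → ℝ}

lemma netProd_eq (A : Matrix (Fin N) (Fin N) ℝ) (hΦ : Φᵀ * Φ = 1) (hΦ' : Φ * Φᵀ = 1)
    (hH : H = Φ * Matrix.diagonal lam * Φᵀ) (step : ℕ → ℝ) {j i : ℕ} (hji : j < i) :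
    netProd A H step j i = (A ^ (i - (j + 1))) ⊗ₖ
      (Φ * Matrix.diagonal (fun m => ∏ t ∈ Finset.Ico (j + 1) i, (1 - step t * lam m)) * Φᵀ) := by
  rw [netProd]
  induction i, hji using Nat.le_induction with
  | base => simp [hΦ']
  | succ i hi ih =>
    rw [List.Ico.succ_top hi, List.map_append, List.prod_append, ih, List.map_singleton,
      List.prod_singleton, netB_transpose, ← Matrix.mul_kronecker_mul, ← pow_succ,
      show i - (j + 1) + 1 = i + 1 - (j + 1) by omega]
    congr 1
    have h1 : 1 - step i • H = Φ * Matrix.diagonal (fun m => 1 - step i * lam m) * Φᵀ := by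
      have h2 : Matrix.diagonal (fun m => 1 - step i * lam m)
          = 1 - step i • Matrix.diagonal lam := by
        rw [← Matrix.diagonal_one, ← Matrix.diagonal_smul, Matrix.diagonal_sub]; rfl
      rw [h2, mul_sub, sub_mul, mul_one, hΦ', hH, Matrix.mul_smul, Matrix.smul_mul]
    rw [h1]
    calc _ = Φ * Matrix.diagonal (fun m => ∏ t ∈ Finset.Ico (j + 1) i, (1 - step t * lam m)) *
          (Φᵀ * Φ) * Matrix.diagonal (fun m => 1 - step i * lam m) * Φᵀ := by
            simp only [Matrix.mul_assoc]
      _ = _ := by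
        rw [hΦ, mul_one, Matrix.mul_assoc Φ, Matrix.diagonal_mul_diagonal]
        simp only [Finset.prod_Ico_succ_top hi]

lemma trace_combination (A : Matrix (Fin N) (Fin N) ℝ) (k : Fin N) (n : ℕ) :
    (Aᵀ * A * A ^ n * Matrix.single k k (1 : ℝ) * (A ^ n)ᵀ).trace
      = ∑ l, (A ^ (n + 1)) l k ^ 2 := by
  have h1 : (Aᵀ * A * A ^ n * Matrix.single k k (1 : ℝ) * (A ^ n)ᵀ).trace
      = ((A ^ (n + 1))ᵀ * A ^ (n + 1) * Matrix.single k k (1 : ℝ)).trace := by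
    rw [Matrix.trace_mul_comm, pow_succ', Matrix.transpose_mul]
    simp only [Matrix.mul_assoc]
  rw [h1, Matrix.trace_mul_single]
  simp only [Matrix.mul_apply, Matrix.transpose_apply, sq, MulOpposite.op_one, one_smul]

lemma trace_modes (hΦ : Φᵀ * Φ = 1) (hH : H = Φ * Matrix.diagonal lam * Φᵀ)
    (R : Matrix (Fin M) (Fin M) ℝ) (d : Fin M → ℝ) :
    (Rᵀ * (Φ * Matrix.diagonal d * Φᵀ) * H * (Φ * Matrix.diagonal d * Φᵀ)ᵀ).trace
      = ∑ m, lam m * d m ^ 2 * (Φᵀ * R * Φ) m m := by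
  have h1 : (Φ * Matrix.diagonal d * Φᵀ) * H * (Φ * Matrix.diagonal d * Φᵀ)ᵀ
      = Φ * Matrix.diagonal (fun m => lam m * d m ^ 2) * Φᵀ := by
    calc _ = Φ * Matrix.diagonal d * (Φᵀ * Φ) * Matrix.diagonal lam * (Φᵀ * Φ) *
          Matrix.diagonal d * Φᵀ := by
            rw [hH]
            simp only [Matrix.transpose_mul, Matrix.transpose_transpose,
              Matrix.diagonal_transpose, Matrix.mul_assoc]
      _ = _ := by
        rw [hΦ, mul_one, mul_one, Matrix.mul_assoc Φ, Matrix.mul_assoc Φ,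
          Matrix.diagonal_mul_diagonal, Matrix.diagonal_mul_diagonal]
        congr 3; ext m; ring
  have h2 : (Rᵀ * (Φ * Matrix.diagonal d * Φᵀ) * H * (Φ * Matrix.diagonal d * Φᵀ)ᵀ)
      = Rᵀ * (Φ * Matrix.diagonal (fun m => lam m * d m ^ 2) * Φᵀ) := by
    rw [← h1]; simp only [Matrix.mul_assoc]
  rw [h2, ← Matrix.trace_transpose, Matrix.transpose_mul, Matrix.transpose_transpose,
    Matrix.transpose_mul, Matrix.transpose_mul, Matrix.transpose_transpose,
    Matrix.diagonal_transpose, Matrix.mul_assoc, Matrix.trace_mul_comm, Matrix.mul_assoc,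
    Matrix.mul_assoc, Matrix.trace, ← Matrix.mul_assoc Φᵀ]
  simp only [Matrix.diag_apply, Matrix.diagonal_mul]

/-- The asymptotic term is a superposition of scalar sums, one for each eigenvalue of the Hessian. -/
lemma asymptoticTerm_eq (A : Matrix (Fin N) (Fin N) ℝ) (hΦ : Φᵀ * Φ = 1) (hΦ' : Φ * Φᵀ = 1)
    (hH : H = Φ * Matrix.diagonal lam * Φᵀ) (R : Matrix (Fin M) (Fin M) ℝ) (μ : ℝ) (k : Fin N)
    (i : ℕ) :
    asymptoticTerm A H R (fun i => μ / i) k i =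
      ∑ m, μ ^ 2 / 2 * (lam m * (Φᵀ * R * Φ) m m) *
        ∑ j ∈ Finset.Ico 1 i, decay (lam m * μ) j i ^ 2 / (j : ℝ) ^ 2 *
          ∑ l, (A ^ (i - j)) l k ^ 2 := by
  rw [asymptoticTerm]
  simp only [Finset.mul_sum (s := Finset.Ico 1 i)]
  rw [Finset.sum_comm]
  refine Finset.sum_congr rfl fun j hj => ?_
  obtain ⟨hj1, hj2⟩ := Finset.mem_Ico.1 hj
  have h1 : (netG A R)ᵀ = (Aᵀ * A) ⊗ₖ Rᵀ := by
    have : netG A R = (Aᵀ * A) ⊗ₖ R := by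
      rw [netG, netA, ← Matrix.kroneckerMap_transpose, ← Matrix.mul_kronecker_mul,
        ← Matrix.mul_kronecker_mul]
      simp
    rw [this, ← Matrix.kroneckerMap_transpose, Matrix.transpose_mul, Matrix.transpose_transpose]
  rw [h1, netProd_eq A hΦ hΦ' hH _ hj2, netSigma, ← Matrix.kroneckerMap_transpose,
    ← Matrix.mul_kronecker_mul, Matrix.mul_smul, ← Matrix.mul_kronecker_mul, Matrix.smul_mul,
    ← Matrix.mul_kronecker_mul, Matrix.trace_smul, Matrix.trace_kronecker, trace_combination,
    trace_modes hΦ hH, show i - (j + 1) + 1 = i - j by omega, smul_eq_mul, Finset.mul_sum,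
    Finset.mul_sum, Finset.mul_sum]
  refine Finset.sum_congr rfl fun m _ => ?_
  have h2 : ∏ t ∈ Finset.Ico (j + 1) i, (1 - μ / (t : ℝ) * lam m) = decay (lam m * μ) j i :=
    Finset.prod_congr rfl fun t _ => by ring
  rw [h2]
  ring

lemma norm_sq_perron_pos {p : EuclideanSpace ℝ (Fin N)} (hp1 : ∑ l, p l = 1) : 0 < ‖p‖ ^ 2 := by
  have : p ≠ 0 := by rintro rfl; simp at hp1
  positivity

lemma closedForm_nonneg {R : Matrix (Fin M) (Fin M) ℝ} (μ : ℝ) (p : EuclideanSpace ℝ (Fin N))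
    (hlam : ∀ m, 0 ≤ lam m) (hR : ∀ m, 0 ≤ (Φᵀ * R * Φ) m m) (i : ℕ) :
    0 ≤ closedForm μ lam Φ R p i := by
  refine mul_nonneg (mul_nonneg (by positivity) (Finset.sum_nonneg fun m _ => ?_)) (by positivity)
  exact mul_nonneg (mul_nonneg (hlam m) (alphaRate_nonneg _ _ _)) (hR m)

lemma single_le_closedForm {R : Matrix (Fin M) (Fin M) ℝ} (μ : ℝ) (p : EuclideanSpace ℝ (Fin N))
    (hlam : ∀ m, 0 ≤ lam m) (hR : ∀ m, 0 ≤ (Φᵀ * R * Φ) m m) (m : Fin M) (i : ℕ) :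
    μ ^ 2 / 2 * (lam m * (Φᵀ * R * Φ) m m) * ‖p‖ ^ 2 * alphaRate (lam m) μ i
      ≤ closedForm μ lam Φ R p i := by
  have h1 := Finset.single_le_sum (f := fun m => lam m * alphaRate (lam m) μ i * (Φᵀ * R * Φ) m m)
    (fun m _ => mul_nonneg (mul_nonneg (hlam m) (alphaRate_nonneg _ _ _)) (hR m))
    (Finset.mem_univ m)
  have h2 := mul_le_mul_of_nonneg_right
    (mul_le_mul_of_nonneg_left h1 (show 0 ≤ μ ^ 2 / 2 by positivity)) (sq_nonneg ‖p‖)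
  rw [closedForm]
  refine le_trans (le_of_eq ?_) h2
  ring

lemma closedForm_eventually_pos {R : Matrix (Fin M) (Fin M) ℝ} {μ : ℝ} (hμ : 0 < μ)
    {p : EuclideanSpace ℝ (Fin N)} (hp1 : ∑ l, p l = 1)
    (hlam : ∀ m, 0 < lam m) (hR : ∀ m, 0 ≤ (Φᵀ * R * Φ) m m)
    {m : Fin M} (hm : (Φᵀ * R * Φ) m m ≠ 0) :
    ∀ᶠ i in atTop, 0 < closedForm μ lam Φ R p i := by
  filter_upwards [eventually_alphaRate_pos (lam m) μ] with i hi
  refine lt_of_lt_of_le ?_ (single_le_closedForm μ p (fun m => (hlam m).le) hR m i)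
  have h1 := hlam m
  have h2 := (hR m).lt_of_ne' hm
  have h3 := norm_sq_perron_pos hp1
  positivity

/-- The asymptotic term is equivalent to the closed form: each mode contributes a scalar sum whose
weights `∑_l (A^{i-j})_{lk}²` converge to `‖p‖²`. -/
lemma asymptoticTerm_isEquivalent {A : Matrix (Fin N) (Fin N) ℝ} (hA : LeftStochasticPrimitive A)
    {p : EuclideanSpace ℝ (Fin N)} (hp : A *ᵥ (fun l => p l) = fun l => p l) (hp1 : ∑ l, p l = 1)
    (hΦ : Φᵀ * Φ = 1) (hΦ' : Φ * Φᵀ = 1) (hH : H = Φ * Matrix.diagonal lam * Φᵀ)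
    {R : Matrix (Fin M) (Fin M) ℝ} {μ : ℝ} (hμ : 0 < μ) (hlam : ∀ m, 0 < lam m)
    (hR : ∀ m, 0 ≤ (Φᵀ * R * Φ) m m) (k : Fin N) :
    (fun i => asymptoticTerm A H R (fun i => μ / i) k i)
      ~[atTop] (fun i => closedForm μ lam Φ R p i) := by
  have hw : Tendsto (fun n => ∑ l, (A ^ n) l k ^ 2) atTop (𝓝 (‖p‖ ^ 2)) := by
    rw [EuclideanSpace.real_norm_sq_eq]
    exact tendsto_finsetSum _ fun l _ => (tendsto_pow_apply hA hp hp1 l k).pow 2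
  have hsum : (fun i => ∑ m, μ ^ 2 / 2 * (lam m * (Φᵀ * R * Φ) m m) *
      ((∑ j ∈ Finset.Ico 1 i, decay (lam m * μ) j i ^ 2 / (j : ℝ) ^ 2 *
          ∑ l, (A ^ (i - j)) l k ^ 2) - ‖p‖ ^ 2 * alphaRate (lam m) μ i))
      =o[atTop] (fun i => closedForm μ lam Φ R p i) := by
    refine IsLittleO.fun_sum fun m _ => ?_
    rcases eq_or_ne ((Φᵀ * R * Φ) m m) 0 with h0 | h0
    · simp only [h0, mul_zero, zero_mul]
      exact isLittleO_zero (E' := ℝ) _ _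
    refine ((isLittleO_weighted_rateSum (mul_pos (hlam m) hμ).le hw).const_mul_left _).trans_isBigO
      ?_
    have h1 := hlam m
    have h2 := (hR m).lt_of_ne' h0
    have h3 := norm_sq_perron_pos hp1
    have h4 : 0 < μ ^ 2 / 2 * (lam m * (Φᵀ * R * Φ) m m) * ‖p‖ ^ 2 := by positivity
    refine IsBigO.of_bound (1 / (μ ^ 2 / 2 * (lam m * (Φᵀ * R * Φ) m m) * ‖p‖ ^ 2))
      (Eventually.of_forall fun i => ?_)
    rw [Real.norm_of_nonneg (alphaRate_nonneg _ _ _),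
      Real.norm_of_nonneg (closedForm_nonneg μ p (fun m => (hlam m).le) hR i), one_div,
      inv_mul_eq_div, le_div_iff₀ h4, mul_comm]
    exact single_le_closedForm μ p (fun m => (hlam m).le) hR m i
  refine hsum.congr_left fun i => ?_
  rw [Pi.sub_apply, asymptoticTerm_eq A hΦ hΦ' hH, closedForm]
  simp only [mul_sub, Finset.sum_sub_distrib]
  congr 1
  rw [Finset.mul_sum, Finset.sum_mul]
  exact Finset.sum_congr rfl fun m _ => by ring

end AsymptoticTerm


/-! ### The risk near its minimizer -/

section RiskAnalysis

variable {M : ℕ}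

local notation "⟪" x ", " y "⟫" => inner ℝ x y

lemma bilin_eq_sum (B : Param M →L[ℝ] Param M →L[ℝ] ℝ) (x y : Param M) :
    B x y = ∑ a, ∑ b, x a * (y b * B (EuclideanSpace.single a 1) (EuclideanSpace.single b 1)) := by
  have hx : ∀ z : Param M, z = ∑ a, z a • EuclideanSpace.single a (1 : ℝ) := fun z => by
    ext b; simp [Finset.sum_apply, Pi.single_apply]
  conv_lhs => rw [hx x, hx y]
  simp only [map_sum, sum_apply, map_smul, _root_.smul_apply,
    smul_eq_mul, Finset.mul_sum]
  rw [Finset.sum_comm]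
  exact Finset.sum_congr rfl fun a _ => Finset.sum_congr rfl fun b _ => by ring

lemma fderiv_fderiv_apply (J : Param M → ℝ) (w x y : Param M) :
    fderiv ℝ (fderiv ℝ J) w x y = (x : Fin M → ℝ) ⬝ᵥ (hessian J w *ᵥ (y : Fin M → ℝ)) := by
  rw [bilin_eq_sum]
  simp only [dotProduct, Matrix.mulVec, hessian, Matrix.of_apply, Finset.mul_sum]
  exact Finset.sum_congr rfl fun a _ => Finset.sum_congr rfl fun b _ => by ring

lemma norm_sq_eq_dotProduct (x : Param M) : ‖x‖ ^ 2 = (x : Fin M → ℝ) ⬝ᵥ (x : Fin M → ℝ) := by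
  rw [EuclideanSpace.real_norm_sq_eq]; simp [dotProduct, sq]

variable {J : Param M → ℝ} {lo hi : ℝ}

lemma BoundedHessian.le_apply (hJ : BoundedHessian J lo hi) (w x : Param M) :
    lo * ‖x‖ ^ 2 ≤ fderiv ℝ (fderiv ℝ J) w x x := by
  have h := (hJ.lower w).dotProduct_mulVec_nonneg x
  rw [Matrix.sub_mulVec, dotProduct_sub, Matrix.smul_mulVec, Matrix.one_mulVec, dotProduct_smul,
    star_trivial, smul_eq_mul, ← norm_sq_eq_dotProduct, ← fderiv_fderiv_apply] at h
  linarith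

lemma BoundedHessian.apply_le (hJ : BoundedHessian J lo hi) (w x : Param M) :
    fderiv ℝ (fderiv ℝ J) w x x ≤ hi * ‖x‖ ^ 2 := by
  have h := (hJ.upper w).dotProduct_mulVec_nonneg x
  rw [Matrix.sub_mulVec, dotProduct_sub, Matrix.smul_mulVec, Matrix.one_mulVec, dotProduct_smul,
    star_trivial, smul_eq_mul, ← norm_sq_eq_dotProduct, ← fderiv_fderiv_apply] at h
  linarith

lemma BoundedHessian.symm_apply (hJ : BoundedHessian J lo hi) (w x y : Param M) :
    fderiv ℝ (fderiv ℝ J) w x y = fderiv ℝ (fderiv ℝ J) w y x :=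
  (hJ.contDiff.contDiffAt.isSymmSndFDerivAt (by simp)).eq x y

lemma BoundedHessian.hi_pos (hJ : BoundedHessian J lo hi) : 0 < hi := hJ.lo_pos.trans_le hJ.lo_le_hi

lemma BoundedHessian.norm_le (hJ : BoundedHessian J lo hi) (w : Param M) :
    ‖fderiv ℝ (fderiv ℝ J) w‖ ≤ hi := by
  set B := fderiv ℝ (fderiv ℝ J) w
  -- positivity of the quadratic form at `x ± y` bounds the bilinear form on unit vectors
  have hunit : ∀ x y : Param M, ‖x‖ ≤ 1 → ‖y‖ ≤ 1 → |B x y| ≤ hi := by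
    intro x y hx hy
    have h1 : 0 ≤ B (x - y) (x - y) := by
      have h := hJ.le_apply w (x - y)
      have := hJ.lo_pos
      exact le_trans (by positivity) h
    have h2 : 0 ≤ B (x + y) (x + y) := by
      have h := hJ.le_apply w (x + y)
      have := hJ.lo_pos
      exact le_trans (by positivity) h
    simp only [map_sub, map_add, _root_.sub_apply, _root_.add_apply]
      at h1 h2
    have h3 := hJ.symm_apply w x y
    have h4 := hJ.apply_le w x
    have h5 := hJ.apply_le w y
    have hh := hJ.hi_pos
    have h6 : hi * ‖x‖ ^ 2 ≤ hi := by
      have : ‖x‖ ^ 2 ≤ 1 := pow_le_one₀ (norm_nonneg _) hx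
      nlinarith
    have h7 : hi * ‖y‖ ^ 2 ≤ hi := by
      have : ‖y‖ ^ 2 ≤ 1 := pow_le_one₀ (norm_nonneg _) hy
      nlinarith
    change B x y = B y x at h3
    change B x x ≤ _ at h4
    change B y y ≤ _ at h5
    rw [abs_le]; constructor <;> linarith
  refine ContinuousLinearMap.opNorm_le_of_unit_norm hJ.hi_pos.le fun x hx => ?_
  refine ContinuousLinearMap.opNorm_le_of_unit_norm hJ.hi_pos.le fun y hy => ?_
  exact hunit x y hx.le hy.le

lemma BoundedHessian.differentiable (hJ : BoundedHessian J lo hi) : Differentiable ℝ J :=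
  hJ.contDiff.differentiable (by norm_num)

lemma BoundedHessian.contDiff_fderiv (hJ : BoundedHessian J lo hi) : ContDiff ℝ 1 (fderiv ℝ J) :=
  hJ.contDiff.fderiv_right (by norm_num)

lemma BoundedHessian.differentiable_fderiv (hJ : BoundedHessian J lo hi) :
    Differentiable ℝ (fderiv ℝ J) :=
  hJ.contDiff_fderiv.differentiable (by norm_num)

lemma inner_gradient (J : Param M → ℝ) (w y : Param M) : ⟪gradient J w, y⟫ = fderiv ℝ J w y := by
  rw [gradient, InnerProductSpace.toDual_symm_apply]

lemma norm_gradient (J : Param M → ℝ) (w : Param M) : ‖gradient J w‖ = ‖fderiv ℝ J w‖ := by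
  rw [gradient, LinearIsometryEquiv.norm_map]

lemma BoundedHessian.continuous_gradient (hJ : BoundedHessian J lo hi) :
    Continuous (gradient J) :=
  (InnerProductSpace.toDual ℝ (Param M)).symm.continuous.comp hJ.contDiff_fderiv.continuous

variable {wo : Param M}

lemma fderiv_minimizer (hwo : ∀ w, J wo ≤ J w) : fderiv ℝ J wo = 0 :=
  IsLocalMin.fderiv_eq_zero (Eventually.of_forall hwo)

lemma hasDerivAt_fderiv_line (hJ : BoundedHessian J lo hi) (w e : Param M) (t : ℝ) :
    HasDerivAt (fun t : ℝ => fderiv ℝ J (w + t • e) e)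
      (fderiv ℝ (fderiv ℝ J) (w + t • e) e e) t := by
  have h1 : HasDerivAt (fun t : ℝ => w + t • e) e t := by
    simpa using ((hasDerivAt_id t).smul_const e).const_add w
  have h2 := (hJ.differentiable_fderiv (w + t • e)).hasFDerivAt.comp_hasDerivAt t h1
  exact ((ContinuousLinearMap.apply ℝ ℝ e).hasFDerivAt).comp_hasDerivAt t h2

lemma BoundedHessian.inner_gradient_ge (hJ : BoundedHessian J lo hi) (hwo : ∀ w, J wo ≤ J w)
    (w : Param M) : lo * ‖w - wo‖ ^ 2 ≤ ⟪gradient J w, w - wo⟫ := by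
  obtain ⟨t, -, ht⟩ := exists_hasDerivAt_eq_slope
    (fun t : ℝ => fderiv ℝ J (wo + t • (w - wo)) (w - wo))
    (fun t : ℝ => fderiv ℝ (fderiv ℝ J) (wo + t • (w - wo)) (w - wo) (w - wo))
    (zero_lt_one) (fun t _ => (hasDerivAt_fderiv_line hJ wo (w - wo) t).continuousAt.continuousWithinAt)
    (fun t _ => hasDerivAt_fderiv_line hJ wo (w - wo) t)
  have h := hJ.le_apply (wo + t • (w - wo)) (w - wo)
  simp only [zero_smul, add_zero, one_smul, add_sub_cancel, fderiv_minimizer hwo, sub_zero,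
    div_one, _root_.zero_apply] at ht
  rw [inner_gradient, ← ht]
  exact h

lemma BoundedHessian.norm_gradient_le (hJ : BoundedHessian J lo hi) (hwo : ∀ w, J wo ≤ J w)
    (w : Param M) : ‖gradient J w‖ ≤ hi * ‖w - wo‖ := by
  have h := convex_univ.norm_image_sub_le_of_norm_fderiv_le
    (f := fderiv ℝ J) (𝕜 := ℝ) (fun u _ => hJ.differentiable_fderiv u) (fun u _ => hJ.norm_le u)
    (Set.mem_univ wo) (Set.mem_univ w)
  rw [fderiv_minimizer hwo, sub_zero] at h
  rwa [norm_gradient]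

/-- One gradient step contracts the squared distance to the minimizer up to second order. -/
lemma BoundedHessian.norm_sq_step_le (hJ : BoundedHessian J lo hi) (hwo : ∀ w, J wo ≤ J w)
    (w : Param M) {τ : ℝ} (hτ : 0 ≤ τ) :
    ‖(w - wo) - τ • gradient J w‖ ^ 2 ≤ (1 - 2 * lo * τ + hi ^ 2 * τ ^ 2) * ‖w - wo‖ ^ 2 := by
  rw [norm_sub_sq_real, norm_smul, inner_smul_right, Real.norm_of_nonneg hτ, real_inner_comm]
  have h1 := hJ.inner_gradient_ge hwo w
  have h2 := pow_le_pow_left₀ (norm_nonneg _) (hJ.norm_gradient_le hwo w) 2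
  have h3 := mul_le_mul_of_nonneg_left h1 hτ
  have h4 := mul_le_mul_of_nonneg_left h2 (sq_nonneg τ)
  nlinarith

/-- First-order expansion of the gradient at the minimizer, with error controlled by the variation
of the Hessian. -/
lemma BoundedHessian.norm_fderiv_sub_le (hJ : BoundedHessian J lo hi) (hwo : ∀ w, J wo ≤ J w)
    {w : Param M} {ε : ℝ}
    (h : ∀ u, ‖u - wo‖ ≤ ‖w - wo‖ →
      ‖fderiv ℝ (fderiv ℝ J) u - fderiv ℝ (fderiv ℝ J) wo‖ ≤ ε) :
    ‖fderiv ℝ J w - fderiv ℝ (fderiv ℝ J) wo (w - wo)‖ ≤ ε * ‖w - wo‖ := by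
  have h1 := (convex_closedBall wo ‖w - wo‖).norm_image_sub_le_of_norm_hasFDerivWithin_le
    (f := fun u => fderiv ℝ J u - fderiv ℝ (fderiv ℝ J) wo u)
    (f' := fun u => fderiv ℝ (fderiv ℝ J) u - fderiv ℝ (fderiv ℝ J) wo) (𝕜 := ℝ) (C := ε)
    (fun u _ => ((hJ.differentiable_fderiv u).hasFDerivAt.sub
      (fderiv ℝ (fderiv ℝ J) wo).hasFDerivAt).hasFDerivWithinAt)
    (fun u hu => h u (by rwa [mem_closedBall_iff_norm] at hu))
    (Metric.mem_closedBall_self (norm_nonneg _)) (show w ∈ Metric.closedBall wo ‖w - wo‖ by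
      rw [mem_closedBall_iff_norm])
  have h2 : fderiv ℝ J w - fderiv ℝ (fderiv ℝ J) wo w -
      (fderiv ℝ J wo - fderiv ℝ (fderiv ℝ J) wo wo)
      = fderiv ℝ J w - fderiv ℝ (fderiv ℝ J) wo (w - wo) := by
    rw [fderiv_minimizer hwo, map_sub]; abel
  rwa [h2] at h1

lemma BoundedHessian.exists_hessian_close (hJ : BoundedHessian J lo hi) (wo : Param M) {ε : ℝ}
    (hε : 0 < ε) : ∃ δ > 0, ∀ u, ‖u - wo‖ ≤ δ →
      ‖fderiv ℝ (fderiv ℝ J) u - fderiv ℝ (fderiv ℝ J) wo‖ ≤ ε := by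
  have hc : Continuous (fderiv ℝ (fderiv ℝ J)) := hJ.contDiff_fderiv.continuous_fderiv (by norm_num)
  have h1 : Tendsto (fun u => ‖fderiv ℝ (fderiv ℝ J) u - fderiv ℝ (fderiv ℝ J) wo‖) (𝓝 wo) (𝓝 0) := by
    have h0 := (tendsto_iff_norm_sub_tendsto_zero
      (E := Param M →L[ℝ] Param M →L[ℝ] ℝ)).1 (hc.tendsto wo)
    exact h0
  obtain ⟨δ, hδ, h⟩ := Metric.eventually_nhds_iff.1 (h1.eventually_lt_const hε)
  refine ⟨δ / 2, by positivity, fun u hu => ?_⟩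
  exact (h (show dist u wo < δ by rw [dist_eq_norm]; linarith)).le

/-- Second-order expansion of the risk at the minimizer. -/
lemma BoundedHessian.sub_le_quadratic (hJ : BoundedHessian J lo hi) (hwo : ∀ w, J wo ≤ J w)
    {ε : ℝ} (hε : 0 < ε) : ∃ δ > 0, ∀ w, ‖w - wo‖ ≤ δ →
      J w - J wo ≤ 1 / 2 * fderiv ℝ (fderiv ℝ J) wo (w - wo) (w - wo) + ε * ‖w - wo‖ ^ 2 := by
  obtain ⟨δ, hδ, hclose⟩ := hJ.exists_hessian_close wo hε
  refine ⟨δ, hδ, fun w hw => ?_⟩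
  have hwe : wo + (w - wo) = w := add_sub_cancel _ _
  generalize w - wo = e at hw hwe ⊢
  set B := fderiv ℝ (fderiv ℝ J) wo
  have hderiv : ∀ t : ℝ, HasDerivAt (fun t : ℝ => J (wo + t • e) - t ^ 2 * (1 / 2 * B e e))
      (fderiv ℝ J (wo + t • e) e - t * B e e) t := by
    intro t
    have h1 : HasDerivAt (fun t : ℝ => wo + t • e) e t := by
      simpa using ((hasDerivAt_id t).smul_const e).const_add wo
    have h2 := (hJ.differentiable (wo + t • e)).hasFDerivAt.comp_hasDerivAt t h1
    have h3 := ((hasDerivAt_pow 2 t).mul_const (1 / 2 * B e e))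
    refine (h2.sub h3).congr_deriv ?_
    norm_num; ring
  obtain ⟨t, ht, heq⟩ := exists_hasDerivAt_eq_slope
    (fun t : ℝ => J (wo + t • e) - t ^ 2 * (1 / 2 * B e e))
    (fun t : ℝ => fderiv ℝ J (wo + t • e) e - t * B e e)
    zero_lt_one (fun t _ => (hderiv t).continuousAt.continuousWithinAt) (fun t _ => hderiv t)
  have h4 := hJ.norm_fderiv_sub_le hwo (w := wo + t • e) (ε := ε) (fun u hu => by
    refine hclose u (hu.trans ?_)
    rw [add_sub_cancel_left, norm_smul, Real.norm_of_nonneg ht.1.le]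
    nlinarith [ht.2, norm_nonneg e, ht.1])
  rw [add_sub_cancel_left] at h4
  have h5 : fderiv ℝ J (wo + t • e) e - t * B e e ≤ ε * ‖e‖ ^ 2 := by
    have h6 : fderiv ℝ J (wo + t • e) e - t * B e e = (fderiv ℝ J (wo + t • e) - B (t • e)) e := by
      simp
    rw [h6]
    refine (le_abs_self _).trans ?_
    rw [← Real.norm_eq_abs]
    refine ((ContinuousLinearMap.le_opNorm _ _).trans ?_)
    refine (mul_le_mul_of_nonneg_right h4 (norm_nonneg _)).trans ?_
    rw [norm_smul, Real.norm_of_nonneg ht.1.le]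
    have : t * (ε * ‖e‖ ^ 2) ≤ 1 * (ε * ‖e‖ ^ 2) := by
      have := ht.2.le
      gcongr
    linarith
  simp only [one_smul, zero_smul, add_zero, one_pow, one_mul, sub_zero, div_one, hwe] at heq
  norm_num at heq
  have h7 : J w - J wo = (fderiv ℝ J (wo + t • e) e - t * B e e) + 1 / 2 * B e e := by
    linarith
  rw [h7]; linarith

section Modes

variable {Φ : Matrix (Fin M) (Fin M) ℝ} {lam : Fin M → ℝ}

/-- The `m`-th column of the matrix `Φ`, an eigenvector of the Hessian at the minimizer. -/
noncomputable def mode (Φ : Matrix (Fin M) (Fin M) ℝ) (m : Fin M) : Param M :=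
  WithLp.toLp 2 fun a => Φ a m

lemma inner_mode (m : Fin M) (x : Param M) : ⟪mode Φ m, x⟫ = (Φᵀ *ᵥ (x : Fin M → ℝ)) m := by
  simp [mode, PiLp.inner_apply, Matrix.mulVec, dotProduct, mul_comm]

lemma sum_inner_mode_sq (hΦ' : Φ * Φᵀ = 1) (x : Param M) : ∑ m, ⟪mode Φ m, x⟫ ^ 2 = ‖x‖ ^ 2 := by
  have h1 : ∑ m, ⟪mode Φ m, x⟫ ^ 2
      = (Φᵀ *ᵥ (x : Fin M → ℝ)) ⬝ᵥ (Φᵀ *ᵥ (x : Fin M → ℝ)) := by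
    simp only [inner_mode, dotProduct, sq]
  rw [h1, Matrix.dotProduct_mulVec, Matrix.vecMul_mulVec, norm_sq_eq_dotProduct]
  simp [hΦ']

lemma norm_mode (hΦ : Φᵀ * Φ = 1) (m : Fin M) : ‖mode Φ m‖ = 1 := by
  have h : ‖mode Φ m‖ ^ 2 = (Φᵀ * Φ) m m := by
    rw [EuclideanSpace.real_norm_sq_eq]; simp [mode, Matrix.mul_apply, sq]
  rw [hΦ, Matrix.one_apply_eq] at h
  exact (sq_eq_sq₀ (norm_nonneg _) zero_le_one).1 (by rw [h]; norm_num)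

lemma inner_mode_sq_le (hΦ' : Φ * Φᵀ = 1) (m : Fin M) (x : Param M) :
    ⟪mode Φ m, x⟫ ^ 2 ≤ ‖x‖ ^ 2 := by
  rw [← sum_inner_mode_sq hΦ']
  exact Finset.single_le_sum (f := fun m => ⟪mode Φ m, x⟫ ^ 2) (fun _ _ => sq_nonneg _)
    (Finset.mem_univ m)

lemma fderiv_fderiv_mode (hΦ : Φᵀ * Φ = 1)
    (hH : hessian J wo = Φ * Matrix.diagonal lam * Φᵀ) (m : Fin M) (x : Param M) :
    fderiv ℝ (fderiv ℝ J) wo x (mode Φ m) = lam m * ⟪mode Φ m, x⟫ := by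
  have h1 : hessian J wo * Φ = Φ * Matrix.diagonal lam := by
    rw [hH, Matrix.mul_assoc, hΦ, mul_one]
  have h2 : hessian J wo *ᵥ (mode Φ m : Fin M → ℝ) = lam m • fun a => Φ a m := by
    ext a
    have := congrFun (congrFun h1 a) m
    rw [Matrix.mul_diagonal] at this
    simpa [mode, Matrix.mulVec, dotProduct, Matrix.mul_apply, mul_comm] using this
  rw [fderiv_fderiv_apply, h2, dotProduct_smul, smul_eq_mul, real_inner_comm]
  simp [mode, PiLp.inner_apply, dotProduct, mul_comm]

lemma fderiv_fderiv_eq_sum (hH : hessian J wo = Φ * Matrix.diagonal lam * Φᵀ) (x : Param M) :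
    fderiv ℝ (fderiv ℝ J) wo x x = ∑ m, lam m * ⟪mode Φ m, x⟫ ^ 2 := by
  rw [fderiv_fderiv_apply, hH, ← Matrix.mulVec_mulVec, ← Matrix.mulVec_mulVec,
    Matrix.dotProduct_mulVec, ← Matrix.mulVec_transpose]
  simp only [dotProduct, inner_mode, Matrix.mulVec_diagonal]
  exact Finset.sum_congr rfl fun m _ => by ring

lemma lo_le_eigenvalue (hJ : BoundedHessian J lo hi) (hΦ : Φᵀ * Φ = 1)
    (hH : hessian J wo = Φ * Matrix.diagonal lam * Φᵀ) (m : Fin M) : lo ≤ lam m := by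
  have h := hJ.le_apply wo (mode Φ m)
  rw [fderiv_fderiv_mode hΦ hH, real_inner_self_eq_norm_sq, norm_mode hΦ] at h
  linarith

lemma abs_inner_mode_gradient_sub_le (hJ : BoundedHessian J lo hi) (hwo : ∀ w, J wo ≤ J w)
    (hΦ : Φᵀ * Φ = 1) (hH : hessian J wo = Φ * Matrix.diagonal lam * Φᵀ)
    {w : Param M} {ε : ℝ}
    (h : ∀ u, ‖u - wo‖ ≤ ‖w - wo‖ →
      ‖fderiv ℝ (fderiv ℝ J) u - fderiv ℝ (fderiv ℝ J) wo‖ ≤ ε) (m : Fin M) :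
    |⟪mode Φ m, gradient J w⟫ - lam m * ⟪mode Φ m, w - wo⟫| ≤ ε * ‖w - wo‖ := by
  have h1 := hJ.norm_fderiv_sub_le hwo h
  rw [real_inner_comm, inner_gradient, ← fderiv_fderiv_mode hΦ hH, ← _root_.sub_apply,
    ← Real.norm_eq_abs]
  refine (ContinuousLinearMap.le_opNorm _ _).trans ?_
  rwa [norm_mode hΦ, mul_one]

end Modes

lemma norm_bilin_le_sum (B : Param M →L[ℝ] Param M →L[ℝ] ℝ) :
    ‖B‖ ≤ ∑ a, ∑ b, |B (EuclideanSpace.single a 1) (EuclideanSpace.single b 1)| := by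
  have h0 : 0 ≤ ∑ a, ∑ b, |B (EuclideanSpace.single a 1) (EuclideanSpace.single b 1)| :=
    Finset.sum_nonneg fun _ _ => Finset.sum_nonneg fun _ _ => abs_nonneg _
  refine ContinuousLinearMap.opNorm_le_bound₂ _ h0 fun x y => ?_
  rw [bilin_eq_sum, Real.norm_eq_abs, Finset.sum_mul, Finset.sum_mul]
  refine (Finset.abs_sum_le_sum_abs _ _).trans (Finset.sum_le_sum fun a _ => ?_)
  rw [Finset.sum_mul, Finset.sum_mul]
  refine (Finset.abs_sum_le_sum_abs _ _).trans (Finset.sum_le_sum fun b _ => ?_)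
  rw [abs_mul, abs_mul]
  have hx := PiLp.norm_apply_le x a
  have hy := PiLp.norm_apply_le y b
  rw [Real.norm_eq_abs] at hx hy
  calc |x a| * (|y b| * |B (EuclideanSpace.single a 1) (EuclideanSpace.single b 1)|)
      ≤ ‖x‖ * (‖y‖ * |B (EuclideanSpace.single a 1) (EuclideanSpace.single b 1)|) := by gcongr
    _ = _ := by ring

/-- Hölder continuity of the Hessian entries at a point gives Hölder continuity in operator norm. -/
lemma exists_hessian_holder {β : ℝ}
    (h : ∀ a b, (fun w => hessian J w a b - hessian J wo a b) =O[𝓝 wo] (fun w => ‖w - wo‖ ^ β)) :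
    ∃ C > 0, ∃ δ > 0, ∀ u, ‖u - wo‖ ≤ δ →
      ‖fderiv ℝ (fderiv ℝ J) u - fderiv ℝ (fderiv ℝ J) wo‖ ≤ C * ‖u - wo‖ ^ β := by
  have h1 : (fun u => ∑ a, ∑ b, |hessian J u a b - hessian J wo a b|)
      =O[𝓝 wo] (fun w => ‖w - wo‖ ^ β) :=
    IsBigO.fun_sum fun a _ => IsBigO.fun_sum fun b _ => (h a b).abs_left
  obtain ⟨C, hC, hb⟩ := h1.exists_pos
  obtain ⟨δ, hδ, hball⟩ := Metric.eventually_nhds_iff.1 hb.bound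
  refine ⟨C, hC, δ / 2, by positivity, fun u hu => ?_⟩
  have h2 := hball (show dist u wo < δ by rw [dist_eq_norm]; linarith)
  rw [Real.norm_of_nonneg (show 0 ≤ ‖u - wo‖ ^ β by positivity)] at h2
  refine (norm_bilin_le_sum _).trans ((le_abs_self _).trans ?_)
  exact h2

end RiskAnalysis


/-! ### Integrating out an independent variable -/

section Freezing

variable {Ω T E : Type*} [MeasurableSpace Ω] [MeasurableSpace T] [MeasurableSpace E]

/-- Expectation of a non-negative function of two independent variables: the second one may be
integrated out with the first one frozen. -/
lemma integrable_and_integral_of_indepFun {P : Measure Ω} [IsProbabilityMeasure P] {Z : Ω → T}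
    {X : Ω → E} (hZ : Measurable Z) (hX : Measurable X) (hind : IndepFun Z X P) {φ : T × E → ℝ}
    (hφ : Measurable φ) (hφ0 : ∀ z, 0 ≤ φ z)
    (hint : ∀ z, Integrable (fun ξ => φ (z, ξ)) (P.map X))
    (hint2 : Integrable (fun ω => ∫ ξ, φ (Z ω, ξ) ∂(P.map X)) P) :
    Integrable (fun ω => φ (Z ω, X ω)) P ∧
      ∫ ω, φ (Z ω, X ω) ∂P = ∫ ω, ∫ ξ, φ (Z ω, ξ) ∂(P.map X) ∂P := by
  have : IsProbabilityMeasure (P.map X) := Measure.isProbabilityMeasure_map hX.aemeasurable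
  have : IsProbabilityMeasure (P.map Z) := Measure.isProbabilityMeasure_map hZ.aemeasurable
  have hmap := (indepFun_iff_map_prod_eq_prod_map_map hZ.aemeasurable hX.aemeasurable).1 hind
  have hm : StronglyMeasurable (fun z => ∫ ξ, φ (z, ξ) ∂(P.map X)) :=
    hφ.stronglyMeasurable.integral_prod_right'
  have h1 : Integrable (fun z => ∫ ξ, φ (z, ξ) ∂(P.map X)) (P.map Z) :=
    (integrable_map_measure hm.aestronglyMeasurable hZ.aemeasurable).2 hint2
  have h2 : Integrable φ ((P.map Z).prod (P.map X)) := by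
    rw [integrable_prod_iff hφ.aestronglyMeasurable]
    refine ⟨Eventually.of_forall hint, ?_⟩
    simpa only [Real.norm_of_nonneg (hφ0 _)] using h1
  have h3 := h2
  rw [← hmap, integrable_map_measure hφ.aestronglyMeasurable (hZ.prodMk hX).aemeasurable] at h3
  refine ⟨h3, ?_⟩
  rw [← integral_map (φ := fun ω => (Z ω, X ω)) (hZ.prodMk hX).aemeasurable
    hφ.aestronglyMeasurable, hmap, integral_prod _ h2,
    integral_map hZ.aemeasurable hm.aestronglyMeasurable]

lemma indepFun_prodMk_left {T' : Type*} [MeasurableSpace T'] {P : Measure Ω} [IsProbabilityMeasure P]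
    {W : Ω → T'} {Y : Ω → T} {X : Ω → E} (hW : Measurable W) (hY : Measurable Y)
    (hX : Measurable X) (h1 : IndepFun W (fun ω => (Y ω, X ω)) P) (h2 : IndepFun Y X P) :
    IndepFun (fun ω => (W ω, Y ω)) X P := by
  have : IsProbabilityMeasure (P.map X) := Measure.isProbabilityMeasure_map hX.aemeasurable
  have : IsProbabilityMeasure (P.map Y) := Measure.isProbabilityMeasure_map hY.aemeasurable
  have : IsProbabilityMeasure (P.map W) := Measure.isProbabilityMeasure_map hW.aemeasurable
  have h3 : IndepFun W Y P := h1.comp measurable_id measurable_fst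
  have e1 := (indepFun_iff_map_prod_eq_prod_map_map hW.aemeasurable
    (hY.prodMk hX).aemeasurable).1 h1
  have e2 := (indepFun_iff_map_prod_eq_prod_map_map hY.aemeasurable hX.aemeasurable).1 h2
  have e3 := (indepFun_iff_map_prod_eq_prod_map_map hW.aemeasurable hY.aemeasurable).1 h3
  rw [indepFun_iff_map_prod_eq_prod_map_map (hW.prodMk hY).aemeasurable hX.aemeasurable, e3]
  have e4 : P.map (fun ω => ((W ω, Y ω), X ω))
      = (P.map (fun ω => (W ω, (Y ω, X ω)))).map MeasurableEquiv.prodAssoc.symm := by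
    rw [Measure.map_map (MeasurableEquiv.measurable _) (hW.prodMk (hY.prodMk hX))]
    rfl
  rw [e4, e1, e2, ← Measure.prodAssoc_prod, Measure.map_map (MeasurableEquiv.measurable _)
    (MeasurableEquiv.measurable _)]
  simp

end Freezing

/-! ### Moments of one step of the noise -/

section Model

set_option linter.unusedSectionVars false

variable {M N : ℕ} {S Ω : Type*} [MeasurableSpace S]

local notation "⟪" x ", " y "⟫" => inner ℝ x y

/-- The variables revealed up to time `i`: the initial estimates and the samples `x k j`, `j ≤ i`. -/
def pastData (w₀ : Fin N → Ω → Param M) (x : Fin N → ℕ → Ω → S) (i : ℕ) (ω : Ω) :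
    (Fin N → Param M) × ((Finset.univ ×ˢ Finset.range (i + 1) : Finset (Fin N × ℕ)) → S) :=
  (fun k => w₀ k ω, fun q => x q.1.1 q.1.2 ω)

/-- The σ-algebra generated by the initial estimates and the samples up to time `i`; it contains the
history of the estimates up to time `i`, and is independent of the samples at time `i + 1`. -/
abbrev past (w₀ : Fin N → Ω → Param M) (x : Fin N → ℕ → Ω → S) (i : ℕ) : MeasurableSpace Ω :=
  MeasurableSpace.comap (pastData w₀ x i) inferInstance

lemma measurable_past_init (w₀ : Fin N → Ω → Param M) (x : Fin N → ℕ → Ω → S) (i : ℕ) (k : Fin N) :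
    Measurable[past w₀ x i] (w₀ k) := by
  have h : Measurable[past w₀ x i] (pastData w₀ x i) := comap_measurable _
  exact (measurable_pi_apply k).comp (measurable_fst.comp h)

lemma measurable_past_sample (w₀ : Fin N → Ω → Param M) (x : Fin N → ℕ → Ω → S) {i j : ℕ}
    (hj : j ≤ i) (k : Fin N) : Measurable[past w₀ x i] (x k j) := by
  have h : Measurable[past w₀ x i] (pastData w₀ x i) := comap_measurable _
  exact (measurable_pi_apply (⟨(k, j), by simp; omega⟩ :
    (Finset.univ ×ˢ Finset.range (i + 1) : Finset (Fin N × ℕ)))).comp (measurable_snd.comp h)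

lemma past_mono (w₀ : Fin N → Ω → Param M) (x : Fin N → ℕ → Ω → S) {i j : ℕ} (h : i ≤ j) :
    past w₀ x i ≤ past w₀ x j := by
  have h1 : Measurable[past w₀ x j] (pastData w₀ x i) := by
    let _ : MeasurableSpace Ω := past w₀ x j
    refine Measurable.prodMk (measurable_pi_lambda _ fun k => measurable_past_init w₀ x j k)
      (measurable_pi_lambda _ fun q => measurable_past_sample w₀ x ?_ _)
    have := q.2
    simp only [Finset.mem_product, Finset.mem_range] at this
    omega
  exact h1.comap_le

lemma measurable_estimate_past {Q : Param M → S → ℝ} {x : Fin N → ℕ → Ω → S} {w₀ : Fin N → Ω → Param M}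
    (hmeas : Measurable (fun z : Param M × S => lossGrad Q z.1 z.2))
    (A : Matrix (Fin N) (Fin N) ℝ) (step : ℕ → ℝ) (i : ℕ) :
    ∀ k, Measurable[past w₀ x i] (estimate Q A step x w₀ i k) := by
  induction i with
  | zero => intro k; exact measurable_past_init w₀ x 0 k
  | succ i ih =>
    intro k
    have h1 : ∀ l, Measurable[past w₀ x (i + 1)] (estimate Q A step x w₀ i l) :=
      fun l => (ih l).mono (past_mono w₀ x (Nat.le_succ i)) le_rfl
    have h2 : ∀ l, Measurable[past w₀ x (i + 1)]
        (fun ω => lossGrad Q (estimate Q A step x w₀ i l ω) (x l (i + 1) ω)) := fun l =>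
      hmeas.comp ((h1 l).prodMk (measurable_past_sample w₀ x le_rfl l))
    exact Finset.measurable_sum _ fun l _ => ((h1 l).sub ((h2 l).const_smul (step (i + 1)))).const_smul (A l k)

/-- The variance of the gradient noise at `w` in direction `u`. -/
noncomputable def noiseVar (Q : Param M → S → ℝ) (D : Measure S) (u w : Param M) : ℝ :=
  ∫ ξ, ⟪u, gradNoise Q D w ξ⟫ ^ 2 ∂D

lemma noiseVar_nonneg {Q : Param M → S → ℝ} {D : Measure S} (u w : Param M) :
    0 ≤ noiseVar Q D u w :=
  integral_nonneg fun _ => sq_nonneg _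

variable [MeasurableSpace Ω]

/-- The standing assumptions on samples, risk and gradient noise, in the form in which they are
used: the noise conditions are stated at deterministic points, and carry over to the estimates by
independence. -/
structure Model (P : Measure Ω) (D : Measure S) (Q : Param M → S → ℝ) (x : Fin N → ℕ → Ω → S)
    (w₀ : Fin N → Ω → Param M) (wo : Param M) (lo hi α σsq : ℝ) : Prop where
  measurable_sample : ∀ k i, Measurable (x k i)
  measurable_init : ∀ k, Measurable (w₀ k)
  memLp_init : ∀ k, MemLp (w₀ k) 2 P
  indep : ∀ i, IndepFun (pastData w₀ x i) (fun ω k => x k (i + 1) ω) P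
  law : ∀ i, P.map (fun ω k => x k (i + 1) ω) = Measure.pi fun _ => D
  bounded : BoundedHessian (risk Q D) lo hi
  minimal : ∀ w, risk Q D wo ≤ risk Q D w
  measurable_lossGrad : Measurable (fun z : Param M × S => lossGrad Q z.1 z.2)
  alpha_nonneg : 0 ≤ α
  sigma_pos : 0 < σsq
  memLp_noise : ∀ w, MemLp (gradNoise Q D w) 2 D
  noise_mean : ∀ w, ∫ ξ, gradNoise Q D w ξ ∂D = 0
  noise_sq : ∀ w, ∫ ξ, ‖gradNoise Q D w ξ‖ ^ 2 ∂D ≤ α * ‖w - wo‖ ^ 2 + σsq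

namespace Model

variable {P : Measure Ω} [IsProbabilityMeasure P] {D : Measure S} [IsProbabilityMeasure D]
  {Q : Param M → S → ℝ} {x : Fin N → ℕ → Ω → S} {w₀ : Fin N → Ω → Param M} {wo : Param M}
  {lo hi α σsq : ℝ}

variable (h : Model P D Q x w₀ wo lo hi α σsq)
include h

lemma measurable_pastData (i : ℕ) : Measurable (pastData w₀ x i) :=
  Measurable.prodMk (measurable_pi_lambda _ fun k => h.measurable_init k)
    (measurable_pi_lambda _ fun _ => h.measurable_sample _ _)

lemma past_le (i : ℕ) : past w₀ x i ≤ ‹MeasurableSpace Ω› := (h.measurable_pastData i).comap_le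

lemma measurable_gradNoise : Measurable (fun z : Param M × S => gradNoise Q D z.1 z.2) :=
  h.measurable_lossGrad.sub (h.bounded.continuous_gradient.measurable.comp measurable_fst)

lemma memLp_inner_noise (u w : Param M) : MemLp (fun ξ => ⟪u, gradNoise Q D w ξ⟫) 2 D :=
  (h.memLp_noise w).const_inner u

lemma integral_inner_noise (u w : Param M) : ∫ ξ, ⟪u, gradNoise Q D w ξ⟫ ∂D = 0 := by
  rw [integral_inner ((h.memLp_noise w).integrable one_le_two), h.noise_mean, inner_zero_right]

lemma noiseVar_le (u w : Param M) : noiseVar Q D u w ≤ ‖u‖ ^ 2 * (α * ‖w - wo‖ ^ 2 + σsq) := by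
  have h1 : noiseVar Q D u w ≤ ∫ ξ, ‖u‖ ^ 2 * ‖gradNoise Q D w ξ‖ ^ 2 ∂D := by
    refine integral_mono (h.memLp_inner_noise u w).integrable_sq
      ((h.memLp_noise w).norm.integrable_sq.const_mul _) fun ξ => ?_
    have := abs_real_inner_le_norm u (gradNoise Q D w ξ)
    rw [← sq_abs, ← mul_pow]
    exact pow_le_pow_left₀ (abs_nonneg _) this 2
  rw [integral_const_mul] at h1
  exact h1.trans (mul_le_mul_of_nonneg_left (h.noise_sq w) (sq_nonneg _))

lemma measurable_noiseVar (u : Param M) : Measurable (noiseVar Q D u) := by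
  have h1 : Measurable (fun z : Param M × S => ⟪u, gradNoise Q D z.1 z.2⟫ ^ 2) :=
    (measurable_const.inner h.measurable_gradNoise).pow_const 2
  exact h1.stronglyMeasurable.integral_prod_right'.measurable

/-- At deterministic points the noises of the agents are independent and centred, so that their
variances add up. -/
lemma integral_sq_frozen (ws : Fin N → Param M) (b : ℝ) (q : Fin N → ℝ) (u : Param M) :
    Integrable (fun ξ : Fin N → S => (b - ∑ l, q l * ⟪u, gradNoise Q D (ws l) (ξ l)⟫) ^ 2)
        (Measure.pi fun _ => D) ∧
      ∫ ξ : Fin N → S, (b - ∑ l, q l * ⟪u, gradNoise Q D (ws l) (ξ l)⟫) ^ 2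
          ∂(Measure.pi fun _ => D)
        = b ^ 2 + ∑ l, q l ^ 2 * noiseVar Q D u (ws l) := by
  set X : Fin N → S → ℝ := fun l ξ => q l * ⟪u, gradNoise Q D (ws l) ξ⟫ with hX
  have hX2 : ∀ l, MemLp (X l) 2 D := fun l => (h.memLp_inner_noise u (ws l)).const_mul _
  have hX0 : ∀ l, ∫ ξ, X l ξ ∂D = 0 := fun l => by
    simp only [hX]; rw [integral_const_mul, h.integral_inner_noise, mul_zero]
  have hXp : ∀ l, MemLp (fun ξ : Fin N → S => X l (ξ l)) 2 (Measure.pi fun _ => D) := fun l =>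
    (hX2 l).comp_measurePreserving (measurePreserving_eval (fun _ => D) l)
  have hY : MemLp (fun ξ : Fin N → S => ∑ l, X l (ξ l)) 2 (Measure.pi fun _ => D) :=
    memLp_finsetSum _ fun l _ => hXp l
  have hmean : ∫ ξ : Fin N → S, ∑ l, X l (ξ l) ∂(Measure.pi fun _ => D) = 0 := by
    rw [integral_finsetSum _ fun l _ => (hXp l).integrable one_le_two]
    refine Finset.sum_eq_zero fun l _ => ?_
    rw [← hX0 l, integral_comp_eval (μ := fun _ : Fin N => D) (i := l) (hX2 l).1]
  have hvar : Var[fun ξ : Fin N → S => ∑ l, X l (ξ l); Measure.pi fun _ => D]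
      = ∑ l, q l ^ 2 * noiseVar Q D u (ws l) := by
    have h1 := variance_sum_pi (μ := fun _ : Fin N => D) hX2
    have h2 : (∑ l, fun ξ : Fin N → S => X l (ξ l)) = fun ξ => ∑ l, X l (ξ l) := by
      ext ξ; simp
    rw [h2] at h1
    rw [h1]
    refine Finset.sum_congr rfl fun l _ => ?_
    rw [variance_of_integral_eq_zero (hX2 l).1.aemeasurable (hX0 l), noiseVar]
    simp only [hX, mul_pow]
    rw [integral_const_mul]
  have hbY : MemLp (fun ξ : Fin N → S => b - ∑ l, X l (ξ l)) 2 (Measure.pi fun _ => D) :=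
    (memLp_const b).sub hY
  refine ⟨hbY.integrable_sq, ?_⟩
  have h3 := variance_eq_sub hbY
  rw [variance_const_sub hY.1, hvar, integral_sub (integrable_const _)
    (hY.integrable one_le_two), hmean] at h3
  simp only [integral_const, probReal_univ, smul_eq_mul, one_mul, sub_zero, Pi.pow_apply] at h3
  linarith

/-- Second moment of one step in direction `u`, restricted by a weight `χ` known at time `n`. -/
lemma second_moment_step (n : ℕ) {W : Fin N → Ω → Param M}
    (hW : ∀ l, Measurable[past w₀ x n] (W l)) (hW2 : ∀ l, MemLp (W l) 2 P) {χ b : Ω → ℝ}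
    (hχ : Measurable[past w₀ x n] χ) (hχ0 : ∀ ω, 0 ≤ χ ω) (hχ1 : ∀ ω, χ ω ≤ 1)
    (hb : Measurable[past w₀ x n] b) (hbint : Integrable (fun ω => χ ω * b ω ^ 2) P)
    (q : Fin N → ℝ) (u : Param M) :
    Integrable (fun ω => χ ω * (b ω -
        ∑ l, q l * ⟪u, gradNoise Q D (W l ω) (x l (n + 1) ω)⟫) ^ 2) P ∧
      ∫ ω, χ ω * (b ω - ∑ l, q l * ⟪u, gradNoise Q D (W l ω) (x l (n + 1) ω)⟫) ^ 2 ∂P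
        = ∫ ω, χ ω * b ω ^ 2 ∂P + ∑ l, q l ^ 2 * ∫ ω, χ ω * noiseVar Q D u (W l ω) ∂P := by
  set Z : Ω → ℝ × ℝ × (Fin N → Param M) := fun ω => (χ ω, b ω, fun l => W l ω) with hZ
  set φ : (ℝ × ℝ × (Fin N → Param M)) × (Fin N → S) → ℝ := fun z =>
    |z.1.1| * (z.1.2.1 - ∑ l, q l * ⟪u, gradNoise Q D (z.1.2.2 l) (z.2 l)⟫) ^ 2 with hφ
  have hZp : Measurable[past w₀ x n] Z :=
    hχ.prodMk (hb.prodMk (@measurable_pi_lambda _ _ _ (past w₀ x n) _ _ hW))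
  have hZm : Measurable Z := hZp.mono (h.past_le n) le_rfl
  have hX : Measurable (fun ω k => x k (n + 1) ω) :=
    measurable_pi_lambda _ fun k => h.measurable_sample k (n + 1)
  have hind : IndepFun Z (fun ω k => x k (n + 1) ω) P := by
    rw [IndepFun_iff_Indep]
    exact indep_of_indep_of_le_left (IndepFun_iff_Indep _ _ _ |>.1 (h.indep n)) hZp.comap_le
  have hφm : Measurable φ := by
    have h1 : ∀ l, Measurable (fun z : (ℝ × ℝ × (Fin N → Param M)) × (Fin N → S) =>
        gradNoise Q D (z.1.2.2 l) (z.2 l)) := fun l => by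
      have h1 : Measurable (fun z : (ℝ × ℝ × (Fin N → Param M)) × (Fin N → S) =>
        ((z.1.2.2 l, z.2 l) : Param M × S)) := by fun_prop
      exact h.measurable_gradNoise.comp h1
    have h2 : Measurable (fun z : (ℝ × ℝ × (Fin N → Param M)) × (Fin N → S) =>
        ∑ l, q l * ⟪u, gradNoise Q D (z.1.2.2 l) (z.2 l)⟫) :=
      Finset.measurable_sum _ fun l _ => (measurable_const.inner (h1 l)).const_mul _
    have h3 : Measurable (fun z : (ℝ × ℝ × (Fin N → Param M)) × (Fin N → S) => |z.1.1|) :=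
      (measurable_fst.comp measurable_fst).abs
    exact h3.mul ((((measurable_fst.comp (measurable_snd.comp measurable_fst))).sub h2).pow_const 2)
  have hfr : ∀ z : ℝ × ℝ × (Fin N → Param M),
      Integrable (fun ξ => φ (z, ξ)) (P.map (fun ω k => x k (n + 1) ω)) ∧
      ∫ ξ, φ (z, ξ) ∂(P.map (fun ω k => x k (n + 1) ω)) =
        |z.1| * (z.2.1 ^ 2 + ∑ l, q l ^ 2 * noiseVar Q D u (z.2.2 l)) := by
    intro z
    obtain ⟨h1, h2⟩ := h.integral_sq_frozen z.2.2 z.2.1 q u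
    rw [h.law n]
    refine ⟨h1.const_mul |z.1|, ?_⟩
    simp only [hφ]
    rw [integral_const_mul, h2]
  have hVint : ∀ l, Integrable (fun ω => χ ω * noiseVar Q D u (W l ω)) P := by
    intro l
    have hW' : Measurable (W l) := (hW l).mono (h.past_le n) le_rfl
    have hχ' : Measurable χ := hχ.mono (h.past_le n) le_rfl
    have hd : Integrable (fun ω => ‖u‖ ^ 2 * (α * ‖W l ω - wo‖ ^ 2 + σsq)) P :=
      ((((hW2 l).sub (memLp_const wo)).norm.integrable_sq.const_mul α).add
        (integrable_const σsq)).const_mul _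
    refine hd.mono' (hχ'.mul ((h.measurable_noiseVar u).comp hW')).aestronglyMeasurable
      (Eventually.of_forall fun ω => ?_)
    have h1 := noiseVar_nonneg (Q := Q) (D := D) u (W l ω)
    rw [Real.norm_of_nonneg (mul_nonneg (hχ0 ω) h1)]
    exact (mul_le_of_le_one_left h1 (hχ1 ω)).trans (h.noiseVar_le u (W l ω))
  have hsplit : ∀ ω, ∫ ξ, φ (Z ω, ξ) ∂(P.map (fun ω k => x k (n + 1) ω))
      = χ ω * b ω ^ 2 + ∑ l, q l ^ 2 * (χ ω * noiseVar Q D u (W l ω)) := by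
    intro ω
    rw [(hfr _).2]
    simp only [hZ, abs_of_nonneg (hχ0 ω), mul_add, Finset.mul_sum]
    congr 1
    exact Finset.sum_congr rfl fun l _ => by ring
  have hsum : Integrable (fun ω => ∑ l, q l ^ 2 * (χ ω * noiseVar Q D u (W l ω))) P :=
    integrable_finsetSum _ fun l _ => (hVint l).const_mul _
  obtain ⟨r1, r2⟩ := integrable_and_integral_of_indepFun hZm hX hind hφm
    (fun z => by positivity) (fun z => (hfr z).1) (by
      simp only [hsplit]; exact hbint.add hsum)
  have hφZ : ∀ ω, φ (Z ω, fun k => x k (n + 1) ω) = χ ω * (b ω -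
        ∑ l, q l * ⟪u, gradNoise Q D (W l ω) (x l (n + 1) ω)⟫) ^ 2 := fun ω => by
    simp only [hφ, hZ, abs_of_nonneg (hχ0 ω)]
  simp only [hφZ] at r1 r2
  refine ⟨r1, ?_⟩
  rw [r2]
  simp only [hsplit]
  rw [integral_add hbint hsum, integral_finsetSum _ fun l _ => (hVint l).const_mul _]
  simp only [integral_const_mul]

end Model

end Model


/-! ### Noise moments at deterministic points -/

section ModelOfAssumptions

variable {M N : ℕ} {S Ω : Type*} [MeasurableSpace S] [MeasurableSpace Ω]

local notation "⟪" x ", " y "⟫" => inner ℝ x y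

lemma indepFun_pastData {P : Measure Ω} [IsProbabilityMeasure P] {x : Fin N → ℕ → Ω → S}
    (hxmeas : ∀ k i, Measurable (x k i))
    (hxind : iIndepFun (fun q : Fin N × ℕ => x q.1 q.2) P)
    {w₀ : Fin N → Ω → Param M} (hw₀meas : ∀ k, Measurable (w₀ k))
    (hw₀ind : IndepFun (fun ω k => w₀ k ω) (fun ω (q : Fin N × ℕ) => x q.1 q.2 ω) P) (i : ℕ) :
    IndepFun (pastData w₀ x i) (fun ω k => x k (i + 1) ω) P := by
  have hY : Measurable (fun ω (q : (Finset.univ ×ˢ Finset.range (i + 1) : Finset (Fin N × ℕ))) =>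
      x q.1.1 q.1.2 ω) := measurable_pi_lambda _ fun q => hxmeas _ _
  have hX : Measurable (fun ω k => x k (i + 1) ω) := measurable_pi_lambda _ fun k => hxmeas _ _
  refine indepFun_prodMk_left (measurable_pi_lambda _ hw₀meas) hY hX ?_ ?_
  · exact hw₀ind.comp measurable_id (ψ := fun z =>
      (fun q : (Finset.univ ×ˢ Finset.range (i + 1) : Finset (Fin N × ℕ)) => z q.1,
        fun k => z (k, i + 1))) (by fun_prop)
  · have h1 := hxind.indepFun_finset (Finset.univ ×ˢ Finset.range (i + 1))
      (Finset.univ ×ˢ {i + 1}) (by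
        rw [Finset.disjoint_left]
        rintro ⟨k, j⟩ hj hj'
        simp at hj hj'
        omega) (fun q => hxmeas _ _)
    exact h1.comp measurable_id
      (ψ := fun (z : (Finset.univ ×ˢ {i + 1} : Finset (Fin N × ℕ)) → S) (k : Fin N) =>
        z ⟨(k, i + 1), by simp⟩)
      (measurable_pi_lambda _ fun k => measurable_pi_apply _)

lemma map_samples_eq_pi {P : Measure Ω} [IsProbabilityMeasure P] {D : Measure S}
    {x : Fin N → ℕ → Ω → S} (hxmeas : ∀ k i, Measurable (x k i))
    (hxlaw : ∀ k i, 1 ≤ i → P.map (x k i) = D)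
    (hxind : iIndepFun (fun q : Fin N × ℕ => x q.1 q.2) P) (i : ℕ) :
    P.map (fun ω k => x k (i + 1) ω) = Measure.pi fun _ => D := by
  have h1 : iIndepFun (fun k : Fin N => x k (i + 1)) P :=
    hxind.precomp (g := fun k : Fin N => (k, i + 1)) fun a b hab => by simpa using hab
  rw [(iIndepFun_iff_map_fun_eq_pi_map fun k => (hxmeas k (i + 1)).aemeasurable).1 h1]
  simp only [hxlaw _ _ (Nat.le_add_left 1 i)]

/-- The gradient noise model along the estimates, used at constant points only, gives the moments
of the noise at deterministic points. -/
lemma model_of_gradientNoiseModel {P : Measure Ω} [IsProbabilityMeasure P] {D : Measure S}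
    [IsProbabilityMeasure D] {Q : Param M → S → ℝ}
    (hQmeas : Measurable (fun z : Param M × S => lossGrad Q z.1 z.2))
    {x : Fin N → ℕ → Ω → S} (hxmeas : ∀ k i, Measurable (x k i))
    (hxlaw : ∀ k i, 1 ≤ i → P.map (x k i) = D)
    (hxind : iIndepFun (fun q : Fin N × ℕ => x q.1 q.2) P)
    {w₀ : Fin N → Ω → Param M} (hw₀meas : ∀ k, Measurable (w₀ k))
    (hw₀ : ∀ k, MemLp (w₀ k) 2 P)
    (hw₀ind : IndepFun (fun ω k => w₀ k ω) (fun ω (q : Fin N × ℕ) => x q.1 q.2 ω) P)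
    {lo hi : ℝ} (hJ : BoundedHessian (risk Q D) lo hi)
    {wo : Param M} (hwo : ∀ w, risk Q D wo ≤ risk Q D w)
    {A : Matrix (Fin N) (Fin N) ℝ} {step : ℕ → ℝ} {α σsq : ℝ} (hα : 0 ≤ α) (hσ : 0 < σsq)
    (hnoise : GradientNoiseModel P Q D x (estimate Q A step x w₀) wo α σsq) (k : Fin N) :
    Model P D Q x w₀ wo lo hi α σsq := by
  have hvm : ∀ w, Measurable (gradNoise Q D w) := fun w =>
    (hQmeas.comp (measurable_const.prodMk measurable_id)).sub_const _
  have hle : history (estimate Q A step x w₀) (1 - 1) ≤ ‹MeasurableSpace Ω› := by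
    refine iSup_le fun k => iSup_le fun j => ?_
    have h1 := measurable_estimate_past (w₀ := w₀) (x := x) hQmeas A step j k
    have h2 : past w₀ x j ≤ ‹MeasurableSpace Ω› := Measurable.comap_le
      (Measurable.prodMk (measurable_pi_lambda _ fun k => hw₀meas k)
        (measurable_pi_lambda _ fun _ => hxmeas _ _))
    exact (h1.mono h2 le_rfl).comap_le
  have hlaw := hxlaw k 1 le_rfl
  have hx := (hxmeas k 1).aemeasurable (μ := P)
  have key := fun w : Param M => hnoise k 1 le_rfl (fun _ => w) measurable_const (memLp_const w)
  have hmem : ∀ w, MemLp (gradNoise Q D w) 2 D := by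
    intro w
    have h1 : ∀ g : S → Param M, Measurable g → MemLp (fun ω => g (x k 1 ω)) 2 P → MemLp g 2 D := by
      intro g hg hg2
      rw [← hlaw]
      exact (memLp_map_measure_iff hg.aestronglyMeasurable hx).2 hg2
    exact h1 _ (hvm w) (key w).1
  have hint : ∀ {F : Type} [NormedAddCommGroup F] [NormedSpace ℝ F] (g : S → F),
      StronglyMeasurable g → ∫ ξ, g ξ ∂D = ∫ ω, g (x k 1 ω) ∂P := by
    intro F _ _ g hg
    rw [← hlaw, integral_map hx hg.aestronglyMeasurable]
  refine ⟨hxmeas, hw₀meas, hw₀, indepFun_pastData hxmeas hxind hw₀meas hw₀ind,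
    map_samples_eq_pi hxmeas hxlaw hxind, hJ, hwo, hQmeas, hα, hσ, hmem, fun w => ?_, fun w => ?_⟩
  · have h1 := integral_condExp (μ := P) (f := fun ω => gradNoise Q D w (x k 1 ω)) hle
    rw [integral_congr_ae (key w).2.1] at h1
    rw [hint _ (hvm w).stronglyMeasurable, ← h1]
    simp
  · have h1 := integral_condExp (μ := P) (f := fun ω => ‖gradNoise Q D w (x k 1 ω)‖ ^ 2) hle
    have h2 : ∫ ω, (P[fun ω => ‖gradNoise Q D w (x k 1 ω)‖ ^ 2 |
        history (estimate Q A step x w₀) (1 - 1)]) ω ∂P ≤ ∫ _, (α * ‖wo - w‖ ^ 2 + σsq) ∂P :=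
      integral_mono_ae integrable_condExp (integrable_const _) (key w).2.2
    rw [h1] at h2
    rw [hint _ ((hvm w).norm.pow_const 2).stronglyMeasurable, norm_sub_rev]
    simpa using h2

end ModelOfAssumptions

/-! ### The noise covariance in the eigenbasis -/

section NoiseCovariance

variable {M N : ℕ} {S Ω : Type*} [MeasurableSpace S] [MeasurableSpace Ω]

local notation "⟪" x ", " y "⟫" => inner ℝ x y

variable {P : Measure Ω} [IsProbabilityMeasure P] {D : Measure S} [IsProbabilityMeasure D]
  {Q : Param M → S → ℝ} {x : Fin N → ℕ → Ω → S} {w₀ : Fin N → Ω → Param M} {wo : Param M}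
  {lo hi α σsq : ℝ} {Φ : Matrix (Fin M) (Fin M) ℝ}

lemma Model.integrable_noise_mul (h : Model P D Q x w₀ wo lo hi α σsq) (w : Param M) (a b : Fin M) :
    Integrable (fun ξ => gradNoise Q D w ξ a * gradNoise Q D w ξ b) D := by
  have h1 : ∀ a, MemLp (fun ξ => gradNoise Q D w ξ a) 2 D := fun a => by
    have := h.memLp_inner_noise (EuclideanSpace.single a 1) w
    simpa [EuclideanSpace.inner_single_left] using this
  exact (h1 a).integrable_mul (h1 b)

lemma Model.noiseVar_mode (h : Model P D Q x w₀ wo lo hi α σsq) (m : Fin M) (w : Param M) :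
    noiseVar Q D (mode Φ m) w = (Φᵀ * noiseCov Q D w * Φ) m m := by
  have h1 : ∀ ξ, ⟪mode Φ m, gradNoise Q D w ξ⟫ ^ 2
      = ∑ b, ∑ a, (Φ a m * Φ b m) * (gradNoise Q D w ξ a * gradNoise Q D w ξ b) := by
    intro ξ
    rw [inner_mode, sq, Matrix.mulVec, dotProduct, Finset.sum_mul_sum, Finset.sum_comm]
    exact Finset.sum_congr rfl fun a _ => Finset.sum_congr rfl fun b _ => by
      simp only [Matrix.transpose_apply]; ring
  simp only [noiseVar, h1]
  rw [integral_finsetSum _ fun b _ => integrable_finsetSum _ fun a _ =>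
    (h.integrable_noise_mul w a b).const_mul _]
  simp only [Matrix.mul_apply, Matrix.transpose_apply, Finset.sum_mul]
  refine Finset.sum_congr rfl fun b _ => ?_
  rw [integral_finsetSum _ fun a _ => (h.integrable_noise_mul w a b).const_mul _]
  refine Finset.sum_congr rfl fun a _ => ?_
  rw [integral_const_mul, noiseCov, Matrix.of_apply]
  ring

lemma Model.noiseCov_mode_nonneg (h : Model P D Q x w₀ wo lo hi α σsq) (m : Fin M) (w : Param M) :
    0 ≤ (Φᵀ * noiseCov Q D w * Φ) m m := by
  rw [← h.noiseVar_mode]; exact noiseVar_nonneg _ _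

lemma Model.exists_noiseCov_mode_ne_zero (h : Model P D Q x w₀ wo lo hi α σsq)
    (hΦ' : Φ * Φᵀ = 1) {w : Param M} (hR : noiseCov Q D w ≠ 0) :
    ∃ m, (Φᵀ * noiseCov Q D w * Φ) m m ≠ 0 := by
  by_contra! h0
  apply hR
  have h1 : ∫ ξ, ‖gradNoise Q D w ξ‖ ^ 2 ∂D = 0 := by
    simp only [← sum_inner_mode_sq hΦ']
    rw [integral_finsetSum _ fun m _ => (h.memLp_inner_noise _ w).integrable_sq]
    exact Finset.sum_eq_zero fun m _ => by
      rw [← noiseVar, h.noiseVar_mode, h0]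
  have h2 := (integral_eq_zero_iff_of_nonneg (fun ξ => sq_nonneg _)
    (h.memLp_noise w).norm.integrable_sq).1 h1
  ext a b
  rw [noiseCov, Matrix.of_apply, Matrix.zero_apply]
  refine integral_eq_zero_of_ae (h2.mono fun ξ hξ => ?_)
  have : gradNoise Q D w ξ = 0 := by simpa using hξ
  simp [this]

lemma Model.continuousAt_noiseVar (h : Model P D Q x w₀ wo lo hi α σsq)
    (hc : ContinuousAt (fun w => noiseCov Q D w) wo) (m : Fin M) :
    ContinuousAt (fun w => noiseVar Q D (mode Φ m) w) wo := by
  simp only [h.noiseVar_mode]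
  have h1 : Continuous (fun R : Matrix (Fin M) (Fin M) ℝ => (Φᵀ * R * Φ) m m) := by fun_prop
  exact h1.continuousAt.comp (f := fun w => noiseCov Q D w) hc

end NoiseCovariance


/-! ### Mean-square error of the network -/

section MeanSquare

set_option linter.unusedSectionVars false

variable {M N : ℕ} {S Ω : Type*} [MeasurableSpace S] [MeasurableSpace Ω]

local notation "⟪" x ", " y "⟫" => inner ℝ x y

variable {P : Measure Ω} [IsProbabilityMeasure P] {D : Measure S} [IsProbabilityMeasure D]
  {Q : Param M → S → ℝ} {x : Fin N → ℕ → Ω → S} {w₀ : Fin N → Ω → Param M} {wo : Param M}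
  {lo hi α σsq : ℝ} {A : Matrix (Fin N) (Fin N) ℝ} {μ : ℝ}

/-- Second moment of a step of a single agent with the whole noise vector. -/
lemma Model.norm_sq_step (h : Model P D Q x w₀ wo lo hi α σsq) (n : ℕ) (l : Fin N)
    {W b : Ω → Param M} (hW : Measurable[past w₀ x n] W) (hW2 : MemLp W 2 P)
    (hb : Measurable[past w₀ x n] b) (hb2 : MemLp b 2 P) {χ : Ω → ℝ}
    (hχ : Measurable[past w₀ x n] χ) (hχ0 : ∀ ω, 0 ≤ χ ω) (hχ1 : ∀ ω, χ ω ≤ 1) (τ : ℝ) :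
    Integrable (fun ω => χ ω * ‖b ω - τ • gradNoise Q D (W ω) (x l (n + 1) ω)‖ ^ 2) P ∧
      ∫ ω, χ ω * ‖b ω - τ • gradNoise Q D (W ω) (x l (n + 1) ω)‖ ^ 2 ∂P ≤
        ∫ ω, χ ω * ‖b ω‖ ^ 2 ∂P +
          τ ^ 2 * (α * ∫ ω, χ ω * ‖W ω - wo‖ ^ 2 ∂P + σsq) := by
  have h1 : ((1 : Matrix (Fin M) (Fin M) ℝ)) * (1 : Matrix (Fin M) (Fin M) ℝ)ᵀ = 1 := by simp
  have hχm : Measurable χ := hχ.mono (h.past_le n) le_rfl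
  have hχb : ∀ᵐ ω ∂P, ‖χ ω‖ ≤ 1 := Eventually.of_forall fun ω => by
    rw [Real.norm_of_nonneg (hχ0 ω)]; exact hχ1 ω
  have hχint : ∀ f : Ω → ℝ, Integrable f P → Integrable (fun ω => χ ω * f ω) P := fun f hf =>
    hf.bdd_mul hχm.aestronglyMeasurable hχb
  have hbm : ∀ a, Measurable[past w₀ x n] (fun ω => ⟪mode 1 a, b ω⟫) := fun a =>
    (continuous_const.inner continuous_id).measurable.comp hb
  have hbi : ∀ a, Integrable (fun ω => χ ω * ⟪mode 1 a, b ω⟫ ^ 2) P := fun a =>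
    hχint _ (hb2.const_inner _).integrable_sq
  -- the step of one agent, in the direction of each basis vector
  have hstep := fun a => h.second_moment_step n (W := fun _ => W) (fun _ => hW) (fun _ => hW2) hχ
    hχ0 hχ1 (hbm a) (hbi a) (Pi.single l τ) (mode 1 a)
  have hsimp : ∀ a ω, (⟪mode 1 a, b ω⟫ - ∑ l', (Pi.single l τ : Fin N → ℝ) l' *
      ⟪mode 1 a, gradNoise Q D (W ω) (x l' (n + 1) ω)⟫)
      = ⟪mode 1 a, b ω - τ • gradNoise Q D (W ω) (x l (n + 1) ω)⟫ := by
    intro a ω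
    rw [inner_sub_right, inner_smul_right, Finset.sum_eq_single l]
    · simp
    · intro l' _ hl'; simp [hl']
    · simp
  have hq : ∀ c : ℝ, ∑ l', (Pi.single l τ : Fin N → ℝ) l' ^ 2 * c = τ ^ 2 * c := by
    intro c
    rw [Finset.sum_eq_single l]
    · simp
    · intro l' _ hl'; simp [hl']
    · simp
  simp only [hsimp, hq] at hstep
  have hsum : ∀ ω, χ ω * ‖b ω - τ • gradNoise Q D (W ω) (x l (n + 1) ω)‖ ^ 2
      = ∑ a, χ ω * ⟪mode 1 a, b ω - τ • gradNoise Q D (W ω) (x l (n + 1) ω)⟫ ^ 2 := fun ω => by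
    rw [← sum_inner_mode_sq h1, Finset.mul_sum]
  have hsumb : ∀ ω, χ ω * ‖b ω‖ ^ 2 = ∑ a, χ ω * ⟪mode 1 a, b ω⟫ ^ 2 := fun ω => by
    rw [← sum_inner_mode_sq h1, Finset.mul_sum]
  have hVb : ∀ a, Integrable (fun ω => χ ω * noiseVar Q D (mode 1 a) (W ω)) P := by
    intro a
    refine hχint _ ?_
    have hd : Integrable (fun ω => ‖(mode 1 a : Param M)‖ ^ 2 * (α * ‖W ω - wo‖ ^ 2 + σsq)) P :=
      (((hW2.sub (memLp_const wo)).norm.integrable_sq.const_mul α).add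
        (integrable_const σsq)).const_mul _
    refine hd.mono' ((h.measurable_noiseVar _).comp
      (hW.mono (h.past_le n) le_rfl)).aestronglyMeasurable (Eventually.of_forall fun ω => ?_)
    rw [Real.norm_of_nonneg (noiseVar_nonneg _ _)]
    exact h.noiseVar_le _ _
  simp only [hsum, hsumb]
  refine ⟨integrable_finsetSum _ fun a _ => (hstep a).1, ?_⟩
  rw [integral_finsetSum _ fun a _ => (hstep a).1, integral_finsetSum _ fun a _ => hbi a]
  simp only [(hstep _).2]
  rw [Finset.sum_add_distrib, ← Finset.mul_sum]
  refine add_le_add le_rfl (mul_le_mul_of_nonneg_left ?_ (sq_nonneg _))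
  rw [← integral_finsetSum _ fun a _ => hVb a]
  have hV : ∀ w, ∑ a, noiseVar Q D (mode 1 a) w ≤ α * ‖w - wo‖ ^ 2 + σsq := by
    intro w
    simp only [noiseVar]
    rw [← integral_finsetSum _ fun m _ => (h.memLp_inner_noise _ w).integrable_sq]
    simp only [sum_inner_mode_sq h1]
    exact h.noise_sq w
  have hWi : Integrable (fun ω => χ ω * ‖W ω - wo‖ ^ 2) P :=
    hχint _ (hW2.sub (memLp_const wo)).norm.integrable_sq
  calc ∫ ω, ∑ a, χ ω * noiseVar Q D (mode 1 a) (W ω) ∂P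
      ≤ ∫ ω, (α * (χ ω * ‖W ω - wo‖ ^ 2) + σsq) ∂P := by
        refine integral_mono (integrable_finsetSum _ fun a _ => hVb a)
          ((hWi.const_mul α).add (integrable_const σsq)) fun ω => ?_
        simp only
        rw [← Finset.mul_sum]
        have h2 := mul_le_mul_of_nonneg_left (hV (W ω)) (hχ0 ω)
        have h3 := mul_le_of_le_one_left h.sigma_pos.le (hχ1 ω)
        linarith
    _ = α * ∫ ω, χ ω * ‖W ω - wo‖ ^ 2 ∂P + σsq := by
        rw [integral_add (hWi.const_mul α) (integrable_const σsq), integral_const_mul]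
        simp

local notation "𝐰" => estimate Q A (fun i : ℕ => μ / (i : ℝ)) x w₀

lemma measurable_past_estimate (h : Model P D Q x w₀ wo lo hi α σsq) (n : ℕ) (k : Fin N) :
    Measurable[past w₀ x n] (𝐰 n k) :=
  measurable_estimate_past h.measurable_lossGrad A _ n k

lemma measurable_estimate (h : Model P D Q x w₀ wo lo hi α σsq) (n : ℕ) (k : Fin N) :
    Measurable (𝐰 n k) :=
  (measurable_past_estimate h n k).mono (h.past_le n) le_rfl

lemma estimate_succ (n : ℕ) (k : Fin N) (ω : Ω) :
    𝐰 (n + 1) k ω = ∑ l, A l k • (𝐰 n l ω - (μ / ((n : ℝ) + 1)) • lossGrad Q (𝐰 n l ω)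
      (x l (n + 1) ω)) := by
  rw [estimate]; push_cast; rfl

lemma lossGrad_eq (w : Param M) (ξ : S) :
    lossGrad Q w ξ = gradient (risk Q D) w + gradNoise Q D w ξ := by
  rw [gradNoise]; abel

lemma memLp_gradient (h : Model P D Q x w₀ wo lo hi α σsq) {W : Ω → Param M} (hW : Measurable W)
    (hW2 : MemLp W 2 P) : MemLp (fun ω => gradient (risk Q D) (W ω)) 2 P := by
  refine MemLp.of_le_mul (g := fun ω => W ω - wo) (c := hi) (hW2.sub (memLp_const wo))
    (h.bounded.continuous_gradient.measurable.comp hW).aestronglyMeasurable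
    (Eventually.of_forall fun ω => ?_)
  exact h.bounded.norm_gradient_le h.minimal (W ω)

lemma memLp_lossGrad (h : Model P D Q x w₀ wo lo hi α σsq) (n : ℕ) (l : Fin N) {W : Ω → Param M}
    (hW : Measurable[past w₀ x n] W) (hW2 : MemLp W 2 P) :
    MemLp (fun ω => lossGrad Q (W ω) (x l (n + 1) ω)) 2 P ∧
      ∫ ω, ‖lossGrad Q (W ω) (x l (n + 1) ω)‖ ^ 2 ∂P
        ≤ (hi ^ 2 + α) * ∫ ω, ‖W ω - wo‖ ^ 2 ∂P + σsq := by
  have hWm : Measurable W := hW.mono (h.past_le n) le_rfl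
  have hg2 := memLp_gradient h hWm hW2
  have hgm : Measurable[past w₀ x n] (fun ω => gradient (risk Q D) (W ω)) :=
    h.bounded.continuous_gradient.measurable.comp hW
  obtain ⟨h1, h2⟩ := h.norm_sq_step n l hW hW2 hgm hg2 (χ := fun _ => 1) measurable_const
    (fun _ => zero_le_one) (fun _ => le_rfl) (-1)
  have h3 : ∀ ω, gradient (risk Q D) (W ω) - (-1 : ℝ) • gradNoise Q D (W ω) (x l (n + 1) ω)
      = lossGrad Q (W ω) (x l (n + 1) ω) := fun ω => by
    rw [lossGrad_eq (D := D)]; simp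
  simp only [h3, one_mul] at h1 h2
  have hm : Measurable (fun ω => lossGrad Q (W ω) (x l (n + 1) ω)) :=
    h.measurable_lossGrad.comp (hWm.prodMk (h.measurable_sample l (n + 1)))
  refine ⟨(memLp_two_iff_integrable_sq_norm hm.aestronglyMeasurable).2 h1, h2.trans ?_⟩
  have h4 : ∫ ω, ‖gradient (risk Q D) (W ω)‖ ^ 2 ∂P ≤ hi ^ 2 * ∫ ω, ‖W ω - wo‖ ^ 2 ∂P := by
    rw [← integral_const_mul]
    refine integral_mono hg2.norm.integrable_sq
      ((hW2.sub (memLp_const wo)).norm.integrable_sq.const_mul _) fun ω => ?_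
    simp only
    rw [← mul_pow]
    exact pow_le_pow_left₀ (norm_nonneg _) (h.bounded.norm_gradient_le h.minimal (W ω)) 2
  linarith

lemma memLp_estimate (h : Model P D Q x w₀ wo lo hi α σsq) (n : ℕ) :
    ∀ k, MemLp (𝐰 n k) 2 P := by
  induction n with
  | zero => exact fun k => h.memLp_init k
  | succ n ih =>
    intro k
    have h1 : 𝐰 (n + 1) k = fun ω => ∑ l, A l k • (𝐰 n l ω - (μ / ((n : ℝ) + 1)) •
        lossGrad Q (𝐰 n l ω) (x l (n + 1) ω)) := funext fun ω => estimate_succ n k ω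
    rw [h1]
    exact memLp_finsetSum _ fun l _ => ((ih l).sub ((memLp_lossGrad h n l
      (measurable_past_estimate h n l) (ih l)).1.const_smul (μ / ((n : ℝ) + 1)))).const_smul (A l k)

lemma memLp_error (h : Model P D Q x w₀ wo lo hi α σsq) (n : ℕ) (k : Fin N) :
    MemLp (fun ω => 𝐰 n k ω - wo) 2 P :=
  (memLp_estimate h n k).sub (memLp_const wo)

/-- The squared error of the network, weighted by the Perron vector: a Lyapunov function, as the
combination step does not increase it. -/
noncomputable def netError (w : ℕ → Fin N → Ω → Param M) (wo : Param M) (p : Fin N → ℝ) (n : ℕ)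
    (ω : Ω) : ℝ :=
  ∑ l, p l * ‖w n l ω - wo‖ ^ 2

variable {p : Fin N → ℝ}

lemma netError_nonneg (w : ℕ → Fin N → Ω → Param M) (hp0 : ∀ l, 0 ≤ p l) (n : ℕ) (ω : Ω) :
    0 ≤ netError w wo p n ω :=
  Finset.sum_nonneg fun l _ => mul_nonneg (hp0 l) (sq_nonneg _)

lemma measurable_netError (h : Model P D Q x w₀ wo lo hi α σsq) (n : ℕ) :
    Measurable[past w₀ x n] (netError 𝐰 wo p n) := by
  have h1 : ∀ l, Measurable[past w₀ x n] (fun ω => ‖𝐰 n l ω - wo‖ ^ 2) := fun l =>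
    ((continuous_id.sub continuous_const).norm.pow 2).measurable.comp
      (measurable_past_estimate h n l)
  exact Finset.measurable_sum _ fun l _ => (h1 l).const_mul _

lemma integrable_netError (h : Model P D Q x w₀ wo lo hi α σsq) (n : ℕ) :
    Integrable (netError 𝐰 wo p n) P :=
  integrable_finsetSum _ fun l _ => (memLp_error h n l).norm.integrable_sq.const_mul _

lemma norm_sq_sum_le {a : Fin N → ℝ} (ha : ∀ l, 0 ≤ a l) (ha1 : ∑ l, a l = 1)
    (y : Fin N → Param M) : ‖∑ l, a l • y l‖ ^ 2 ≤ ∑ l, a l * ‖y l‖ ^ 2 := by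
  have h1 : ConvexOn ℝ Set.univ (fun y : Param M => ‖y‖ ^ 2) :=
    (convexOn_univ_norm).pow (fun _ _ => norm_nonneg _) 2
  exact h1.map_sum_le (fun l _ => ha l) ha1 (fun _ _ => Set.mem_univ _)

lemma netError_succ_le (hA : LeftStochasticPrimitive A) (hp0 : ∀ l, 0 ≤ p l)
    (hp : A *ᵥ p = p) (n : ℕ) (ω : Ω) :
    netError 𝐰 wo p (n + 1) ω ≤ ∑ l, p l * ‖(𝐰 n l ω - wo) - (μ / ((n : ℝ) + 1)) •
      lossGrad Q (𝐰 n l ω) (x l (n + 1) ω)‖ ^ 2 := by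
  set y : Fin N → Param M := fun l => (𝐰 n l ω - wo) - (μ / ((n : ℝ) + 1)) •
      lossGrad Q (𝐰 n l ω) (x l (n + 1) ω) with hy
  have h1 : ∀ k, 𝐰 (n + 1) k ω - wo = ∑ l, A l k • y l := by
    intro k
    have h2 : wo = ∑ l, A l k • wo := by rw [← Finset.sum_smul, hA.col_sum, one_smul]
    conv_lhs => rw [estimate_succ, h2, ← Finset.sum_sub_distrib]
    refine Finset.sum_congr rfl fun l _ => ?_
    rw [hy, ← smul_sub]
    congr 1
    exact sub_right_comm _ _ _
  calc netError 𝐰 wo p (n + 1) ω ≤ ∑ k, p k * ∑ l, A l k * ‖y l‖ ^ 2 := by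
        refine Finset.sum_le_sum fun k _ => mul_le_mul_of_nonneg_left ?_ (hp0 k)
        rw [h1]
        exact norm_sq_sum_le (fun l => hA.primitive.nonneg l k) (hA.col_sum k) y
    _ = ∑ l, (A *ᵥ p) l * ‖y l‖ ^ 2 := by
        simp only [Finset.mul_sum, Matrix.mulVec, dotProduct, Finset.sum_mul]
        rw [Finset.sum_comm]
        exact Finset.sum_congr rfl fun l _ => Finset.sum_congr rfl fun k _ => by ring
    _ = _ := by rw [hp]

/-- Mean-square recursion of the network error, on an event known at time `n`. -/
lemma integral_netError_succ_le (h : Model P D Q x w₀ wo lo hi α σsq)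
    (hA : LeftStochasticPrimitive A) (hp0 : ∀ l, 0 ≤ p l) (hp : A *ᵥ p = p) (hp1 : ∑ l, p l = 1)
    (hμ : 0 < μ) (n : ℕ) {χ : Ω → ℝ} (hχ : Measurable[past w₀ x n] χ) (hχ0 : ∀ ω, 0 ≤ χ ω)
    (hχ1 : ∀ ω, χ ω ≤ 1) :
    ∫ ω, χ ω * netError 𝐰 wo p (n + 1) ω ∂P ≤
      (1 - 2 * lo * (μ / ((n : ℝ) + 1)) + (hi ^ 2 + α) * (μ / ((n : ℝ) + 1)) ^ 2) *
        ∫ ω, χ ω * netError 𝐰 wo p n ω ∂P + (μ / ((n : ℝ) + 1)) ^ 2 * σsq := by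
  set τ := μ / ((n : ℝ) + 1) with hτ
  have hτ0 : 0 ≤ τ := by positivity
  have hχm : Measurable χ := hχ.mono (h.past_le n) le_rfl
  have hχb : ∀ᵐ ω ∂P, ‖χ ω‖ ≤ 1 := Eventually.of_forall fun ω => by
    rw [Real.norm_of_nonneg (hχ0 ω)]; exact hχ1 ω
  have hχint : ∀ f : Ω → ℝ, Integrable f P → Integrable (fun ω => χ ω * f ω) P := fun f hf =>
    hf.bdd_mul hχm.aestronglyMeasurable hχb
  set b : Fin N → Ω → Param M := fun l ω => (𝐰 n l ω - wo) - τ • gradient (risk Q D) (𝐰 n l ω)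
    with hb
  have hbm : ∀ l, Measurable[past w₀ x n] (b l) := fun l =>
    ((continuous_id.sub continuous_const).sub
      (h.bounded.continuous_gradient.const_smul τ)).measurable.comp
      (measurable_past_estimate h n l)
  have hb2 : ∀ l, MemLp (b l) 2 P := fun l => (memLp_error h n l).sub
    ((memLp_gradient h (measurable_estimate h n l) (memLp_estimate h n l)).const_smul τ)
  have hstep := fun l => h.norm_sq_step n l (measurable_past_estimate (A := A) (μ := μ) h n l)
    (memLp_estimate h n l) (hbm l) (hb2 l) hχ hχ0 hχ1 τ
  have hbeq : ∀ l ω, b l ω - τ • gradNoise Q D (𝐰 n l ω) (x l (n + 1) ω)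
      = (𝐰 n l ω - wo) - τ • lossGrad Q (𝐰 n l ω) (x l (n + 1) ω) := fun l ω => by
    rw [lossGrad_eq (D := D), smul_add, hb]; simp only; abel
  simp only [hbeq] at hstep
  have hEl : ∀ l, Integrable (fun ω => χ ω * ‖𝐰 n l ω - wo‖ ^ 2) P := fun l =>
    hχint _ (memLp_error h n l).norm.integrable_sq
  have hbl : ∀ l, ∫ ω, χ ω * ‖b l ω‖ ^ 2 ∂P ≤
      (1 - 2 * lo * τ + hi ^ 2 * τ ^ 2) * ∫ ω, χ ω * ‖𝐰 n l ω - wo‖ ^ 2 ∂P := by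
    intro l
    rw [← integral_const_mul]
    refine integral_mono (hχint _ (hb2 l).norm.integrable_sq) ((hEl l).const_mul _) fun ω => ?_
    have := mul_le_mul_of_nonneg_left
      (h.bounded.norm_sq_step_le h.minimal (𝐰 n l ω) hτ0) (hχ0 ω)
    simp only [hb]
    linarith
  have hnet : ∫ ω, χ ω * netError 𝐰 wo p n ω ∂P
      = ∑ l, p l * ∫ ω, χ ω * ‖𝐰 n l ω - wo‖ ^ 2 ∂P := by
    have h1 : ∀ ω, χ ω * netError 𝐰 wo p n ω = ∑ l, p l * (χ ω * ‖𝐰 n l ω - wo‖ ^ 2) := fun ω => by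
      rw [netError, Finset.mul_sum]; exact Finset.sum_congr rfl fun l _ => by ring
    simp only [h1]
    rw [integral_finsetSum _ fun l _ => (hEl l).const_mul _]
    simp only [integral_const_mul]
  calc ∫ ω, χ ω * netError 𝐰 wo p (n + 1) ω ∂P
      ≤ ∫ ω, ∑ l, p l * (χ ω * ‖(𝐰 n l ω - wo) - τ •
          lossGrad Q (𝐰 n l ω) (x l (n + 1) ω)‖ ^ 2) ∂P := by
        refine integral_mono (hχint _ (integrable_netError h (n + 1)))
          (integrable_finsetSum _ fun l _ => (hstep l).1.const_mul _) fun ω => ?_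
        have := mul_le_mul_of_nonneg_left
          (netError_succ_le (Q := Q) (x := x) (w₀ := w₀) (wo := wo) (μ := μ) hA hp0 hp n ω) (hχ0 ω)
        refine this.trans (le_of_eq ?_)
        rw [Finset.mul_sum]; exact Finset.sum_congr rfl fun l _ => by ring
    _ = ∑ l, p l * ∫ ω, χ ω * ‖(𝐰 n l ω - wo) - τ •
          lossGrad Q (𝐰 n l ω) (x l (n + 1) ω)‖ ^ 2 ∂P := by
        rw [integral_finsetSum _ fun l _ => (hstep l).1.const_mul _]
        simp only [integral_const_mul]
    _ ≤ ∑ l, p l * ((1 - 2 * lo * τ + (hi ^ 2 + α) * τ ^ 2) *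
          ∫ ω, χ ω * ‖𝐰 n l ω - wo‖ ^ 2 ∂P + τ ^ 2 * σsq) := by
        refine Finset.sum_le_sum fun l _ => mul_le_mul_of_nonneg_left ?_ (hp0 l)
        have h1 := (hstep l).2
        have h2 := hbl l
        linarith
    _ = _ := by
        rw [hnet, Finset.mul_sum]
        simp only [mul_add, Finset.sum_add_distrib, ← Finset.sum_mul, hp1, one_mul]
        congr 1
        exact Finset.sum_congr rfl fun l _ => by ring

end MeanSquare


/-! ### Localization and a maximal inequality -/

section Localization

set_option linter.unusedSectionVars false

variable {Ω : Type*} [MeasurableSpace Ω]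

/-- The event that `s j ≤ (j + 1)^(-g)` holds for all `j` between `n₀` and `n`. -/
def alive (s : ℕ → Ω → ℝ) (g : ℝ) (n₀ n : ℕ) : Set Ω :=
  {ω | ∀ j, n₀ ≤ j → j ≤ n → s j ω ≤ ((j : ℝ) + 1) ^ (-g)}

/-- The indicator function of the event `alive s g n₀ n`. -/
noncomputable def aliveInd (s : ℕ → Ω → ℝ) (g : ℝ) (n₀ n : ℕ) : Ω → ℝ :=
  (alive s g n₀ n).indicator fun _ => 1

variable {s : ℕ → Ω → ℝ} {g : ℝ} {n₀ n : ℕ}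

lemma aliveInd_nonneg (ω : Ω) : 0 ≤ aliveInd s g n₀ n ω :=
  Set.indicator_nonneg (fun _ _ => zero_le_one) ω

lemma aliveInd_le_one (ω : Ω) : aliveInd s g n₀ n ω ≤ 1 :=
  Set.indicator_le_self' (fun _ _ => zero_le_one) ω

lemma aliveInd_of_mem {ω : Ω} (h : ω ∈ alive s g n₀ n) : aliveInd s g n₀ n ω = 1 :=
  Set.indicator_of_mem h _

lemma aliveInd_of_notMem {ω : Ω} (h : ω ∉ alive s g n₀ n) : aliveInd s g n₀ n ω = 0 :=
  Set.indicator_of_notMem h _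

lemma alive_succ_subset : alive s g n₀ (n + 1) ⊆ alive s g n₀ n :=
  fun _ hω j h1 h2 => hω j h1 (h2.trans (Nat.le_succ n))

lemma aliveInd_succ_le (ω : Ω) : aliveInd s g n₀ (n + 1) ω ≤ aliveInd s g n₀ n ω :=
  Set.indicator_le_indicator_of_subset alive_succ_subset (fun _ => zero_le_one) ω

lemma measurableSet_alive {m : MeasurableSpace Ω} (hs : ∀ j ≤ n, Measurable[m] (s j)) :
    MeasurableSet[m] (alive s g n₀ n) := by
  have h1 : alive s g n₀ n = ⋂ j ∈ Finset.Icc n₀ n, {ω | s j ω ≤ ((j : ℝ) + 1) ^ (-g)} := by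
    ext ω; simp [alive]
  rw [h1]
  refine Finset.measurableSet_biInter _ fun j hj => ?_
  exact hs j (Finset.mem_Icc.1 hj).2 measurableSet_Iic

lemma measurable_aliveInd {m : MeasurableSpace Ω} (hs : ∀ j ≤ n, Measurable[m] (s j)) :
    Measurable[m] (aliveInd s g n₀ n) :=
  measurable_const.indicator (measurableSet_alive hs)

/-- Pointwise form of the maximal inequality: leaving the region costs at least one. -/
lemma aliveInd_step (ω₀ : Ω) :
    (1 - aliveInd s g n₀ (n + 1) ω₀) + ((n : ℝ) + 2) ^ g * (aliveInd s g n₀ (n + 1) ω₀ * s (n + 1) ω₀)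
      ≤ (1 - aliveInd s g n₀ n ω₀) + ((n : ℝ) + 2) ^ g * (aliveInd s g n₀ n ω₀ * s (n + 1) ω₀) := by
  by_cases h1 : ω₀ ∈ alive s g n₀ n
  · by_cases h2 : ω₀ ∈ alive s g n₀ (n + 1)
    · rw [aliveInd_of_mem h1, aliveInd_of_mem h2]
    · rw [aliveInd_of_mem h1, aliveInd_of_notMem h2]
      have h3 : ((n : ℝ) + 2) ^ (-g) < s (n + 1) ω₀ := by
        by_contra! h4
        apply h2
        intro j hj1 hj2
        rcases Nat.le_succ_iff.1 hj2 with h5 | h5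
        · exact h1 j hj1 h5
        · subst h5
          refine h4.trans (le_of_eq ?_)
          push_cast; congr 1; ring
      have h4 : (0 : ℝ) < ((n : ℝ) + 2) ^ g := by positivity
      rw [Real.rpow_neg (by positivity)] at h3
      have h5 := mul_le_mul_of_nonneg_left h3.le h4.le
      rw [mul_inv_cancel₀ h4.ne'] at h5
      linarith
  · have h2 : ω₀ ∉ alive s g n₀ (n + 1) := fun h => h1 (alive_succ_subset h)
    rw [aliveInd_of_notMem h1, aliveInd_of_notMem h2]

/-- If `(n + 1)^g s n` is, up to summable errors, a supermartingale whose mean tends to zero, then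
the probability of ever leaving the region `s n ≤ (n + 1)^(-g)` after time `n₀` tends to zero. -/
lemma exists_escape_le {P : Measure Ω} [IsProbabilityMeasure P] (hs0 : ∀ n ω, 0 ≤ s n ω)
    (hsm : ∀ n, Measurable (s n)) (hsi : ∀ n, Integrable (s n) P) {q q' C K : ℝ}
    (hg : 0 < g) (hgq : g < q) (hgq' : g < q') (hg1 : g < 1) (hC : 0 ≤ C)
    (hrec : ∀ᶠ n : ℕ in atTop, ∀ n₀, ∫ ω, aliveInd s g n₀ n ω * s (n + 1) ω ∂P ≤
      (1 - q' / ((n : ℝ) + 1)) * ∫ ω, aliveInd s g n₀ n ω * s n ω ∂P + C / ((n : ℝ) + 1) ^ 2)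
    (hrate : ∀ᶠ n : ℕ in atTop, ∫ ω, s n ω ∂P ≤ K * ((n : ℝ) + 1) ^ (-q))
    {ε : ℝ} (hε : 0 < ε) :
    ∃ n₀, ∀ n ≥ n₀, ∫ ω, (1 - aliveInd s g n₀ n ω) ∂P ≤ ε := by
  have hχm : ∀ n₀ n, Measurable (aliveInd s g n₀ n) := fun n₀ n =>
    measurable_aliveInd fun j _ => hsm j
  have hχi : ∀ n₀ n, Integrable (fun ω => 1 - aliveInd s g n₀ n ω) P := fun n₀ n =>
    (integrable_const _).sub (Integrable.of_bound (hχm n₀ n).aestronglyMeasurable 1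
      (Eventually.of_forall fun ω => by
        rw [Real.norm_of_nonneg (aliveInd_nonneg ω)]; exact aliveInd_le_one ω))
  have hχs : ∀ n₀ n j, Integrable (fun ω => aliveInd s g n₀ n ω * s j ω) P := fun n₀ n j =>
    (hsi j).bdd_mul (c := 1) (hχm n₀ n).aestronglyMeasurable (Eventually.of_forall fun ω => by
      rw [Real.norm_of_nonneg (aliveInd_nonneg ω)]; exact aliveInd_le_one ω)
  set f : ℕ → ℝ := fun j => C * 2 ^ g * ((j : ℝ) + 1) ^ (g - 2) with hf
  have hf0 : ∀ j, 0 ≤ f j := fun j => by positivity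
  have hfs : Summable f := by
    have h1 := (Real.summable_nat_rpow (p := g - 2)).2 (by linarith)
    have h2 := ((summable_nat_add_iff 1).2 h1).mul_left (C * 2 ^ g)
    simpa [hf] using h2
  have ht1 : Tendsto (fun n₀ : ℕ => ∑' j, f (j + n₀)) atTop (𝓝 0) := tendsto_sum_nat_add f
  have ht2 : Tendsto (fun n : ℕ => K * ((n : ℝ) + 1) ^ (-(q - g))) atTop (𝓝 0) := by
    have : Tendsto (fun n : ℕ => ((n : ℝ) + 1) ^ (-(q - g))) atTop (𝓝 0) :=
      (tendsto_rpow_neg_atTop (by linarith)).comp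
        (tendsto_atTop_add_const_right _ 1 tendsto_natCast_atTop_atTop)
    simpa using this.const_mul K
  obtain ⟨n1, hn1⟩ := eventually_atTop.1 hrec
  obtain ⟨n₀, h1, h2, h3, h4⟩ := ((ht1.eventually_le_const (half_pos hε)).and
    ((ht2.eventually_le_const (half_pos hε)).and (hrate.and (eventually_ge_atTop n1)))).exists
  refine ⟨n₀, fun n hn => ?_⟩
  have hclaim : ∀ n ≥ n₀, ∫ ω, (1 - aliveInd s g n₀ n ω) ∂P
      + ((n : ℝ) + 1) ^ g * ∫ ω, aliveInd s g n₀ n ω * s n ω ∂P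
      ≤ ((n₀ : ℝ) + 1) ^ g * ∫ ω, s n₀ ω ∂P + ∑ j ∈ Finset.Ico n₀ n, f j := by
    intro n hn
    induction n, hn using Nat.le_induction with
    | base =>
      rw [Finset.Ico_self, Finset.sum_empty, add_zero, ← integral_const_mul, ← integral_const_mul,
        ← integral_add (hχi _ _) ((hχs _ _ _).const_mul _)]
      refine integral_mono ((hχi _ _).add ((hχs _ _ _).const_mul _)) ((hsi n₀).const_mul _)
        fun ω => ?_
      simp only
      by_cases h : ω ∈ alive s g n₀ n₀
      · rw [aliveInd_of_mem h]; simp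
      · rw [aliveInd_of_notMem h]
        have h5 : ((n₀ : ℝ) + 1) ^ (-g) < s n₀ ω := by
          by_contra! h6
          exact h fun j hj1 hj2 => by rwa [le_antisymm hj2 hj1]
        have h4 : (0 : ℝ) < ((n₀ : ℝ) + 1) ^ g := by positivity
        rw [Real.rpow_neg (by positivity)] at h5
        have h6 := mul_le_mul_of_nonneg_left h5.le h4.le
        rw [mul_inv_cancel₀ h4.ne'] at h6
        linarith
    | succ n hn ih =>
      have hN : (0 : ℝ) < (n : ℝ) + 1 := by positivity
      have h5 : ∫ ω, (1 - aliveInd s g n₀ (n + 1) ω) ∂P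
          + ((n : ℝ) + 2) ^ g * ∫ ω, aliveInd s g n₀ (n + 1) ω * s (n + 1) ω ∂P
          ≤ ∫ ω, (1 - aliveInd s g n₀ n ω) ∂P
            + ((n : ℝ) + 2) ^ g * ∫ ω, aliveInd s g n₀ n ω * s (n + 1) ω ∂P := by
        rw [← integral_const_mul, ← integral_const_mul,
          ← integral_add (hχi _ _) ((hχs _ _ _).const_mul _),
          ← integral_add (hχi _ _) ((hχs _ _ _).const_mul _)]
        refine integral_mono ((hχi _ _).add ((hχs _ _ _).const_mul _))
          ((hχi _ _).add ((hχs _ _ _).const_mul _)) fun ω => ?_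
        exact aliveInd_step ω
      have h6 := hn1 n (h4.trans hn) n₀
      set a := ∫ ω, aliveInd s g n₀ n ω * s n ω ∂P with ha
      have ha0 : 0 ≤ a := integral_nonneg fun ω => mul_nonneg (aliveInd_nonneg ω) (hs0 n ω)
      have h7 : ((n : ℝ) + 2) ^ g * (1 - q' / ((n : ℝ) + 1)) ≤ ((n : ℝ) + 1) ^ g := by
        have h8 := rpow_mul_one_sub_le hN hg.le
        have h9 : (0 : ℝ) < ((n : ℝ) + 1) ^ g := by positivity
        have h10 : (0 : ℝ) < ((n : ℝ) + 2) ^ g := by positivity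
        rw [Real.rpow_neg hN.le, show (n : ℝ) + 1 + 1 = n + 2 by ring,
          Real.rpow_neg (by positivity), inv_mul_le_iff₀ h9, ← div_eq_mul_inv,
          le_div_iff₀ h10] at h8
        refine le_trans ?_ h8
        rw [mul_comm]
        gcongr
      have h8 : ((n : ℝ) + 2) ^ g * (C / ((n : ℝ) + 1) ^ 2) ≤ f n := by
        have h9 : ((n : ℝ) + 2) ^ g ≤ 2 ^ g * ((n : ℝ) + 1) ^ g := by
          rw [← Real.mul_rpow (by norm_num) hN.le]
          exact Real.rpow_le_rpow (by positivity) (by linarith) hg.le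
        have h10 : f n = 2 ^ g * ((n : ℝ) + 1) ^ g * (C / ((n : ℝ) + 1) ^ 2) := by
          simp only [hf]
          rw [Real.rpow_sub hN, Real.rpow_two]; ring
        rw [h10]
        exact mul_le_mul_of_nonneg_right h9 (by positivity)
      rw [Finset.sum_Ico_succ_top hn]
      push_cast
      rw [show (n : ℝ) + 1 + 1 = n + 2 by ring]
      have h9 := mul_le_mul_of_nonneg_left h6 (show (0 : ℝ) ≤ ((n : ℝ) + 2) ^ g by positivity)
      have h10 := mul_le_mul_of_nonneg_right h7 ha0
      linarith
  have h5 := hclaim n hn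
  have h6 : 0 ≤ ((n : ℝ) + 1) ^ g * ∫ ω, aliveInd s g n₀ n ω * s n ω ∂P :=
    mul_nonneg (by positivity)
      (integral_nonneg fun ω => mul_nonneg (aliveInd_nonneg ω) (hs0 n ω))
  have h7 : ((n₀ : ℝ) + 1) ^ g * ∫ ω, s n₀ ω ∂P ≤ ε / 2 := by
    refine le_trans ?_ h2
    refine (mul_le_mul_of_nonneg_left h3 (by positivity)).trans (le_of_eq ?_)
    rw [show -(q - g) = g + -q by ring, Real.rpow_add (by positivity)]; ring
  have h8 : ∑ j ∈ Finset.Ico n₀ n, f j ≤ ε / 2 := by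
    refine le_trans ?_ h1
    rw [Finset.sum_Ico_eq_sum_range]
    simp only [add_comm n₀]
    exact ((summable_nat_add_iff n₀).2 hfs).sum_le_tsum _ fun j _ => hf0 _
  linarith

end Localization

/-! ### Decay and localization of the network error -/

section NetworkErrorRate

variable {M N : ℕ} {S Ω : Type*} [MeasurableSpace S] [MeasurableSpace Ω]

variable {P : Measure Ω} [IsProbabilityMeasure P] {D : Measure S} [IsProbabilityMeasure D]
  {Q : Param M → S → ℝ} {x : Fin N → ℕ → Ω → S} {w₀ : Fin N → Ω → Param M} {wo : Param M}
  {lo hi α σsq : ℝ} {A : Matrix (Fin N) (Fin N) ℝ} {μ : ℝ} {p : Fin N → ℝ}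

local notation "𝐰" => estimate Q A (fun i : ℕ => μ / (i : ℝ)) x w₀

lemma eventually_integral_netError_succ_le (h : Model P D Q x w₀ wo lo hi α σsq)
    (hA : LeftStochasticPrimitive A) (hp0 : ∀ l, 0 ≤ p l) (hp : A *ᵥ p = p) (hp1 : ∑ l, p l = 1)
    (hμ : 0 < μ) {q' : ℝ} (hq' : q' < 2 * lo * μ) :
    ∀ᶠ n : ℕ in atTop, ∀ χ : Ω → ℝ, Measurable[past w₀ x n] χ → (∀ ω, 0 ≤ χ ω) → (∀ ω, χ ω ≤ 1) →
      ∫ ω, χ ω * netError 𝐰 wo p (n + 1) ω ∂P ≤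
        (1 - q' / ((n : ℝ) + 1)) * ∫ ω, χ ω * netError 𝐰 wo p n ω ∂P
          + μ ^ 2 * σsq / ((n : ℝ) + 1) ^ 2 := by
  have h1 : Tendsto (fun n : ℕ => (hi ^ 2 + α) * μ ^ 2 * (1 / ((n : ℝ) + 1))) atTop (𝓝 0) := by
    simpa using (tendsto_one_div_add_atTop_nhds_zero_nat (𝕜 := ℝ)).const_mul
      ((hi ^ 2 + α) * μ ^ 2)
  filter_upwards [h1.eventually_le_const (show 0 < 2 * lo * μ - q' by linarith)] with n hn χ hχ
    hχ0 hχ1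
  have hN : (0 : ℝ) < (n : ℝ) + 1 := by positivity
  refine (integral_netError_succ_le h hA hp0 hp hp1 hμ n hχ hχ0 hχ1).trans
    (add_le_add (mul_le_mul_of_nonneg_right ?_ ?_) (le_of_eq (by rw [div_pow]; ring)))
  · have h2 := mul_le_mul_of_nonneg_right hn (show 0 ≤ 1 / ((n : ℝ) + 1) by positivity)
    have h3 : 1 - q' / ((n : ℝ) + 1) - (1 - 2 * lo * (μ / ((n : ℝ) + 1))
        + (hi ^ 2 + α) * (μ / ((n : ℝ) + 1)) ^ 2)
        = (2 * lo * μ - q') * (1 / ((n : ℝ) + 1))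
          - (hi ^ 2 + α) * μ ^ 2 * (1 / ((n : ℝ) + 1)) * (1 / ((n : ℝ) + 1)) := by ring
    linarith
  · exact integral_nonneg fun ω => mul_nonneg (hχ0 ω) (netError_nonneg _ hp0 n ω)

/-- The mean-square error decays at every rate below the one given by the lower Hessian bound, capped
at `1 / n`. -/
lemma exists_netError_rate (h : Model P D Q x w₀ wo lo hi α σsq)
    (hA : LeftStochasticPrimitive A) (hp0 : ∀ l, 0 ≤ p l) (hp : A *ᵥ p = p) (hp1 : ∑ l, p l = 1)
    (hμ : 0 < μ) {q : ℝ} (hq0 : 0 ≤ q) (hq : q < 2 * lo * μ) (hq1 : q ≤ 1) :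
    ∃ K > 0, ∀ᶠ n : ℕ in atTop, ∫ ω, netError 𝐰 wo p n ω ∂P ≤ K * ((n : ℝ) + 1) ^ (-q) := by
  obtain ⟨q', hqq', hq'⟩ := exists_between hq
  refine rate_of_recursion (x := fun n => ∫ ω, netError 𝐰 wo p n ω ∂P) (C := μ ^ 2 * σsq) hq0 hqq' ?_
  filter_upwards [eventually_integral_netError_succ_le h hA hp0 hp hp1 hμ hq'] with n hn
  have h1 := hn (fun _ => 1) measurable_const (fun _ => zero_le_one) (fun _ => le_rfl)
  simp only [one_mul] at h1
  refine h1.trans (add_le_add le_rfl ?_)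
  have hs := h.sigma_pos.le
  rw [div_eq_mul_inv]
  refine mul_le_mul_of_nonneg_left ?_ (by positivity)
  rw [← Real.rpow_natCast, ← Real.rpow_neg (by positivity)]
  exact Real.rpow_le_rpow_of_exponent_le (by simp) (by push_cast; linarith)

/-- With probability close to one the network error stays below `(n + 1)^(-g)` from some time on. -/
lemma exists_escape_netError_le (h : Model P D Q x w₀ wo lo hi α σsq)
    (hA : LeftStochasticPrimitive A) (hp0 : ∀ l, 0 ≤ p l) (hp : A *ᵥ p = p) (hp1 : ∑ l, p l = 1)
    (hμ : 0 < μ) {g : ℝ} (hg : 0 < g) (hgl : g < 2 * lo * μ) (hg1 : g < 1) {ε : ℝ} (hε : 0 < ε) :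
    ∃ n₀, ∀ n ≥ n₀, ∫ ω, (1 - aliveInd (netError 𝐰 wo p) g n₀ n ω) ∂P ≤ ε := by
  obtain ⟨q, hq1, hq2⟩ := exists_between (lt_min hgl hg1)
  obtain ⟨q', hq3, hq4⟩ := exists_between hgl
  obtain ⟨K, -, hK⟩ := exists_netError_rate h hA hp0 hp hp1 hμ (hg.trans hq1).le
    (hq2.trans_le (min_le_left _ _)) (hq2.trans_le (min_le_right _ _)).le
  have hm : ∀ n j, j ≤ n → Measurable[past w₀ x n] (netError 𝐰 wo p j) := fun n j hj =>
    (measurable_netError h j).mono (past_mono w₀ x hj) le_rfl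
  refine exists_escape_le (q' := q') (C := μ ^ 2 * σsq) (netError_nonneg _ hp0)
    (fun n => (measurable_netError h n).mono (h.past_le n) le_rfl)
    (integrable_netError h) hg hq1 hq3 hg1 (by have := h.sigma_pos; positivity) ?_ hK hε
  filter_upwards [eventually_integral_netError_succ_le h hA hp0 hp hp1 hμ hq4] with n hn n₀
  exact hn _ (measurable_aliveInd (hm n)) aliveInd_nonneg aliveInd_le_one

end NetworkErrorRate

/-! ### Disagreement between agents -/

section Disagreement

set_option linter.unusedSectionVars false

lemma inv_sq_of_contraction {y : ℕ → ℝ} {ρ B : ℝ} (hρ0 : 0 ≤ ρ) (hρ1 : ρ < 1)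
    (h : ∀ᶠ n : ℕ in atTop, y (n + 1) ≤ ρ * y n + B / ((n : ℝ) + 1) ^ 2) :
    ∃ K > 0, ∀ᶠ n : ℕ in atTop, y n ≤ K / ((n : ℝ) + 1) ^ 2 := by
  have ht : Tendsto (fun n : ℕ => (((n : ℝ) + 1) / ((n : ℝ) + 2)) ^ 2) atTop (𝓝 1) := by
    have h1 := (tendsto_natCast_div_add_atTop (1 : ℝ)).comp (tendsto_add_atTop_nat 1)
    have h2 := h1.pow 2
    rw [one_pow] at h2
    refine h2.congr fun n => ?_
    simp only [Function.comp]
    push_cast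
    rw [show (n : ℝ) + 1 + 1 = n + 2 by ring]
  obtain ⟨n1, hn1⟩ := eventually_atTop.1
    (h.and (ht.eventually_const_le (show (1 + ρ) / 2 < 1 by linarith)))
  set K := max 1 (max (2 * B / (1 - ρ)) (y n1 * ((n1 : ℝ) + 1) ^ 2))
  have hK0 : 0 < K := lt_of_lt_of_le one_pos (le_max_left _ _)
  have hK1 : 2 * B ≤ K * (1 - ρ) := by
    rw [← div_le_iff₀ (by linarith)]
    exact (le_max_left _ _).trans (le_max_right _ _)
  have hK2 : y n1 * ((n1 : ℝ) + 1) ^ 2 ≤ K := (le_max_right _ _).trans (le_max_right _ _)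
  refine ⟨K, hK0, eventually_atTop.2 ⟨n1, fun n hn => ?_⟩⟩
  induction n, hn using Nat.le_induction with
  | base => rwa [le_div_iff₀ (by positivity)]
  | succ n hn ih =>
    obtain ⟨h1, h2⟩ := hn1 n hn
    have hN : (0 : ℝ) < ((n : ℝ) + 1) ^ 2 := by positivity
    calc y (n + 1) ≤ ρ * (K / ((n : ℝ) + 1) ^ 2) + B / ((n : ℝ) + 1) ^ 2 := by
          have := mul_le_mul_of_nonneg_left ih hρ0; linarith
      _ = (ρ * K + B) / ((n : ℝ) + 1) ^ 2 := by ring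
      _ ≤ (K * ((1 + ρ) / 2)) / ((n : ℝ) + 1) ^ 2 := by gcongr; linarith
      _ ≤ (K * (((n : ℝ) + 1) / ((n : ℝ) + 2)) ^ 2) / ((n : ℝ) + 1) ^ 2 := by gcongr
      _ = K / (((n + 1 : ℕ) : ℝ) + 1) ^ 2 := by
          push_cast
          rw [show (n : ℝ) + 1 + 1 = n + 2 by ring]
          field_simp

variable {M N : ℕ} {S Ω : Type*} [MeasurableSpace S] [MeasurableSpace Ω]

variable {P : Measure Ω} [IsProbabilityMeasure P] {D : Measure S} [IsProbabilityMeasure D]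
  {Q : Param M → S → ℝ} {x : Fin N → ℕ → Ω → S} {w₀ : Fin N → Ω → Param M} {wo : Param M}
  {lo hi α σsq : ℝ} {A : Matrix (Fin N) (Fin N) ℝ} {μ : ℝ} {p : Fin N → ℝ}

local notation "𝐰" => estimate Q A (fun i : ℕ => μ / (i : ℝ)) x w₀

/-- The total size of the instantaneous gradients used in the step from time `n` to `n + 1`. -/
noncomputable def gradSize (Q : Param M → S → ℝ) (x : Fin N → ℕ → Ω → S)
    (w : ℕ → Fin N → Ω → Param M) (n : ℕ) (ω : Ω) : ℝ :=
  ∑ l, ‖lossGrad Q (w n l ω) (x l (n + 1) ω)‖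

/-- A pathwise bound for the disagreement between agents: perturbations of size `C μ / (n + 1)` times
the gradients, damped by the factor `ρ` at every step. -/
noncomputable def spread (C ρ μ : ℝ) (Q : Param M → S → ℝ) (x : Fin N → ℕ → Ω → S)
    (w : ℕ → Fin N → Ω → Param M) : ℕ → Ω → ℝ
  | 0, ω => C * ∑ l, ‖w 0 l ω‖
  | n + 1, ω => ρ * (spread C ρ μ Q x w n ω + C * (μ / ((n : ℝ) + 1)) * gradSize Q x w n ω)

/-- The left-hand side is what remains of the disagreement at time `n` after `m` more combination steps
without adaptation; for `m = 0` it is the distance of agent `k` from the weighted average. -/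
lemma norm_deviation_le (hp : A *ᵥ p = p) {C ρ : ℝ} (hμ : 0 ≤ μ)
    (hgeo : ∀ n l k, |(A ^ n) l k - p l| ≤ C * ρ ^ n) (n : ℕ) (ω : Ω) :
    ∀ m k, ‖∑ l, ((A ^ m) l k - p l) • 𝐰 n l ω‖ ≤ ρ ^ m * spread C ρ μ Q x 𝐰 n ω := by
  have hsum : ∀ m k (y : Fin N → Param M),
      ‖∑ l, ((A ^ m) l k - p l) • y l‖ ≤ C * ρ ^ m * ∑ l, ‖y l‖ := by
    intro m k y
    refine (norm_sum_le _ _).trans ?_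
    rw [Finset.mul_sum]
    refine Finset.sum_le_sum fun l _ => ?_
    rw [norm_smul, Real.norm_eq_abs]
    exact mul_le_mul_of_nonneg_right (hgeo m l k) (norm_nonneg _)
  induction n with
  | zero =>
    intro m k
    refine (hsum m k _).trans (le_of_eq ?_)
    rw [spread]; ring
  | succ n ih =>
    intro m k
    have h1 : ∑ l, ((A ^ m) l k - p l) • 𝐰 (n + 1) l ω
        = ∑ l, ((A ^ (m + 1)) l k - p l) • 𝐰 n l ω - (μ / ((n : ℝ) + 1)) •
          ∑ l, ((A ^ (m + 1)) l k - p l) • lossGrad Q (𝐰 n l ω) (x l (n + 1) ω) := by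
      have h2 : ∀ l', (A ^ (m + 1)) l' k - p l' = ∑ l, ((A ^ m) l k - p l) * A l' l := by
        intro l'
        simp only [sub_mul, Finset.sum_sub_distrib]
        congr 1
        · rw [pow_succ', Matrix.mul_apply]
          exact Finset.sum_congr rfl fun l _ => mul_comm _ _
        · refine (congrFun hp l').symm.trans ?_
          simp only [Matrix.mulVec, dotProduct]
          exact Finset.sum_congr rfl fun l _ => mul_comm _ _
      simp only [estimate_succ, h2, Finset.smul_sum, Finset.sum_smul, smul_smul]
      rw [Finset.sum_comm, ← Finset.sum_sub_distrib]
      refine Finset.sum_congr rfl fun l' _ => ?_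
      rw [← Finset.sum_sub_distrib]
      refine Finset.sum_congr rfl fun l _ => ?_
      rw [smul_sub, smul_smul]
      congr 2
      ring
    rw [h1]
    refine (norm_sub_le _ _).trans ?_
    have h3 := ih (m + 1) k
    have h4 := hsum (m + 1) k fun l => lossGrad Q (𝐰 n l ω) (x l (n + 1) ω)
    rw [norm_smul, Real.norm_of_nonneg (by positivity)]
    have h5 := mul_le_mul_of_nonneg_left h4 (show 0 ≤ μ / ((n : ℝ) + 1) by positivity)
    rw [spread, gradSize]
    refine (add_le_add h3 h5).trans (le_of_eq ?_)
    rw [pow_succ]; ring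

lemma memLp_gradSize (h : Model P D Q x w₀ wo lo hi α σsq) (n : ℕ) :
    MemLp (gradSize Q x 𝐰 n) 2 P :=
  memLp_finsetSum _ fun l _ =>
    (memLp_lossGrad h n l (measurable_past_estimate h n l) (memLp_estimate h n l)).1.norm

lemma memLp_spread (h : Model P D Q x w₀ wo lo hi α σsq) (C ρ : ℝ) (n : ℕ) :
    MemLp (spread C ρ μ Q x 𝐰 n) 2 P := by
  induction n with
  | zero => exact (memLp_finsetSum _ fun l _ => (memLp_estimate (A := A) (μ := μ) h 0 l).norm).const_mul C
  | succ n ih => exact (ih.add ((memLp_gradSize h n).const_mul (C * (μ / ((n : ℝ) + 1))))).const_mul ρ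

/-- The disagreement between agents is of order `1 / n` in mean square. -/
lemma exists_spread_rate (h : Model P D Q x w₀ wo lo hi α σsq)
    (hA : LeftStochasticPrimitive A) (hp : A *ᵥ p = p) (hp1 : ∑ l, p l = 1)
    (hμ : 0 < μ) (C : ℝ) {ρ : ℝ} (hρ0 : 0 < ρ) (hρ1 : ρ < 1) :
    ∃ K > 0, ∀ᶠ n : ℕ in atTop, ∫ ω, spread C ρ μ Q x 𝐰 n ω ^ 2 ∂P ≤ K / ((n : ℝ) + 1) ^ 2 := by
  have hppos := perron_pos hA hp hp1
  have hlo := h.bounded.lo_pos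
  obtain ⟨K₀, hK₀, hrate⟩ := exists_netError_rate h hA (fun l => (hppos l).le) hp hp1 hμ le_rfl
    (show (0 : ℝ) < 2 * lo * μ by positivity) zero_le_one
  have hα := h.alpha_nonneg
  have hσ := h.sigma_pos
  -- a bound for the mean square of the gradients, uniform in time
  set B := (N : ℝ) * ∑ l, ((hi ^ 2 + α) * (K₀ / p l) + σsq) with hB
  have hgrad : ∀ᶠ n : ℕ in atTop, ∫ ω, gradSize Q x 𝐰 n ω ^ 2 ∂P ≤ B := by
    filter_upwards [hrate] with n hn
    rw [neg_zero, Real.rpow_zero, mul_one] at hn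
    have h1 := fun l => memLp_lossGrad h n l (measurable_past_estimate (A := A) (μ := μ) h n l)
      (memLp_estimate h n l)
    calc ∫ ω, gradSize Q x 𝐰 n ω ^ 2 ∂P
        ≤ ∫ ω, (N : ℝ) * ∑ l, ‖lossGrad Q (𝐰 n l ω) (x l (n + 1) ω)‖ ^ 2 ∂P := by
          refine integral_mono (memLp_gradSize h n).integrable_sq
            ((integrable_finsetSum _ fun l _ => (h1 l).1.norm.integrable_sq).const_mul _) fun ω => ?_
          have := sq_sum_le_card_mul_sum_sq (s := Finset.univ)
            (f := fun l => ‖lossGrad Q (𝐰 n l ω) (x l (n + 1) ω)‖)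
          simpa [gradSize] using this
      _ = (N : ℝ) * ∑ l, ∫ ω, ‖lossGrad Q (𝐰 n l ω) (x l (n + 1) ω)‖ ^ 2 ∂P := by
          rw [integral_const_mul, integral_finsetSum _ fun l _ => (h1 l).1.norm.integrable_sq]
      _ ≤ B := by
          refine mul_le_mul_of_nonneg_left (Finset.sum_le_sum fun l _ => ?_) (Nat.cast_nonneg N)
          refine (h1 l).2.trans (add_le_add (mul_le_mul_of_nonneg_left ?_ (by positivity)) le_rfl)
          rw [le_div_iff₀ (hppos l), mul_comm, ← integral_const_mul]
          refine le_trans (integral_mono ((memLp_error h n l).norm.integrable_sq.const_mul _)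
            (integrable_netError h n) fun ω => ?_) hn
          exact Finset.single_le_sum (f := fun l => p l * ‖𝐰 n l ω - wo‖ ^ 2)
            (fun l _ => mul_nonneg (hppos l).le (sq_nonneg _)) (Finset.mem_univ l)
  refine inv_sq_of_contraction (B := (ρ * C * μ) ^ 2 / (1 - ρ) * B) hρ0.le hρ1 ?_
  filter_upwards [hgrad] with n hn
  have h1ρ : 0 < 1 - ρ := by linarith
  calc ∫ ω, spread C ρ μ Q x 𝐰 (n + 1) ω ^ 2 ∂P
      ≤ ∫ ω, (ρ * spread C ρ μ Q x 𝐰 n ω ^ 2 +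
          ((ρ * C * μ) ^ 2 / (1 - ρ) / ((n : ℝ) + 1) ^ 2) * gradSize Q x 𝐰 n ω ^ 2) ∂P := by
        refine integral_mono (memLp_spread h C ρ (n + 1)).integrable_sq
          (((memLp_spread h C ρ n).integrable_sq.const_mul _).add
            ((memLp_gradSize h n).integrable_sq.const_mul _)) fun ω => ?_
        simp only
        rw [spread]
        -- convexity of the square with weights `ρ` and `1 - ρ`
        set z := spread C ρ μ Q x 𝐰 n ω
        set y := ρ * C * μ / ((n : ℝ) + 1) * gradSize Q x 𝐰 n ω / (1 - ρ) with hy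
        have h2 : ρ * (z + C * (μ / ((n : ℝ) + 1)) * gradSize Q x 𝐰 n ω) = ρ * z + (1 - ρ) * y := by
          rw [hy]; field_simp
        have h3 : ((ρ * C * μ) ^ 2 / (1 - ρ) / ((n : ℝ) + 1) ^ 2) * gradSize Q x 𝐰 n ω ^ 2
            = (1 - ρ) * y ^ 2 := by
          rw [hy]; field_simp
        rw [h2, h3]
        have := mul_nonneg (mul_nonneg hρ0.le h1ρ.le) (sq_nonneg (z - y))
        nlinarith
    _ = ρ * ∫ ω, spread C ρ μ Q x 𝐰 n ω ^ 2 ∂P +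
          ((ρ * C * μ) ^ 2 / (1 - ρ) / ((n : ℝ) + 1) ^ 2) * ∫ ω, gradSize Q x 𝐰 n ω ^ 2 ∂P := by
        rw [integral_add ((memLp_spread h C ρ n).integrable_sq.const_mul _)
            ((memLp_gradSize h n).integrable_sq.const_mul _), integral_const_mul,
          integral_const_mul]
    _ ≤ _ := by
        refine add_le_add le_rfl ?_
        refine (mul_le_mul_of_nonneg_left hn (by positivity)).trans (le_of_eq ?_)
        ring

end Disagreement


/-! ### Recursions for weakly coupled modes -/

section CoupledModes

/-- Modes that are weakly coupled through their total energy `∑ m, u m` and through a disagreement `e`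
of order `1 / n²` decay at their own rates. The coupling is `o(n^(q-2))`, where `n^(-q)` is the rate
at which the total energy is already known to decay. -/
lemma eventually_le_alphaRate_of_coupled {M : ℕ} {lam κ : Fin M → ℝ} {u : Fin M → ℕ → ℝ} {e : ℕ → ℝ}
    {L μ q K : ℝ} (hμ : 0 < μ) (hL : ∀ m, L ≤ lam m) (hL1 : 1 ≤ 2 * L * μ) (hq0 : 0 ≤ q)
    (hq1 : q ≤ 1) (hqL : q < 2 * L * μ) (hκ : ∀ m, 0 ≤ κ m) (hu : ∀ m n, 0 ≤ u m n)
    (hK : 0 ≤ K) (he : ∀ᶠ n : ℕ in atTop, e n ≤ K / ((n : ℝ) + 1) ^ 2)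
    (hrec : ∀ ε > 0, ∀ᶠ n : ℕ in atTop, ∀ m, u m (n + 1) ≤
      (1 - lam m * μ / ((n : ℝ) + 1)) ^ 2 * u m n
        + ε * ((n : ℝ) + 1) ^ (q - 2) * (∑ m', u m' n + e n) + (κ m + ε) / ((n : ℝ) + 1) ^ 2)
    (m : Fin M) {η : ℝ} (hη : 0 < η) :
    ∀ᶠ n in atTop, u m n ≤ (κ m + η) * alphaRate (lam m) μ (n + 1) := by
  have hlam : ∀ m, 2 * L * μ ≤ 2 * (lam m * μ) := fun m => by
    have := mul_le_mul_of_nonneg_right (hL m) hμ.le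
    linarith
  -- the total energy is `O(n^(-q))`
  have htotal : ∃ B > 0, ∀ᶠ n : ℕ in atTop, ∑ m', u m' n ≤ B * ((n : ℝ) + 1) ^ (-q) := by
    obtain ⟨q'', hq1'', hq2''⟩ := exists_between hqL
    obtain ⟨q', hq1', hq2'⟩ := exists_between hq1''
    set ε := (q'' - q') / (M + 1) with hε
    have hε0 : 0 < ε := div_pos (by linarith) (by positivity)
    have hMε : M * ε ≤ q'' - q' := by
      have : (M + 1) * ε = q'' - q' := by rw [hε]; field_simp
      linarith
    refine rate_of_recursion (x := fun n => ∑ m', u m' n)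
      (C := M * ε * K + ∑ m', (κ m' + ε)) hq0 hq1' ?_
    have hsq : ∀ᶠ n : ℕ in atTop, ∀ m', (1 - lam m' * μ / ((n : ℝ) + 1)) ^ 2 ≤ 1 - q'' / (n + 1) :=
      eventually_all.2 fun m' => eventually_sq_le (hq2''.trans_le (hlam m'))
    filter_upwards [hrec ε hε0, hsq, he] with n h1 h2 h3
    have hN : (1 : ℝ) ≤ (n : ℝ) + 1 := by linarith [Nat.cast_nonneg (α := ℝ) n]
    have hN0 : (0 : ℝ) < (n : ℝ) + 1 := by linarith
    have hp1 : ((n : ℝ) + 1) ^ (q - 2) ≤ 1 / ((n : ℝ) + 1) := by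
      rw [one_div, ← Real.rpow_neg_one]
      exact Real.rpow_le_rpow_of_exponent_le hN (by linarith)
    have hp2 : ((n : ℝ) + 1) ^ (q - 2) * (K / ((n : ℝ) + 1) ^ 2) ≤ K * ((n : ℝ) + 1) ^ (-1 - q) := by
      rw [div_eq_mul_inv, ← Real.rpow_natCast, ← Real.rpow_neg hN0.le, mul_left_comm,
        ← Real.rpow_add hN0]
      exact mul_le_mul_of_nonneg_left
        (Real.rpow_le_rpow_of_exponent_le hN (by push_cast; linarith)) hK
    have hp3 : 1 / ((n : ℝ) + 1) ^ 2 ≤ ((n : ℝ) + 1) ^ (-1 - q) := by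
      rw [one_div, ← Real.rpow_natCast, ← Real.rpow_neg hN0.le]
      exact Real.rpow_le_rpow_of_exponent_le hN (by push_cast; linarith)
    have hU : 0 ≤ ∑ m', u m' n := Finset.sum_nonneg fun m' _ => hu m' n
    have hpow : 0 ≤ ((n : ℝ) + 1) ^ (q - 2) := by positivity
    have hκε : 0 ≤ ∑ m', (κ m' + ε) := Finset.sum_nonneg fun m' _ => add_nonneg (hκ m') hε0.le
    calc ∑ m', u m' (n + 1)
        ≤ ∑ m', ((1 - q'' / (n + 1)) * u m' n
          + ε * ((n : ℝ) + 1) ^ (q - 2) * (∑ m', u m' n + e n)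
          + (κ m' + ε) / ((n : ℝ) + 1) ^ 2) := by
          refine Finset.sum_le_sum fun m' _ => (h1 m').trans ?_
          have := mul_le_mul_of_nonneg_right (h2 m') (hu m' n)
          linarith
      _ = (1 - q'' / (n + 1)) * ∑ m', u m' n
          + M * ε * (((n : ℝ) + 1) ^ (q - 2) * ∑ m', u m' n + ((n : ℝ) + 1) ^ (q - 2) * e n)
          + (∑ m', (κ m' + ε)) * (1 / ((n : ℝ) + 1) ^ 2) := by
          rw [Finset.sum_add_distrib, Finset.sum_add_distrib, ← Finset.mul_sum, Finset.sum_const,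
            Finset.card_univ, Fintype.card_fin, nsmul_eq_mul, ← Finset.sum_div]
          ring
      _ ≤ (1 - q'' / (n + 1)) * ∑ m', u m' n
          + (M * ε * (1 / ((n : ℝ) + 1) * ∑ m', u m' n) + M * ε * (K * ((n : ℝ) + 1) ^ (-1 - q)))
          + (∑ m', (κ m' + ε)) * ((n : ℝ) + 1) ^ (-1 - q) := by
          have h5 := (mul_le_mul_of_nonneg_left h3 hpow).trans hp2
          have h6 := mul_le_mul_of_nonneg_right hp1 hU
          have h7 := mul_le_mul_of_nonneg_left (add_le_add h6 h5)
            (show 0 ≤ M * ε by positivity)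
          have h8 := mul_le_mul_of_nonneg_left hp3 hκε
          linarith
      _ ≤ (1 - q'' / (n + 1)) * ∑ m', u m' n
          + ((q'' - q') * (1 / ((n : ℝ) + 1) * ∑ m', u m' n)
            + M * ε * (K * ((n : ℝ) + 1) ^ (-1 - q)))
          + (∑ m', (κ m' + ε)) * ((n : ℝ) + 1) ^ (-1 - q) := by
          gcongr
      _ = _ := by ring
  obtain ⟨B, hB, hBn⟩ := htotal
  refine eventually_le_alphaRate_of_recursion (by linarith [hlam m]) (hκ m) (fun η hη => ?_) hη
  have hε : 0 < η / (B + K + 1) := by positivity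
  filter_upwards [hrec _ hε, hBn, he] with n h1 h2 h3
  have hN : (1 : ℝ) ≤ (n : ℝ) + 1 := by linarith [Nat.cast_nonneg (α := ℝ) n]
  have hN0 : (0 : ℝ) < (n : ℝ) + 1 := by linarith
  have hK2 : K / ((n : ℝ) + 1) ^ 2 ≤ K * ((n : ℝ) + 1) ^ (-q) := by
    rw [div_eq_mul_inv, ← Real.rpow_natCast, ← Real.rpow_neg hN0.le]
    exact mul_le_mul_of_nonneg_left
      (Real.rpow_le_rpow_of_exponent_le hN (by push_cast; linarith)) hK
  have h4 : ((n : ℝ) + 1) ^ (q - 2) * (∑ m', u m' n + e n) ≤ (B + K) / ((n : ℝ) + 1) ^ 2 := by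
    calc ((n : ℝ) + 1) ^ (q - 2) * (∑ m', u m' n + e n)
        ≤ ((n : ℝ) + 1) ^ (q - 2) * ((B + K) * ((n : ℝ) + 1) ^ (-q)) := by
          gcongr; linarith
      _ = (B + K) / ((n : ℝ) + 1) ^ 2 := by
          rw [mul_left_comm, ← Real.rpow_add hN0, div_eq_mul_inv,
            ← Real.rpow_natCast (_ + 1) 2, ← Real.rpow_neg hN0.le]
          congr 2; push_cast; ring
  refine (h1 m).trans ?_
  rw [add_assoc]
  refine add_le_add le_rfl ?_
  rw [mul_assoc]
  refine (add_le_add (mul_le_mul_of_nonneg_left h4 hε.le) le_rfl).trans (le_of_eq ?_)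
  field_simp
  ring

end CoupledModes

/-! ### The weighted average of the agents -/

section Centroid

set_option linter.unusedSectionVars false

variable {M N : ℕ} {S Ω : Type*} [MeasurableSpace S] [MeasurableSpace Ω]

local notation "⟪" x ", " y "⟫" => inner ℝ x y

variable {P : Measure Ω} [IsProbabilityMeasure P] {D : Measure S} [IsProbabilityMeasure D]
  {Q : Param M → S → ℝ} {x : Fin N → ℕ → Ω → S} {w₀ : Fin N → Ω → Param M} {wo : Param M}
  {lo hi α σsq : ℝ} {A : Matrix (Fin N) (Fin N) ℝ} {μ : ℝ} {p : Fin N → ℝ}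

local notation "𝐰" => estimate Q A (fun i : ℕ => μ / (i : ℝ)) x w₀

/-- The error of the Perron-weighted average of the agents. -/
noncomputable def centroid (w : ℕ → Fin N → Ω → Param M) (wo : Param M) (p : Fin N → ℝ) (n : ℕ)
    (ω : Ω) : Param M :=
  ∑ l, p l • (w n l ω - wo)

lemma memLp_centroid (h : Model P D Q x w₀ wo lo hi α σsq) (n : ℕ) :
    MemLp (centroid 𝐰 wo p n) 2 P :=
  memLp_finsetSum _ fun l _ => (memLp_error h n l).const_smul (p l)

/-- Averaging with the Perron vector absorbs the combination step. -/
lemma centroid_succ (hp : A *ᵥ p = p) (hp1 : ∑ l, p l = 1) (n : ℕ) (ω : Ω) :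
    centroid 𝐰 wo p (n + 1) ω = ∑ l, p l • ((𝐰 n l ω - wo) -
      (μ / ((n : ℝ) + 1)) • lossGrad Q (𝐰 n l ω) (x l (n + 1) ω)) := by
  have h1 : ∀ y : Fin N → Param M, ∑ k, p k • ∑ l, A l k • y l = ∑ l, p l • y l := by
    intro y
    simp only [Finset.smul_sum, smul_smul]
    rw [Finset.sum_comm]
    refine Finset.sum_congr rfl fun l _ => ?_
    rw [← Finset.sum_smul]
    congr 1
    refine Eq.trans ?_ (congrFun hp l)
    simp only [Matrix.mulVec, dotProduct]
    exact Finset.sum_congr rfl fun k _ => mul_comm _ _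
  simp only [centroid, estimate_succ, smul_sub, Finset.sum_sub_distrib, ← Finset.sum_smul, hp1]
  have h2 := h1 fun l => 𝐰 n l ω - (μ / ((n : ℝ) + 1)) • lossGrad Q (𝐰 n l ω) (x l (n + 1) ω)
  simp only [smul_sub, Finset.sum_sub_distrib] at h2
  rw [h2]
  abel

/-- One step of the energy of the average in the direction of an eigenvector, on an event known at
time `n` on which the linearization error is at most `ε` times the errors of the agents. -/
lemma integral_mode_centroid_succ_le (h : Model P D Q x w₀ wo lo hi α σsq) (hp0 : ∀ l, 0 ≤ p l)
    (hp : A *ᵥ p = p) (hp1 : ∑ l, p l = 1) (hμ : 0 ≤ μ) {n : ℕ} {χ : Ω → ℝ}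
    (hχ : Measurable[past w₀ x n] χ) (hχ0 : ∀ ω, 0 ≤ χ ω) (hχ1 : ∀ ω, χ ω ≤ 1)
    {u : Param M} (hu : ‖u‖ = 1) {l ε R : ℝ} (hε0 : 0 ≤ ε) (hε1 : μ / ((n : ℝ) + 1) * ε ≤ 1)
    (hl : |1 - μ / ((n : ℝ) + 1) * l| ≤ 1) (hR : 0 ≤ R)
    {z : Ω → ℝ} (hz2 : MemLp z 2 P)
    (hz : ∀ j ω, ‖(𝐰 n j ω - wo) - centroid 𝐰 wo p n ω‖ ≤ z ω)
    (hlin : ∀ ω, χ ω ≠ 0 → ∀ j, |⟪u, gradient (risk Q D) (𝐰 n j ω)⟫ - l * ⟪u, 𝐰 n j ω - wo⟫|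
      ≤ ε * ‖𝐰 n j ω - wo‖)
    (hvar : ∀ ω, χ ω ≠ 0 → ∀ j, noiseVar Q D u (𝐰 n j ω) ≤ R) :
    ∫ ω, χ ω * ⟪u, centroid 𝐰 wo p (n + 1) ω⟫ ^ 2 ∂P ≤
      (1 - μ / ((n : ℝ) + 1) * l) ^ 2 * ∫ ω, χ ω * ⟪u, centroid 𝐰 wo p n ω⟫ ^ 2 ∂P
        + 5 * (μ / ((n : ℝ) + 1) * ε) *
          (∫ ω, χ ω * ‖centroid 𝐰 wo p n ω‖ ^ 2 ∂P + ∫ ω, z ω ^ 2 ∂P)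
        + (μ / ((n : ℝ) + 1)) ^ 2 * ((∑ l, p l ^ 2) * R) := by
  set τ := μ / ((n : ℝ) + 1) with hτ
  have hτ0 : 0 ≤ τ := by positivity
  have hχm : Measurable χ := hχ.mono (h.past_le n) le_rfl
  have hχb : ∀ᵐ ω ∂P, ‖χ ω‖ ≤ 1 := Eventually.of_forall fun ω => by
    rw [Real.norm_of_nonneg (hχ0 ω)]; exact hχ1 ω
  have hχint : ∀ f : Ω → ℝ, Integrable f P → Integrable (fun ω => χ ω * f ω) P := fun f hf =>
    hf.bdd_mul hχm.aestronglyMeasurable hχb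
  set b : Ω → ℝ := fun ω => ∑ j, p j * ⟪u, (𝐰 n j ω - wo) - τ • gradient (risk Q D) (𝐰 n j ω)⟫
    with hb
  have hbm : Measurable[past w₀ x n] b := by
    refine Finset.measurable_sum _ fun j _ => Measurable.const_mul ?_ _
    exact (continuous_const.inner ((continuous_id.sub continuous_const).sub
      (h.bounded.continuous_gradient.const_smul τ))).measurable.comp
      (measurable_past_estimate h n j)
  have hb2 : MemLp b 2 P := memLp_finsetSum _ fun j _ => (((memLp_error h n j).sub
    ((memLp_gradient h (measurable_estimate h n j) (memLp_estimate h n j)).const_smul τ)).const_inner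
      u).const_mul (p j)
  obtain ⟨hint, hstep⟩ := h.second_moment_step n (measurable_past_estimate (A := A) (μ := μ) h n)
    (memLp_estimate h n) hχ hχ0 hχ1 hbm (hχint _ hb2.integrable_sq) (fun j => τ * p j) u
  have hc : ∀ ω, ⟪u, centroid 𝐰 wo p (n + 1) ω⟫ =
      b ω - ∑ j, (τ * p j) * ⟪u, gradNoise Q D (𝐰 n j ω) (x j (n + 1) ω)⟫ := by
    intro ω
    rw [centroid_succ hp hp1, hb, inner_sum, ← Finset.sum_sub_distrib]
    refine Finset.sum_congr rfl fun j _ => ?_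
    rw [lossGrad_eq (D := D)]
    simp only [inner_smul_right, inner_sub_right, inner_add_right]
    ring
  simp only [hc]
  rw [hstep]
  refine add_le_add ?_ ?_
  · have i1 := hχint _ ((memLp_centroid (A := A) (μ := μ) (p := p) h n).const_inner u).integrable_sq
    have i2 := hχint _ (memLp_centroid (A := A) (μ := μ) (p := p) h n).norm.integrable_sq
    have i3 : Integrable (fun ω => χ ω * ‖centroid 𝐰 wo p n ω‖ ^ 2 + z ω ^ 2) P :=
      i2.add hz2.integrable_sq
    rw [← integral_const_mul, ← integral_add i2 hz2.integrable_sq, ← integral_const_mul,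
      ← integral_add (i1.const_mul _) (i3.const_mul _)]
    refine integral_mono (hχint _ hb2.integrable_sq)
      ((i1.const_mul _).add (i3.const_mul _)) fun ω => ?_
    simp only
    by_cases hω : χ ω = 0
    · rw [hω]
      have := sq_nonneg (z ω)
      simp only [zero_mul, mul_zero, zero_add]
      positivity
    set c := centroid 𝐰 wo p n ω with hcdef
    set y := ⟪u, c⟫ with hy
    set G := ∑ j, p j * ‖𝐰 n j ω - wo‖ with hG
    have hG0 : 0 ≤ G := Finset.sum_nonneg fun j _ => mul_nonneg (hp0 j) (norm_nonneg _)
    have hGle : G ≤ ‖c‖ + z ω := by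
      have h1 : G ≤ ∑ j, p j * (‖c‖ + z ω) := by
        refine Finset.sum_le_sum fun j _ => mul_le_mul_of_nonneg_left ?_ (hp0 j)
        have h2 := norm_le_norm_add_norm_sub' (𝐰 n j ω - wo) c
        have h3 := hz j ω
        linarith
      rwa [← Finset.sum_mul, hp1, one_mul] at h1
    have hyc : |y| ≤ ‖c‖ := by
      have := abs_real_inner_le_norm u c
      rwa [hu, one_mul] at this
    have hdev : |b ω - (1 - τ * l) * y| ≤ τ * ε * G := by
      have h1 : b ω - (1 - τ * l) * y = -(τ * ∑ j, p j *
          (⟪u, gradient (risk Q D) (𝐰 n j ω)⟫ - l * ⟪u, 𝐰 n j ω - wo⟫)) := by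
        rw [hb, hy, hcdef, centroid, inner_sum, Finset.mul_sum, Finset.mul_sum,
          ← Finset.sum_neg_distrib, ← Finset.sum_sub_distrib]
        refine Finset.sum_congr rfl fun j _ => ?_
        simp only [inner_smul_right, inner_sub_right]
        ring
      rw [h1, abs_neg, abs_mul, abs_of_nonneg hτ0, mul_assoc]
      refine mul_le_mul_of_nonneg_left ?_ hτ0
      refine (Finset.abs_sum_le_sum_abs _ _).trans ?_
      rw [hG, Finset.mul_sum]
      refine Finset.sum_le_sum fun j _ => ?_
      rw [abs_mul, abs_of_nonneg (hp0 j)]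
      have := mul_le_mul_of_nonneg_left (hlin ω hω j) (hp0 j)
      linarith
    have hmain : b ω ^ 2 ≤ (1 - τ * l) ^ 2 * y ^ 2 + 5 * (τ * ε) * (‖c‖ ^ 2 + z ω ^ 2) := by
      set d := b ω - (1 - τ * l) * y with hd
      have hs0 : 0 ≤ τ * ε := mul_nonneg hτ0 hε0
      have h1 : b ω ^ 2 = (1 - τ * l) ^ 2 * y ^ 2 + 2 * ((1 - τ * l) * y) * d + d ^ 2 := by
        rw [hd]; ring
      have h2 : |(1 - τ * l) * y| ≤ ‖c‖ := by
        rw [abs_mul]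
        exact (mul_le_mul hl hyc (abs_nonneg _) zero_le_one).trans (by rw [one_mul])
      have h3 : (1 - τ * l) * y * d ≤ ‖c‖ * (τ * ε * G) := by
        refine (le_abs_self _).trans ?_
        rw [abs_mul]
        exact mul_le_mul h2 hdev (abs_nonneg _) (norm_nonneg _)
      have h4 : d ^ 2 ≤ τ * ε * G ^ 2 := by
        have h5 : d ^ 2 ≤ (τ * ε * G) ^ 2 := by
          rw [← sq_abs]; exact pow_le_pow_left₀ (abs_nonneg _) hdev 2
        have h6 : (τ * ε * G) ^ 2 ≤ τ * ε * G ^ 2 := by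
          have := mul_le_mul_of_nonneg_right (mul_le_of_le_one_left hs0 hε1) (sq_nonneg G)
          nlinarith
        exact h5.trans h6
      have h7 : 2 * (‖c‖ * G) + G ^ 2 ≤ 5 * (‖c‖ ^ 2 + z ω ^ 2) := by
        have h8 := mul_le_mul_of_nonneg_left hGle (norm_nonneg c)
        have h9 := pow_le_pow_left₀ hG0 hGle 2
        nlinarith [sq_nonneg (‖c‖ - z ω), sq_nonneg (z ω)]
      have h8 := mul_le_mul_of_nonneg_left h7 hs0
      rw [h1]
      linarith
    have h1 := mul_le_mul_of_nonneg_left hmain (hχ0 ω)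
    have h2 : χ ω * z ω ^ 2 ≤ z ω ^ 2 := mul_le_of_le_one_left (sq_nonneg _) (hχ1 ω)
    have h3 := mul_le_mul_of_nonneg_left h2 (show 0 ≤ 5 * (τ * ε) by positivity)
    linarith
  · have h1 : ∀ j, ∫ ω, χ ω * noiseVar Q D u (𝐰 n j ω) ∂P ≤ R := by
      intro j
      have h2 : ∫ _ω, R ∂P = R := by simp
      rw [← h2]
      refine integral_mono_of_nonneg (Eventually.of_forall fun ω =>
        mul_nonneg (hχ0 ω) (noiseVar_nonneg _ _)) (integrable_const R)
        (Eventually.of_forall fun ω => ?_)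
      simp only
      by_cases hω : χ ω = 0
      · rw [hω, zero_mul]; exact hR
      · exact (mul_le_of_le_one_left (noiseVar_nonneg _ _) (hχ1 ω)).trans (hvar ω hω j)
    calc ∑ j, (τ * p j) ^ 2 * ∫ ω, χ ω * noiseVar Q D u (𝐰 n j ω) ∂P
        ≤ ∑ j, (τ * p j) ^ 2 * R :=
          Finset.sum_le_sum fun j _ => mul_le_mul_of_nonneg_left (h1 j) (sq_nonneg _)
      _ = τ ^ 2 * ((∑ l, p l ^ 2) * R) := by
          rw [Finset.sum_mul, Finset.mul_sum]
          exact Finset.sum_congr rfl fun j _ => by ring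

lemma norm_error_sub_centroid_le (hp : A *ᵥ p = p) (hp1 : ∑ l, p l = 1) {C ρ : ℝ} (hμ : 0 ≤ μ)
    (hgeo : ∀ n l k, |(A ^ n) l k - p l| ≤ C * ρ ^ n) (n : ℕ) (k : Fin N) (ω : Ω) :
    ‖(𝐰 n k ω - wo) - centroid 𝐰 wo p n ω‖ ≤ spread C ρ μ Q x 𝐰 n ω := by
  have h1 := norm_deviation_le (Q := Q) (x := x) (w₀ := w₀) hp hμ hgeo n ω 0 k
  rw [show ρ ^ 0 = 1 from pow_zero ρ, one_mul] at h1
  refine le_trans (le_of_eq ?_) h1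
  congr 1
  simp only [sub_smul, Finset.sum_sub_distrib, pow_zero, Matrix.one_apply, ite_smul, one_smul,
    zero_smul, Finset.sum_ite_eq', Finset.mem_univ, if_true, centroid, smul_sub, ← Finset.sum_smul,
    hp1]
  abel

end Centroid


/-! ### Excess risk in terms of the modes -/

section RiskGap

variable {M : ℕ} {J : Param M → ℝ} {lo hi : ℝ} {wo : Param M} {Φ : Matrix (Fin M) (Fin M) ℝ}
  {lam : Fin M → ℝ}

local notation "⟪" x ", " y "⟫" => inner ℝ x y

/-- Near the minimizer the excess risk is at most `1 + η` times the quadratic form of the Hessian at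
an approximation `c` of the error, up to the square of the approximation error. -/
lemma exists_sub_le_modes (hJ : BoundedHessian J lo hi) (hwo : ∀ w, J wo ≤ J w)
    (hΦ : Φᵀ * Φ = 1) (hΦ' : Φ * Φᵀ = 1) (hH : hessian J wo = Φ * Matrix.diagonal lam * Φᵀ) {η : ℝ}
    (hη : 0 < η) : ∃ δ > 0, ∃ C > 0, ∀ w c : Param M, ‖w - wo‖ ≤ δ →
      J w - J wo ≤ (1 + η) * (1 / 2 * ∑ m, lam m * ⟪mode Φ m, c⟫ ^ 2) + C * ‖(w - wo) - c‖ ^ 2 := by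
  have hlo := hJ.lo_pos
  have hlam : ∀ m, 0 ≤ lam m := fun m => hlo.le.trans (lo_le_eigenvalue hJ hΦ hH m)
  set s := min 1 (η / 3) with hs
  have hs0 : 0 < s := lt_min one_pos (by positivity)
  have hs1 : s ≤ 1 := min_le_left _ _
  have hsη : s ≤ η / 3 := min_le_right _ _
  have hss : (1 + s) * (1 + s) ≤ 1 + η := by nlinarith
  obtain ⟨δ, hδ, hquad⟩ := hJ.sub_le_quadratic hwo (ε := s * lo / 2) (by positivity)
  have hΛ : 0 ≤ ∑ m, lam m := Finset.sum_nonneg fun m _ => hlam m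
  refine ⟨δ, hδ, (1 + s) * (1 + 1 / s) * (1 / 2 * (∑ m, lam m)) + 1, by positivity,
    fun w c hw => ?_⟩
  set e := w - wo with he
  set d := e - c with hd
  have h1 := hquad w hw
  rw [fderiv_fderiv_eq_sum hH, ← he] at h1
  have h2 : lo * ‖e‖ ^ 2 ≤ ∑ m, lam m * ⟪mode Φ m, e⟫ ^ 2 := by
    rw [← sum_inner_mode_sq hΦ', Finset.mul_sum]
    exact Finset.sum_le_sum fun m _ =>
      mul_le_mul_of_nonneg_right (lo_le_eigenvalue hJ hΦ hH m) (sq_nonneg _)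
  have h3 : ∑ m, lam m * ⟪mode Φ m, e⟫ ^ 2 ≤
      (1 + s) * ∑ m, lam m * ⟪mode Φ m, c⟫ ^ 2 + (1 + 1 / s) * ((∑ m, lam m) * ‖d‖ ^ 2) := by
    have h4 : ∀ a b : ℝ, (a + b) ^ 2 ≤ (1 + s) * a ^ 2 + (1 + 1 / s) * b ^ 2 := by
      intro a b
      have h5 : (1 + s) * a ^ 2 + (1 + 1 / s) * b ^ 2 - (a + b) ^ 2 = (s * a - b) ^ 2 / s := by
        field_simp; ring
      have h6 : 0 ≤ (s * a - b) ^ 2 / s := by positivity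
      linarith
    rw [Finset.sum_mul, Finset.mul_sum, Finset.mul_sum, ← Finset.sum_add_distrib]
    refine Finset.sum_le_sum fun m _ => ?_
    have h5 : ⟪mode Φ m, e⟫ = ⟪mode Φ m, c⟫ + ⟪mode Φ m, d⟫ := by
      rw [hd, ← inner_add_right]; congr 1; abel
    have h6 : ⟪mode Φ m, d⟫ ^ 2 ≤ ‖d‖ ^ 2 := inner_mode_sq_le hΦ' m d
    have h7 := mul_le_mul_of_nonneg_left h6 (show 0 ≤ 1 + 1 / s by positivity)
    have h8 := mul_le_mul_of_nonneg_left
      ((h4 ⟪mode Φ m, c⟫ ⟪mode Φ m, d⟫).trans (add_le_add le_rfl h7)) (hlam m)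
    rw [h5]
    linarith
  have hc : 0 ≤ ∑ m, lam m * ⟪mode Φ m, c⟫ ^ 2 :=
    Finset.sum_nonneg fun m _ => mul_nonneg (hlam m) (sq_nonneg _)
  have h9 := mul_le_mul_of_nonneg_right hss hc
  have h10 : s * lo / 2 * ‖e‖ ^ 2 ≤ s / 2 * ∑ m, lam m * ⟪mode Φ m, e⟫ ^ 2 := by
    have := mul_le_mul_of_nonneg_left h2 (show 0 ≤ s / 2 by positivity)
    linarith
  have h11 := mul_le_mul_of_nonneg_left h3 (show 0 ≤ (1 + s) / 2 by positivity)
  have h12 := sq_nonneg ‖d‖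
  linarith

end RiskGap

/-! ### Domination by the closed form -/

section Comparison

variable {M N : ℕ} {lam : Fin M → ℝ} {μ : ℝ} {Φ R : Matrix (Fin M) (Fin M) ℝ}
  {p : EuclideanSpace ℝ (Fin N)}

/-- If the noise excites a slowest mode, then the closed form dominates the rates of all modes. -/
lemma exists_alphaRate_le_closedForm (hμ : 0 < μ) {L : ℝ} (hL : ∀ m, L ≤ lam m)
    (hL1 : 1 ≤ 2 * L * μ) (hR : ∀ m, 0 ≤ (Φᵀ * R * Φ) m m) (hp1 : ∑ l, p l = 1) {m₀ : Fin M}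
    (hm₀ : (Φᵀ * R * Φ) m₀ m₀ ≠ 0) (hm₀L : 2 * L * μ = 1 → lam m₀ = L) :
    (∃ B > 0, ∀ᶠ i in atTop, ∀ m, alphaRate (lam m) μ i ≤ B * closedForm μ lam Φ R p i) ∧
      (fun i : ℕ => 1 / (i : ℝ) ^ 2) =o[atTop] (fun i => closedForm μ lam Φ R p i) := by
  have hLpos : 0 < L := by
    by_contra! h
    have := mul_nonpos_of_nonpos_of_nonneg h hμ.le
    linarith
  have hlam : ∀ m, 0 < lam m := fun m => hLpos.trans_le (hL m)
  have hlamL : ∀ m, 2 * L * μ ≤ 2 * lam m * μ := fun m => by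
    have := mul_le_mul_of_nonneg_right (hL m) hμ.le
    linarith
  have hR0 : 0 < (Φᵀ * R * Φ) m₀ m₀ := (hR m₀).lt_of_ne' hm₀
  set c := μ ^ 2 / 2 * (lam m₀ * (Φᵀ * R * Φ) m₀ m₀) * ‖p‖ ^ 2 with hc
  have hc0 : 0 < c := by
    have h1 := hlam m₀
    have h2 : 0 < ‖p‖ ^ 2 := norm_sq_perron_pos hp1
    positivity
  have hsingle : ∀ i, c * alphaRate (lam m₀) μ i ≤ closedForm μ lam Φ R p i := fun i =>
    single_le_closedForm μ p (fun m => (hlam m).le) hR m₀ i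
  have hO : (fun i => alphaRate (lam m₀) μ i) =O[atTop] (fun i => closedForm μ lam Φ R p i) := by
    refine IsBigO.of_bound c⁻¹ (Eventually.of_forall fun i => ?_)
    rw [Real.norm_of_nonneg (alphaRate_nonneg _ _ _), Real.norm_of_nonneg
      ((mul_nonneg hc0.le (alphaRate_nonneg _ _ _)).trans (hsingle i)), ← div_eq_inv_mul,
      le_div_iff₀ hc0, mul_comm]
    exact hsingle i
  have hmode : ∀ m, (fun i => alphaRate (lam m) μ i) =O[atTop] (fun i => alphaRate (lam m₀) μ i) := by
    intro m
    have hfast : 1 < 2 * lam m * μ → (fun i => alphaRate (lam m) μ i) =O[atTop]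
        (fun i : ℕ => 1 / (i : ℝ)) := by
      intro h
      refine IsBigO.of_bound (2 * lam m * μ - 1)⁻¹ (Eventually.of_forall fun i => le_of_eq ?_)
      rw [alphaRate_of_one_lt h]
      have h1 : 0 < 2 * lam m * μ - 1 := by linarith
      have h2 : (0 : ℝ) ≤ i := Nat.cast_nonneg i
      rw [Real.norm_of_nonneg (by positivity), Real.norm_of_nonneg (by positivity)]
      field_simp
    rcases hL1.lt_or_eq with h1 | h1
    · refine (hfast (h1.trans_le (hlamL m))).trans ?_
      have h2 := h1.trans_le (hlamL m₀)
      refine IsBigO.of_bound (2 * lam m₀ * μ - 1) (Eventually.of_forall fun i => le_of_eq ?_)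
      rw [alphaRate_of_one_lt h2]
      have h1 : 0 < 2 * lam m₀ * μ - 1 := by linarith
      have h2 : (0 : ℝ) ≤ i := Nat.cast_nonneg i
      rw [Real.norm_of_nonneg (by positivity), Real.norm_of_nonneg (by positivity)]
      field_simp
    · have h2 := hm₀L h1.symm
      rcases (hL m).eq_or_lt with h3 | h3
      · rw [h2, ← h3]
      · have h4 : 1 < 2 * lam m * μ := by
          have := mul_lt_mul_of_pos_right h3 hμ
          linarith
        refine (hfast h4).trans (isLittleO_inv_alphaRate_of_eq_one ?_).isBigO
        rw [h2]; exact h1.symm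
  refine ⟨?_, (isLittleO_inv_sq_alphaRate _ _).trans_isBigO hO⟩
  have hb : (fun i => ∑ m, alphaRate (lam m) μ i) =O[atTop] (fun i => closedForm μ lam Φ R p i) :=
    IsBigO.fun_sum fun m _ => (hmode m).trans hO
  obtain ⟨B, hB, hb⟩ := hb.exists_pos
  refine ⟨B, hB, ?_⟩
  filter_upwards [hb.bound] with i hi m
  rw [Real.norm_of_nonneg (Finset.sum_nonneg fun m _ => alphaRate_nonneg _ _ _),
    Real.norm_of_nonneg (closedForm_nonneg μ p (fun m => (hlam m).le) hR i)] at hi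
  exact (Finset.single_le_sum (f := fun m => alphaRate (lam m) μ i)
    (fun m _ => alphaRate_nonneg _ _ _) (Finset.mem_univ m)).trans hi

end Comparison

/-! ### Decay of the modes on the localizing event -/

section LocalizedModes

set_option linter.unusedSectionVars false

variable {M N : ℕ} {S Ω : Type*} [MeasurableSpace S] [MeasurableSpace Ω]

local notation "⟪" x ", " y "⟫" => inner ℝ x y

variable {P : Measure Ω} [IsProbabilityMeasure P] {D : Measure S} [IsProbabilityMeasure D]
  {Q : Param M → S → ℝ} {x : Fin N → ℕ → Ω → S} {w₀ : Fin N → Ω → Param M} {wo : Param M}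
  {lo hi α σsq : ℝ} {A : Matrix (Fin N) (Fin N) ℝ} {μ : ℝ} {p : Fin N → ℝ}
  {Φ : Matrix (Fin M) (Fin M) ℝ} {lam : Fin M → ℝ}

local notation "𝐰" => estimate Q A (fun i : ℕ => μ / (i : ℝ)) x w₀

lemma norm_sq_error_le_of_mem_alive {w : ℕ → Fin N → Ω → Param M} (hp0 : ∀ l, 0 < p l) {g : ℝ}
    {n₀ n : ℕ} (hn : n₀ ≤ n) {ω : Ω} (hω : ω ∈ alive (netError w wo p) g n₀ n) (l : Fin N) :
    ‖w n l ω - wo‖ ^ 2 ≤ (∑ j, 1 / p j) * ((n : ℝ) + 1) ^ (-g) := by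
  have h1 : p l * ‖w n l ω - wo‖ ^ 2 ≤ ((n : ℝ) + 1) ^ (-g) :=
    (Finset.single_le_sum (f := fun l => p l * ‖w n l ω - wo‖ ^ 2)
      (fun j _ => mul_nonneg (hp0 j).le (sq_nonneg _)) (Finset.mem_univ l)).trans (hω n hn le_rfl)
  have h2 : 1 / p l ≤ ∑ j, 1 / p j :=
    Finset.single_le_sum (f := fun j => 1 / p j) (fun j _ => (one_div_pos.2 (hp0 j)).le)
      (Finset.mem_univ l)
  calc ‖w n l ω - wo‖ ^ 2 = 1 / p l * (p l * ‖w n l ω - wo‖ ^ 2) := by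
        have := (hp0 l).ne'
        field_simp
    _ ≤ _ := mul_le_mul h2 h1 (mul_nonneg (hp0 l).le (sq_nonneg _))
        ((one_div_pos.2 (hp0 l)).le.trans h2)

lemma eventually_norm_sub_le (wo : Param M) {g : ℝ} (hg : 0 < g) (K : ℝ) {δ : ℝ} (hδ : 0 < δ) :
    ∀ᶠ n : ℕ in atTop, ∀ u : Param M, ‖u - wo‖ ^ 2 ≤ K * ((n : ℝ) + 1) ^ (-g) → ‖u - wo‖ ≤ δ := by
  have h1 : Tendsto (fun n : ℕ => K * ((n : ℝ) + 1) ^ (-g)) atTop (𝓝 0) := by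
    have : Tendsto (fun n : ℕ => ((n : ℝ) + 1) ^ (-g)) atTop (𝓝 0) :=
      (tendsto_rpow_neg_atTop hg).comp
        (tendsto_atTop_add_const_right _ 1 tendsto_natCast_atTop_atTop)
    simpa using this.const_mul K
  filter_upwards [h1.eventually_le_const (show 0 < δ ^ 2 by positivity)] with n hn u hu
  exact (pow_le_pow_iff_left₀ (norm_nonneg _) hδ.le two_ne_zero).1 (hu.trans hn)

/-- On the localizing event, every mode of the average obeys the mean-square recursion of the
linearized algorithm up to negligible terms, and hence decays at the rate of that mode. -/
lemma eventually_localized_mode_le (h : Model P D Q x w₀ wo lo hi α σsq) (hp0 : ∀ l, 0 < p l)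
    (hp : A *ᵥ p = p) (hp1 : ∑ l, p l = 1) (hμ : 0 < μ) (hΦ : Φᵀ * Φ = 1) (hΦ' : Φ * Φᵀ = 1)
    (hH : hessian (risk Q D) wo = Φ * Matrix.diagonal lam * Φᵀ)
    (hcont : ∀ m, ContinuousAt (fun w => noiseVar Q D (mode Φ m) w) wo)
    {L q g : ℝ} (hL : ∀ m, L ≤ lam m) (hL1 : 1 ≤ 2 * L * μ) (hq0 : 0 ≤ q) (hq1 : q ≤ 1)
    (hqL : q < 2 * L * μ) (hg : 0 < g)
    (hclose : ∀ K, ∀ ε > 0, ∀ᶠ n : ℕ in atTop, ∀ u : Param M,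
      ‖u - wo‖ ^ 2 ≤ K * ((n : ℝ) + 1) ^ (-g) →
        ‖fderiv ℝ (fderiv ℝ (risk Q D)) u - fderiv ℝ (fderiv ℝ (risk Q D)) wo‖
          ≤ ε * ((n : ℝ) + 1) ^ (q - 1))
    {C ρ K : ℝ} (hgeo : ∀ n l k, |(A ^ n) l k - p l| ≤ C * ρ ^ n) (hK : 0 ≤ K)
    (hspread : ∀ᶠ n : ℕ in atTop, ∫ ω, spread C ρ μ Q x 𝐰 n ω ^ 2 ∂P ≤ K / ((n : ℝ) + 1) ^ 2)
    (n₀ : ℕ) (m : Fin M) {η : ℝ} (hη : 0 < η) :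
    ∀ᶠ n : ℕ in atTop, ∫ ω, aliveInd (netError 𝐰 wo p) g n₀ n ω *
        ⟪mode Φ m, centroid 𝐰 wo p n ω⟫ ^ 2 ∂P ≤
      (μ ^ 2 * (∑ l, p l ^ 2) * noiseVar Q D (mode Φ m) wo + η) * alphaRate (lam m) μ (n + 1) := by
  have hlampos : ∀ m, 0 < lam m := fun m =>
    h.bounded.lo_pos.trans_le (lo_le_eigenvalue h.bounded hΦ hH m)
  set χ : ℕ → Ω → ℝ := fun n => aliveInd (netError 𝐰 wo p) g n₀ n with hχdef
  have hχm : ∀ n, Measurable[past w₀ x n] (χ n) := fun n => measurable_aliveInd fun j hj =>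
    (measurable_netError h j).mono (past_mono w₀ x hj) le_rfl
  have hχint : ∀ n (f : Ω → ℝ), Integrable f P → Integrable (fun ω => χ n ω * f ω) P :=
    fun n f hf => hf.bdd_mul (c := 1) ((hχm n).mono (h.past_le n) le_rfl).aestronglyMeasurable
      (Eventually.of_forall fun ω => by
        rw [Real.norm_of_nonneg (aliveInd_nonneg ω)]; exact aliveInd_le_one ω)
  have hi1 : ∀ n n' m, Integrable (fun ω => χ n ω * ⟪mode Φ m, centroid 𝐰 wo p n' ω⟫ ^ 2) P :=
    fun n n' m => hχint n _ ((memLp_centroid (A := A) (μ := μ) h n').const_inner _).integrable_sq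
  set s := ∑ l, p l ^ 2 with hs
  have hs0 : 0 ≤ s := Finset.sum_nonneg fun l _ => sq_nonneg _
  refine eventually_le_alphaRate_of_coupled
    (u := fun m n => ∫ ω, χ n ω * ⟪mode Φ m, centroid 𝐰 wo p n ω⟫ ^ 2 ∂P)
    (κ := fun m => μ ^ 2 * s * noiseVar Q D (mode Φ m) wo) hμ hL hL1 hq0 hq1 hqL
    (fun m => mul_nonneg (by positivity) (noiseVar_nonneg _ _))
    (fun m n => integral_nonneg fun ω => mul_nonneg (aliveInd_nonneg ω) (sq_nonneg _)) hK hspread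
    (fun ε hε => ?_) m hη
  set η₀ := ε / (μ ^ 2 * s + 1) with hη₀
  have hη₀pos : 0 < η₀ := by positivity
  have hvar : ∃ δ > 0, ∀ m, ∀ w : Param M, ‖w - wo‖ ≤ δ →
      noiseVar Q D (mode Φ m) w ≤ noiseVar Q D (mode Φ m) wo + η₀ := by
    have h1 : ∀ᶠ w in 𝓝 wo, ∀ m, noiseVar Q D (mode Φ m) w ≤ noiseVar Q D (mode Φ m) wo + η₀ :=
      eventually_all.2 fun m => (hcont m).eventually_le_const (by linarith)
    obtain ⟨δ, hδ, hb⟩ := Metric.eventually_nhds_iff.1 h1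
    refine ⟨δ / 2, by positivity, fun m w hw => hb ?_ m⟩
    rw [dist_eq_norm]; linarith
  obtain ⟨δ, hδ, hvar⟩ := hvar
  set ε₀ := ε / (5 * μ) with hε₀
  have hε₀pos : 0 < ε₀ := by positivity
  have hτ : Tendsto (fun n : ℕ => μ / ((n : ℝ) + 1)) atTop (𝓝 0) := by
    simpa [div_eq_mul_inv] using (tendsto_one_div_add_atTop_nhds_zero_nat (𝕜 := ℝ)).const_mul μ
  have hτ1 : ∀ᶠ n : ℕ in atTop, μ / ((n : ℝ) + 1) * ε₀ ≤ 1 := by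
    have := hτ.mul_const ε₀
    rw [zero_mul] at this
    exact this.eventually_le_const one_pos
  have hτ2 : ∀ᶠ n : ℕ in atTop, ∀ m, μ / ((n : ℝ) + 1) * lam m ≤ 2 := by
    refine eventually_all.2 fun m => ?_
    have := hτ.mul_const (lam m)
    rw [zero_mul] at this
    exact this.eventually_le_const two_pos
  filter_upwards [eventually_ge_atTop n₀, hclose (∑ j, 1 / p j) ε₀ hε₀pos,
    eventually_norm_sub_le wo hg (∑ j, 1 / p j) hδ, hτ1, hτ2] with n hn hcl hnear hn1 hn2 m
  have hN : (1 : ℝ) ≤ (n : ℝ) + 1 := by linarith [Nat.cast_nonneg (α := ℝ) n]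
  have hN0 : (0 : ℝ) < (n : ℝ) + 1 := by linarith
  have herr : ∀ ω, χ n ω ≠ 0 → ∀ l,
      ‖𝐰 n l ω - wo‖ ^ 2 ≤ (∑ j, 1 / p j) * ((n : ℝ) + 1) ^ (-g) := by
    intro ω hω l
    have hmem : ω ∈ alive (netError 𝐰 wo p) g n₀ n := by
      by_contra hc
      exact hω (aliveInd_of_notMem hc)
    exact norm_sq_error_le_of_mem_alive hp0 hn hmem l
  have hpow1 : ((n : ℝ) + 1) ^ (q - 1) ≤ 1 := Real.rpow_le_one_of_one_le_of_nonpos hN (by linarith)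
  have hpow0 : 0 ≤ ((n : ℝ) + 1) ^ (q - 1) := by positivity
  have hstep := integral_mode_centroid_succ_le h (fun l => (hp0 l).le) hp hp1 hμ.le (hχm n)
    aliveInd_nonneg aliveInd_le_one (norm_mode hΦ m) (l := lam m)
    (ε := ε₀ * ((n : ℝ) + 1) ^ (q - 1)) (R := noiseVar Q D (mode Φ m) wo + η₀) (by positivity)
    (by
      have h1 := mul_le_mul_of_nonneg_left hpow1 (show 0 ≤ μ / ((n : ℝ) + 1) * ε₀ by positivity)
      linarith)
    (by
      rw [abs_le]
      have h1 : 0 ≤ μ / ((n : ℝ) + 1) * lam m := mul_nonneg (by positivity) (hlampos m).le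
      constructor <;> linarith [hn2 m])
    (add_nonneg (noiseVar_nonneg _ _) hη₀pos.le) (memLp_spread h C ρ n)
    (fun j ω => norm_error_sub_centroid_le hp hp1 hμ.le hgeo n j ω)
    (fun ω hω j => abs_inner_mode_gradient_sub_le h.bounded h.minimal hΦ hH
      (fun u hu => hcl u (le_trans (pow_le_pow_left₀ (norm_nonneg _) hu 2) (herr ω hω j))) m)
    (fun ω hω j => hvar m _ (hnear _ (herr ω hω j)))
  have hsum : ∫ ω, χ n ω * ‖centroid 𝐰 wo p n ω‖ ^ 2 ∂P
      = ∑ m', ∫ ω, χ n ω * ⟪mode Φ m', centroid 𝐰 wo p n ω⟫ ^ 2 ∂P := by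
    rw [← integral_finsetSum _ fun m' _ => hi1 n n m']
    simp only [← Finset.mul_sum, sum_inner_mode_sq hΦ']
  have hmono : ∫ ω, χ (n + 1) ω * ⟪mode Φ m, centroid 𝐰 wo p (n + 1) ω⟫ ^ 2 ∂P
      ≤ ∫ ω, χ n ω * ⟪mode Φ m, centroid 𝐰 wo p (n + 1) ω⟫ ^ 2 ∂P :=
    integral_mono (hi1 _ _ _) (hi1 _ _ _) fun ω =>
      mul_le_mul_of_nonneg_right (aliveInd_succ_le ω) (sq_nonneg _)
  refine hmono.trans (hstep.trans (le_of_eq_of_le ?_ (add_le_add le_rfl (?_ :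
    (μ ^ 2 * s * (noiseVar Q D (mode Φ m) wo + η₀)) / ((n : ℝ) + 1) ^ 2 ≤ _))))
  · rw [hsum]
    have h1 : 5 * (μ / ((n : ℝ) + 1) * (ε₀ * ((n : ℝ) + 1) ^ (q - 1)))
        = ε * ((n : ℝ) + 1) ^ (q - 2) := by
      rw [show q - 1 = (q - 2) + 1 by ring, Real.rpow_add_one hN0.ne', hε₀]
      field_simp
    have h2 : 1 - μ / ((n : ℝ) + 1) * lam m = 1 - lam m * μ / ((n : ℝ) + 1) := by ring
    rw [h1, h2]
    congr 1
    rw [div_pow]; ring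
  · refine div_le_div_of_nonneg_right ?_ (by positivity)
    rw [mul_add]
    refine add_le_add le_rfl ?_
    rw [hη₀, mul_div_assoc', div_le_iff₀ (by positivity)]
    nlinarith

end LocalizedModes


/-! ### Variation of the Hessian on shrinking balls -/

section HessianModulus

variable {M : ℕ} {J : Param M → ℝ} {lo hi : ℝ} {wo : Param M}

lemma eventually_hessian_close (hJ : BoundedHessian J lo hi) {g : ℝ} (hg : 0 < g) (K : ℝ) {ε : ℝ}
    (hε : 0 < ε) : ∀ᶠ n : ℕ in atTop, ∀ u : Param M, ‖u - wo‖ ^ 2 ≤ K * ((n : ℝ) + 1) ^ (-g) →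
      ‖fderiv ℝ (fderiv ℝ J) u - fderiv ℝ (fderiv ℝ J) wo‖ ≤ ε := by
  obtain ⟨δ, hδ, h⟩ := hJ.exists_hessian_close wo hε
  filter_upwards [eventually_norm_sub_le wo hg K hδ] with n hn u hu
  exact h u (hn u hu)

/-- If the Hessian is Hölder continuous at the minimizer, then it deviates by a negative power of `n`
on balls whose radius is a negative power of `n`. -/
lemma eventually_hessian_close_of_holder {β : ℝ} (hβ : 0 < β)
    (h : ∀ a b, (fun w => hessian J w a b - hessian J wo a b) =O[𝓝 wo] (fun w => ‖w - wo‖ ^ β))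
    {g r : ℝ} (hg : 0 < g) (hr : r < g * β / 2) (K : ℝ) {ε : ℝ} (hε : 0 < ε) :
    ∀ᶠ n : ℕ in atTop, ∀ u : Param M, ‖u - wo‖ ^ 2 ≤ K * ((n : ℝ) + 1) ^ (-g) →
      ‖fderiv ℝ (fderiv ℝ J) u - fderiv ℝ (fderiv ℝ J) wo‖ ≤ ε * ((n : ℝ) + 1) ^ (-r) := by
  obtain ⟨C, hC, δ, hδ, hhol⟩ := exists_hessian_holder h
  have h1 : Tendsto (fun n : ℕ => C * |K| ^ (β / 2) * ((n : ℝ) + 1) ^ (-(g * β / 2 - r))) atTop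
      (𝓝 0) := by
    have : Tendsto (fun n : ℕ => ((n : ℝ) + 1) ^ (-(g * β / 2 - r))) atTop (𝓝 0) :=
      (tendsto_rpow_neg_atTop (by linarith)).comp
        (tendsto_atTop_add_const_right _ 1 tendsto_natCast_atTop_atTop)
    simpa using this.const_mul (C * |K| ^ (β / 2))
  filter_upwards [eventually_norm_sub_le wo hg K hδ, h1.eventually_le_const hε] with n hn h2 u hu
  have hN0 : (0 : ℝ) < (n : ℝ) + 1 := by positivity
  calc ‖fderiv ℝ (fderiv ℝ J) u - fderiv ℝ (fderiv ℝ J) wo‖ ≤ C * ‖u - wo‖ ^ β := hhol u (hn u hu)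
    _ = C * (‖u - wo‖ ^ 2) ^ (β / 2) := by
        rw [← Real.rpow_natCast, ← Real.rpow_mul (norm_nonneg _)]
        congr 2; push_cast; ring
    _ ≤ C * (|K| * ((n : ℝ) + 1) ^ (-g)) ^ (β / 2) := by
        gcongr
        exact hu.trans (mul_le_mul_of_nonneg_right (le_abs_self K) (by positivity))
    _ = C * |K| ^ (β / 2) * ((n : ℝ) + 1) ^ (-(g * β / 2 - r)) * ((n : ℝ) + 1) ^ (-r) := by
        rw [Real.mul_rpow (abs_nonneg K) (by positivity), ← Real.rpow_mul hN0.le,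
          mul_assoc (C * _), ← Real.rpow_add hN0, mul_assoc]
        congr 3; ring
    _ ≤ ε * ((n : ℝ) + 1) ^ (-r) := by gcongr

end HessianModulus

/-! ### The probability of a large excess risk -/

section ExcessRisk

set_option linter.unusedSectionVars false

variable {M N : ℕ} {S Ω : Type*} [MeasurableSpace S] [MeasurableSpace Ω]

local notation "⟪" x ", " y "⟫" => inner ℝ x y

variable {P : Measure Ω} [IsProbabilityMeasure P] {D : Measure S} [IsProbabilityMeasure D]
  {Q : Param M → S → ℝ} {x : Fin N → ℕ → Ω → S} {w₀ : Fin N → Ω → Param M} {wo : Param M}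
  {lo hi α σsq : ℝ} {A : Matrix (Fin N) (Fin N) ℝ} {μ : ℝ} {p : EuclideanSpace ℝ (Fin N)}
  {Φ : Matrix (Fin M) (Fin M) ℝ} {lam : Fin M → ℝ}

local notation "𝐰" => estimate Q A (fun i : ℕ => μ / (i : ℝ)) x w₀

/-- The excess risk of an agent exceeds the closed form divided by `ν` with probability at most
`ν + ε`: the localizing event has probability close to one, and on it Markov's inequality applies. -/
lemma eventually_excess_risk_prob_ge (h : Model P D Q x w₀ wo lo hi α σsq)
    (hA : LeftStochasticPrimitive A) (hp : A *ᵥ (fun l => p l) = fun l => p l)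
    (hp1 : ∑ l, p l = 1) (hμ : 0 < μ) (hΦ : Φᵀ * Φ = 1) (hΦ' : Φ * Φᵀ = 1)
    (hH : hessian (risk Q D) wo = Φ * Matrix.diagonal lam * Φᵀ)
    (hcont : ContinuousAt (fun w => noiseCov Q D w) wo)
    {L q g : ℝ} (hL : ∀ m, L ≤ lam m) (hL1 : 1 ≤ 2 * L * μ) (hq0 : 0 ≤ q) (hq1 : q ≤ 1)
    (hqL : q < 2 * L * μ) (hg : 0 < g) (hg1 : g < 1) (hgl : g < 2 * lo * μ)
    (hclose : ∀ K, ∀ ε > 0, ∀ᶠ n : ℕ in atTop, ∀ u : Param M,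
      ‖u - wo‖ ^ 2 ≤ K * ((n : ℝ) + 1) ^ (-g) →
        ‖fderiv ℝ (fderiv ℝ (risk Q D)) u - fderiv ℝ (fderiv ℝ (risk Q D)) wo‖
          ≤ ε * ((n : ℝ) + 1) ^ (q - 1))
    {m₀ : Fin M} (hm₀ : (Φᵀ * noiseCov Q D wo * Φ) m₀ m₀ ≠ 0) (hm₀L : 2 * L * μ = 1 → lam m₀ = L)
    (k : Fin N) {ν ε : ℝ} (hν : 0 < ν) (hε : 0 < ε) :
    ∀ᶠ n : ℕ in atTop, 1 - ν - ε ≤ P.real {ω | risk Q D (𝐰 n k ω) - risk Q D wo ≤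
      1 / ν * closedForm μ lam Φ (noiseCov Q D wo) p (n + 1)} := by
  have hppos := perron_pos hA hp hp1
  have hlampos : ∀ m, 0 < lam m := fun m =>
    h.bounded.lo_pos.trans_le (lo_le_eigenvalue h.bounded hΦ hH m)
  have hR : ∀ m, 0 ≤ (Φᵀ * noiseCov Q D wo * Φ) m m := fun m => h.noiseCov_mode_nonneg m wo
  obtain ⟨C, ρ, hC, hρ0, hρ1, hgeo⟩ := exists_geometric_pow hA hp hp1
  obtain ⟨K, hK, hspread⟩ := exists_spread_rate h hA hp hp1 hμ C hρ0 hρ1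
  obtain ⟨⟨B, hB, hBα⟩, hinv⟩ := exists_alphaRate_le_closedForm hμ hL hL1 hR hp1 hm₀ hm₀L
  obtain ⟨n₀, hescape⟩ := exists_escape_netError_le h hA (fun l => (hppos l).le) hp hp1 hμ hg hgl
    hg1 (show 0 < ε / 2 by positivity)
  -- the relative error `η` is chosen such that `ν ((1 + η)² + η) ≤ ν + ε / 2`
  set η := min 1 (ε / (8 * ν)) with hη
  have hη0 : 0 < η := lt_min one_pos (by positivity)
  have hη1 : η ≤ 1 := min_le_left _ _
  have hη2 : ν * ((1 + η) * (1 + η) + η) ≤ ν + ε / 2 := by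
    have h1 : η * (8 * ν) ≤ ε := by rw [← le_div_iff₀ (by positivity)]; exact min_le_right _ _
    nlinarith [mul_pos hν hη0]
  obtain ⟨δ, hδ, C', hC', hgap⟩ := exists_sub_le_modes h.bounded h.minimal hΦ hΦ' hH hη0
  have hΛ : 0 ≤ ∑ m, lam m := Finset.sum_nonneg fun m _ => (hlampos m).le
  set η' := η / (B * (∑ m, lam m) + 1) with hη'
  have hη'0 : 0 < η' := by positivity
  have hmodes : ∀ᶠ n : ℕ in atTop, ∀ m, ∫ ω, aliveInd (netError 𝐰 wo (fun l => p l)) g n₀ n ω *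
        ⟪mode Φ m, centroid 𝐰 wo (fun l => p l) n ω⟫ ^ 2 ∂P ≤
      (μ ^ 2 * (∑ l, p l ^ 2) * noiseVar Q D (mode Φ m) wo + η') * alphaRate (lam m) μ (n + 1) :=
    eventually_all.2 fun m => eventually_localized_mode_le h hppos hp hp1 hμ hΦ hΦ' hH
      (fun m => h.continuousAt_noiseVar hcont m) hL hL1 hq0 hq1 hqL hg hclose hgeo hK.le hspread
      n₀ m hη'0
  filter_upwards [eventually_ge_atTop n₀, hmodes, hspread,
    (tendsto_add_atTop_nat 1).eventually hBα,
    (tendsto_add_atTop_nat 1).eventually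
      (isLittleO_iff.1 hinv (show 0 < η / (C' * K) by positivity)),
    (tendsto_add_atTop_nat 1).eventually (closedForm_eventually_pos hμ hp1 hlampos hR hm₀),
    eventually_norm_sub_le wo hg (∑ j, 1 / p j) hδ] with n hn hmode hz hα hsq hpos hnear
  set G := closedForm μ lam Φ (noiseCov Q D wo) p (n + 1) with hG
  set χ : Ω → ℝ := aliveInd (netError 𝐰 wo (fun l => p l)) g n₀ n with hχ
  set c : Ω → Param M := centroid 𝐰 wo (fun l => p l) n with hc
  set z : Ω → ℝ := spread C ρ μ Q x 𝐰 n with hzdef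
  have hχm : Measurable χ := (measurable_aliveInd fun j hj =>
    (measurable_netError h j).mono (past_mono w₀ x hj) le_rfl : Measurable[past w₀ x n] χ).mono
      (h.past_le n) le_rfl
  have hχi : Integrable χ P := Integrable.of_bound hχm.aestronglyMeasurable 1
    (Eventually.of_forall fun ω => by
      rw [Real.norm_of_nonneg (aliveInd_nonneg ω)]; exact aliveInd_le_one ω)
  have hci : ∀ m, Integrable (fun ω => χ ω * ⟪mode Φ m, c ω⟫ ^ 2) P := fun m =>
    ((memLp_centroid h n).const_inner (mode Φ m)).integrable_sq.bdd_mul (c := 1)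
      hχm.aestronglyMeasurable (Eventually.of_forall fun ω => by
        rw [Real.norm_of_nonneg (aliveInd_nonneg ω)]; exact aliveInd_le_one ω)
  have hzi : Integrable (fun ω => z ω ^ 2) P := (memLp_spread h C ρ n).integrable_sq
  -- an integrable bound for the excess risk on the localizing event
  set V : Ω → ℝ := fun ω => (1 + η) * (1 / 2 * ∑ m, lam m * (χ ω * ⟪mode Φ m, c ω⟫ ^ 2))
    + C' * z ω ^ 2 with hV
  have hVi1 : Integrable (fun ω => (1 + η) * (1 / 2 * ∑ m, lam m * (χ ω * ⟪mode Φ m, c ω⟫ ^ 2))) P :=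
    ((integrable_finsetSum _ fun m _ => (hci m).const_mul (lam m)).const_mul _).const_mul _
  have hVi : Integrable V P := hVi1.add (hzi.const_mul C')
  have hV0 : ∀ ω, 0 ≤ V ω := fun ω => by
    have : 0 ≤ ∑ m, lam m * (χ ω * ⟪mode Φ m, c ω⟫ ^ 2) := Finset.sum_nonneg fun m _ =>
      mul_nonneg (hlampos m).le (mul_nonneg (aliveInd_nonneg ω) (sq_nonneg _))
    simp only [hV]
    positivity
  have hVG : ∫ ω, V ω ∂P ≤ ((1 + η) * (1 + η) + η) * G := by
    have h1 : ∫ ω, V ω ∂P = (1 + η) * (1 / 2 * ∑ m, lam m * ∫ ω, χ ω * ⟪mode Φ m, c ω⟫ ^ 2 ∂P)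
        + C' * ∫ ω, z ω ^ 2 ∂P := by
      simp only [hV]
      rw [integral_add hVi1 (hzi.const_mul C'), integral_const_mul, integral_const_mul,
        integral_const_mul, integral_finsetSum _ fun m _ => (hci m).const_mul (lam m)]
      simp only [integral_const_mul]
    have h2 : 1 / 2 * ∑ m, lam m * ∫ ω, χ ω * ⟪mode Φ m, c ω⟫ ^ 2 ∂P ≤ G + η * G := by
      calc 1 / 2 * ∑ m, lam m * ∫ ω, χ ω * ⟪mode Φ m, c ω⟫ ^ 2 ∂P
          ≤ 1 / 2 * ∑ m, lam m * ((μ ^ 2 * (∑ l, p l ^ 2) * noiseVar Q D (mode Φ m) wo + η')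
              * alphaRate (lam m) μ (n + 1)) :=
            mul_le_mul_of_nonneg_left (Finset.sum_le_sum fun m _ =>
              mul_le_mul_of_nonneg_left (hmode m) (hlampos m).le) (by norm_num)
        _ = G + 1 / 2 * (η' * ∑ m, lam m * alphaRate (lam m) μ (n + 1)) := by
            rw [hG, closedForm, EuclideanSpace.real_norm_sq_eq]
            simp only [h.noiseVar_mode]
            generalize ∑ l, p l ^ 2 = s
            simp only [Finset.mul_sum, Finset.sum_mul]
            rw [← Finset.sum_add_distrib]
            exact Finset.sum_congr rfl fun m _ => by ring
        _ ≤ G + 1 / 2 * (η' * ∑ m, lam m * (B * G)) := by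
            gcongr with m
            · exact (hlampos m).le
            · exact hα m
        _ ≤ G + η * G := by
            rw [← Finset.sum_mul]
            have h3 : η' * (B * (∑ m, lam m) + 1) = η := by rw [hη']; field_simp
            have h4 : η' * ((∑ m, lam m) * (B * G)) ≤ η * G := by
              rw [← h3]
              have : 0 ≤ η' * G := by positivity
              linarith
            have h5 : 0 ≤ η' * ((∑ m, lam m) * (B * G)) := by positivity
            linarith
    have h3 : C' * ∫ ω, z ω ^ 2 ∂P ≤ η * G := by
      rw [Real.norm_of_nonneg (by positivity), Real.norm_of_nonneg hpos.le] at hsq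
      push_cast at hsq
      calc C' * ∫ ω, z ω ^ 2 ∂P ≤ C' * (K / ((n : ℝ) + 1) ^ 2) :=
            mul_le_mul_of_nonneg_left hz hC'.le
        _ = C' * K * (1 / ((n : ℝ) + 1) ^ 2) := by ring
        _ ≤ C' * K * (η / (C' * K) * G) := mul_le_mul_of_nonneg_left hsq (by positivity)
        _ = η * G := by field_simp
    rw [h1]
    have h4 := mul_le_mul_of_nonneg_left h2 (show 0 ≤ 1 + η by positivity)
    linarith
  -- Markov's inequality, applied to the sum of both failure indicators
  set E := {ω | risk Q D (𝐰 n k ω) - risk Q D wo ≤ 1 / ν * G} with hE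
  have hEm : MeasurableSet E :=
    measurableSet_le (((h.bounded.contDiff.continuous.measurable).comp
      (measurable_estimate h n k)).sub_const _) measurable_const
  have hbad : P.real Eᶜ ≤ ∫ ω, ((1 - χ ω) + ν / G * V ω) ∂P := by
    rw [← integral_indicator_one hEm.compl]
    refine integral_mono ((integrable_const (1 : ℝ)).indicator hEm.compl)
      (((integrable_const 1).sub hχi).add (hVi.const_mul _)) fun ω => ?_
    have hχ1 : χ ω ≤ 1 := aliveInd_le_one ω
    have hVν : 0 ≤ ν / G * V ω := mul_nonneg (by positivity) (hV0 ω)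
    by_cases hω : ω ∈ E
    · rw [Set.indicator_of_notMem (by simpa using hω)]
      linarith
    · rw [Set.indicator_of_mem hω, Pi.one_apply]
      by_cases hal : ω ∈ alive (netError 𝐰 wo (fun l => p l)) g n₀ n
      · have hχω : χ ω = 1 := aliveInd_of_mem hal
        have h1 := hgap (𝐰 n k ω) (c ω) (hnear _ (norm_sq_error_le_of_mem_alive hppos hn hal k))
        have h2 := pow_le_pow_left₀ (norm_nonneg _)
          (norm_error_sub_centroid_le (Q := Q) (x := x) (w₀ := w₀) (wo := wo) hp hp1 hμ.le hgeo n k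
            ω) 2
        have h3 : risk Q D (𝐰 n k ω) - risk Q D wo ≤ V ω := by
          simp only [hV, hχω, one_mul]
          exact h1.trans (add_le_add le_rfl (mul_le_mul_of_nonneg_left h2 hC'.le))
        have h4 : 1 / ν * G < V ω := (not_le.1 hω).trans_le h3
        have h5 : 1 ≤ ν / G * V ω := by
          have h6 := mul_le_mul_of_nonneg_left h4.le (show 0 ≤ ν / G by positivity)
          refine le_trans (le_of_eq ?_) h6
          field_simp
        linarith
      · have hχω : χ ω = 0 := aliveInd_of_notMem hal
        rw [hχω]; linarith
  have hfinal : ∫ ω, ((1 - χ ω) + ν / G * V ω) ∂P ≤ ν + ε := by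
    have hχi' : Integrable (fun ω => 1 - χ ω) P := (integrable_const 1).sub hχi
    rw [integral_add hχi' (hVi.const_mul _), integral_const_mul]
    have h1 := hescape n hn
    have h2 : ν / G * ∫ ω, V ω ∂P ≤ ν + ε / 2 := by
      refine (mul_le_mul_of_nonneg_left hVG (by positivity)).trans (le_trans (le_of_eq ?_) hη2)
      field_simp
    linarith
  have h1 := probReal_compl_eq_one_sub (μ := P) hEm
  linarith

end ExcessRisk

end Diffusion

theorem theorem3 {M N : ℕ} {S Ω : Type*} [MeasurableSpace S] [MeasurableSpace Ω]
    -- probability space, data distribution, loss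
    (P : Measure Ω) [IsProbabilityMeasure P] (D : Measure S) [IsProbabilityMeasure D]
    (Q : Diffusion.Param M → S → ℝ)
    (hQint : ∀ w, Integrable (Q w) D)
    (hQdiff : ∀ x, Differentiable ℝ (fun w => Q w x))
    (hQmeas : Measurable (fun z : Diffusion.Param M × S => Diffusion.lossGrad Q z.1 z.2))
    -- independent samples with common distribution, independent initial estimates
    (x : Fin N → ℕ → Ω → S) (hxmeas : ∀ k i, Measurable (x k i))
    (hxlaw : ∀ k i, 1 ≤ i → P.map (x k i) = D)
    (hxind : iIndepFun (fun q : Fin N × ℕ => x q.1 q.2) P)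
    (w₀ : Fin N → Ω → Diffusion.Param M) (hw₀meas : ∀ k, Measurable (w₀ k))
    (hw₀ : ∀ k, MemLp (w₀ k) 2 P)
    (hw₀ind : IndepFun (fun ω k => w₀ k ω) (fun ω (q : Fin N × ℕ) => x q.1 q.2 ω) P)
    -- risk with bounded Hessian, and its minimizer
    (lo hi : ℝ) (hJ : Diffusion.BoundedHessian (Diffusion.risk Q D) lo hi)
    (wo : Diffusion.Param M) (hwo : ∀ w, Diffusion.risk Q D wo ≤ Diffusion.risk Q D w)
    -- combination matrix, its normalized right eigenvector, step-size constant
    (A : Matrix (Fin N) (Fin N) ℝ) (hA : Diffusion.LeftStochasticPrimitive A)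
    (p : EuclideanSpace ℝ (Fin N)) (hp : ∀ l, ∑ k, A l k * p k = p l) (hp1 : ∑ l, p l = 1)
    (μ : ℝ) (hμ : 0 < μ)
    -- gradient noise model along the diffusion recursion with step sizes `μ / i`
    (α σsq : ℝ) (hα : 0 ≤ α) (hσ : 0 < σsq)
    (hnoise : Diffusion.GradientNoiseModel P Q D x
      (Diffusion.estimate Q A (fun i => μ / i) x w₀) wo α σsq)
    -- eigendecomposition of the Hessian at the minimizer
    (lam : Fin M → ℝ) (Φ : Matrix (Fin M) (Fin M) ℝ) (hΦ : Φ ∈ Matrix.orthogonalGroup (Fin M) ℝ)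
    (hH : Diffusion.hessian (Diffusion.risk Q D) wo = Φ * Matrix.diagonal lam * Φᵀ)
    (k : Fin N) :
    (∀ m, 2 * lam m * μ < 1 →
      Summable (Diffusion.hyp3F2Term 1 1 1 (2 - lam m * μ) (2 - lam m * μ) 1)) ∧
    (fun i => Diffusion.asymptoticTerm A (Diffusion.hessian (Diffusion.risk Q D) wo)
        (Diffusion.noiseCov Q D wo) (fun i => μ / i) k i)
      ~[atTop] (fun i => Diffusion.closedForm μ lam Φ (Diffusion.noiseCov Q D wo) p i) ∧
    (Diffusion.noiseCov Q D wo ≠ 0 →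
      Tendsto (fun i => Diffusion.asymptoticTerm A (Diffusion.hessian (Diffusion.risk Q D) wo)
          (Diffusion.noiseCov Q D wo) (fun i => μ / i) k i /
        Diffusion.closedForm μ lam Φ (Diffusion.noiseCov Q D wo) p i) atTop (𝓝 1)) ∧
    (1 ≤ 2 * (⨅ m, lam m) * μ →
      -- the noise covariance is continuous at the minimizer
      ContinuousAt (fun w => Diffusion.noiseCov Q D w) wo →
      -- the noise is not degenerate, so that the closed form dominates the transient term
      (∃ m, (Φᵀ * Diffusion.noiseCov Q D wo * Φ) m m ≠ 0 ∧
        (2 * (⨅ m, lam m) * μ = 1 → lam m = ⨅ m, lam m)) →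
      -- at the threshold only: the Hessian is Hölder continuous at the minimizer
      (2 * (⨅ m, lam m) * μ = 1 → ∃ β : ℝ, 0 < β ∧ ∀ a b,
        (fun w => Diffusion.hessian (Diffusion.risk Q D) w a b -
          Diffusion.hessian (Diffusion.risk Q D) wo a b) =O[𝓝 wo] (fun w => ‖w - wo‖ ^ β)) →
      ∀ ν : ℝ, 0 < ν →
        ENNReal.ofReal (1 - ν) ≤
          liminf (fun i : ℕ => P {ω |
            Diffusion.risk Q D (Diffusion.estimate Q A (fun i => μ / i) x w₀ (i - 1) k ω) -
                Diffusion.risk Q D wo ≤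
              1 / ν * Diffusion.closedForm μ lam Φ (Diffusion.noiseCov Q D wo) p i}) atTop) := by
  have hΦ1 : Φ * Φᵀ = 1 :=
    (Matrix.mem_orthogonalGroup_iff (Fin M) ℝ).1 hΦ
  have hΦ2 : Φᵀ * Φ = 1 :=
    (Matrix.mem_orthogonalGroup_iff' (Fin M) ℝ).1 hΦ
  have hpv : A *ᵥ (fun l => p l) = fun l => p l := funext hp
  have h := Diffusion.model_of_gradientNoiseModel hQmeas hxmeas hxlaw hxind hw₀meas hw₀ hw₀ind hJ
    hwo hα hσ hnoise k
  have hlam : ∀ m, 0 < lam m := fun m =>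
    hJ.lo_pos.trans_le (Diffusion.lo_le_eigenvalue hJ hΦ2 hH m)
  have hR : ∀ m, 0 ≤ (Φᵀ * Diffusion.noiseCov Q D wo * Φ) m m := fun m =>
    h.noiseCov_mode_nonneg m wo
  have hequiv := Diffusion.asymptoticTerm_isEquivalent hA hpv hp1 hΦ2 hΦ1 hH hμ hlam hR k
  refine ⟨fun m hm => Diffusion.summable_hyp3F2Term (by linarith), hequiv, fun hR0 => ?_, ?_⟩
  · obtain ⟨m, hm⟩ := h.exists_noiseCov_mode_ne_zero hΦ1 hR0
    refine (isEquivalent_iff_tendsto_one ?_).1 hequiv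
    filter_upwards [Diffusion.closedForm_eventually_pos hμ hp1 hlam hR hm] with i hi
    exact hi.ne'
  · rintro hL1 hcont ⟨m₀, hm₀, hm₀L⟩ hholder ν hν
    set L := ⨅ m, lam m with hLdef
    have hL : ∀ m, L ≤ lam m := fun m => ciInf_le (Set.finite_range lam).bddBelow m
    -- the exponent of the radius of the localizing balls
    set g := min 1 (2 * lo * μ) / 2 with hg
    have hmin : 0 < min 1 (2 * lo * μ) := lt_min one_pos (by have := hJ.lo_pos; positivity)
    have hg0 : 0 < g := half_pos hmin
    have hg1 : g < 1 := (half_lt_self hmin).trans_le (min_le_left _ _)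
    have hgl : g < 2 * lo * μ := (half_lt_self hmin).trans_le (min_le_right _ _)
    obtain ⟨q, hq0, hq1, hqL, hclose⟩ : ∃ q : ℝ, 0 ≤ q ∧ q ≤ 1 ∧ q < 2 * L * μ ∧
        ∀ K, ∀ ε > 0, ∀ᶠ n : ℕ in atTop, ∀ u : Diffusion.Param M,
          ‖u - wo‖ ^ 2 ≤ K * ((n : ℝ) + 1) ^ (-g) →
            ‖fderiv ℝ (fderiv ℝ (Diffusion.risk Q D)) u -
              fderiv ℝ (fderiv ℝ (Diffusion.risk Q D)) wo‖ ≤ ε * ((n : ℝ) + 1) ^ (q - 1) := by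
      rcases hL1.lt_or_eq with h1 | h1
      · refine ⟨1, zero_le_one, le_rfl, h1, fun K ε hε => ?_⟩
        simpa using Diffusion.eventually_hessian_close hJ hg0 K hε
      · -- at the threshold the energy decays only almost at the rate `1 / n`, and the Hölder
        -- modulus compensates for the loss
        obtain ⟨β, hβ, hh⟩ := hholder h1.symm
        have hr0 : 0 < min (g * β / 4) (1 / 2) := lt_min (by positivity) (by norm_num)
        have hr1 : min (g * β / 4) (1 / 2) < g * β / 2 :=
          (min_le_left _ _).trans_lt (by linarith [mul_pos hg0 hβ])
        have hr2 : min (g * β / 4) (1 / 2) ≤ 1 / 2 := min_le_right _ _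
        refine ⟨1 - min (g * β / 4) (1 / 2), by linarith, by linarith, by linarith,
          fun K ε hε => ?_⟩
        rw [sub_sub_cancel_left]
        exact Diffusion.eventually_hessian_close_of_holder hβ hh hg0 hr1 K hε
    have hmain : ∀ ε > 0, ENNReal.ofReal (1 - ν - ε) ≤ liminf (fun i : ℕ => P {ω |
        Diffusion.risk Q D (Diffusion.estimate Q A (fun i => μ / i) x w₀ (i - 1) k ω) -
            Diffusion.risk Q D wo ≤
          1 / ν * Diffusion.closedForm μ lam Φ (Diffusion.noiseCov Q D wo) p i}) atTop := by
      intro ε hε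
      have h1 := Diffusion.eventually_excess_risk_prob_ge h hA hpv hp1 hμ hΦ2 hΦ1 hH hcont hL hL1
        hq0 hq1 hqL hg0 hg1 hgl hclose hm₀ hm₀L k hν hε
      refine le_liminf_of_le (by isBoundedDefault) ?_
      filter_upwards [(tendsto_sub_atTop_nat 1).eventually h1, eventually_ge_atTop 1] with i hi hi1
      rw [Nat.sub_add_cancel hi1] at hi
      rw [← ofReal_measureReal]
      exact ENNReal.ofReal_le_ofReal hi
    have hlim : Tendsto (fun n : ℕ => ENNReal.ofReal (1 - ν - 1 / ((n : ℝ) + 1))) atTop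
        (𝓝 (ENNReal.ofReal (1 - ν))) := by
      refine ENNReal.tendsto_ofReal ?_
      simpa using (tendsto_one_div_add_atTop_nhds_zero_nat (𝕜 := ℝ)).const_sub (1 - ν)
    exact le_of_tendsto' hlim fun n => hmain _ (by positivity)
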